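/- Notation. Work on $\mathbb{R}^2\times\mathbb{R}$, with Fourier variables $(\xi,\tau)$ and $\hat f(\xi,\tau)=\int e^{-i(x\cdot\xi+t\tau)}f\,dx\,dt$; put $|(\xi,\tau)|=(|\tau|+|\xi|^2)^{1/2}$, $\langle x\rangle=(1+x^2)^{1/2}$ and $$\|f\|_{X^{s,b}}=\big\|\langle(\xi,\tau)\rangle^{s}\langle\tau-|\xi|^2\rangle^{b}\hat f\big\|_{L^2}.$$ Fix a smooth nonnegative $\varphi_0:[0,\infty)\to\mathbb{R}$ with $\varphi_0=1$ on $[0,1]$ and $\varphi_0=0$ on $[2,\infty)$, and let $\varphi_i(x)=\varphi_0(2^{-i}x)-\varphi_0(2^{-i+1}x)$ for integers $i\ge1$. For an integer $i\ge 0$ and $d\in I_i=\{2^{-i},2^{-i+1},\dots,2^{i+2}\}$ let $A_{i,d}$ be the support of $\varphi_i(|(\xi,\tau)|)\,\varphi_{i+\log_2 d}(|\tau-|\xi|^2|)$, and let $X^{s,b}_{i,d}$ be the space of $f\in X^{s,b}$ with $\hat f$ supported in $A_{i,d}$. For $F$ which is not localized, $\|F\|_{X^{s,b}_{i,d}}$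 means $\|\mathcal{F}^{-1}(\chi_{A_{i,d}}\hat F)\|_{X^{s,b}}$. Fix complex constants $c_{ab}$ and let $B(u,v)=\sum_{a,b\in\{1,2\}}c_{ab}\,u_{x_a}v_{x_b}$. Proposition. There is a constant $C$, depending only on $\varphi_0$ and the $c_{ab}$, such that the following holds for all $u\in X^{0,1/2}_{i,d_1}$ and $v\in X^{0,1/2}_{j,d_2}$. (a) Let $1\le i\le j$, $d_1\in I_i$, $d_2,d_3\in I_j$, and assume that $d_1\le 2^{i-3}$ in case $i\le j-5$. Then $$\|B(u,v)\|_{X^{0,-1/2}_{j,d_3}}\le C\,2^{3i/2}\max(d_2,d_3)^{-1/2}\,\|u\|_{X^{0,1/2}_{i,d_1}}\|v\|_{X^{0,1/2}_{j,d_2}},$$ $$\|B(u,v)\|_{X^{0,-1/2}_{j,d_3}}\le C\,2^{(i+j)/2}\,\|u\|_{X^{0,1/2}_{i,d_1}}\|v\|_{X^{0,1/2}_{j,d_2}}.$$ (b) Let $i,j,k\ge0$, $|i-j|\le1$, $k\le j-1$, $d_1\in I_i$, $d_2\in I_j$, $d_3\in I_k$. If $d_3\le 2^{k-2}$ in case $k\le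 j-5$, then $$\|B(u,v)\|_{X^{0,-1/2}_{k,d_3}}\le C\,2^{k/2+j}\max(d_1,d_2)^{-1/2}\,\|u\|_{X^{0,1/2}_{i,d_1}}\|v\|_{X^{0,1/2}_{j,d_2}}.$$ If $d_3\le 2^{k-3}$ in case $k\le j-5$, then $$\|B(u,v)\|_{X^{0,-1/2}_{k,d_3}}\le C\,2^{(3j-k)/2}\,\|u\|_{X^{0,1/2}_{i,d_1}}\|v\|_{X^{0,1/2}_{j,d_2}}.$$ All four estimates also hold, under the same restrictions, with $B(\bar u,v)$ or $B(u,\bar v)$ in place of $B(u,v)$. -/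

import Mathlib

open MeasureTheory
open scoped ContDiff SchwartzMap ComplexConjugate ENNReal InnerProductSpace

noncomputable section

namespace SchrodingerBilinear

/-- Space-time `ℝ² × ℝ`, on the physical side with points `(x₁, x₂, t)` and on the Fourier side
with points `(ξ₁, ξ₂, τ)`; coordinates `0, 1` are the spatial ones, coordinate `2` is time. -/
abbrev SpaceTime : Type := EuclideanSpace ℝ (Fin 3)

/-- `|ξ|²` for `ζ = (ξ, τ)`. -/
def xiSq (ζ : SpaceTime) : ℝ := (ζ 0) ^ 2 + (ζ 1) ^ 2

/-- The anisotropic size `|(ξ, τ)| = (|τ| + ξ²)^{1/2}`. -/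
def parabolicNorm (ζ : SpaceTime) : ℝ := Real.sqrt (|ζ 2| + xiSq ζ)

/-- The modulation `τ - ξ²`. -/
def modulation (ζ : SpaceTime) : ℝ := ζ 2 - xiSq ζ

/-- The Japanese bracket `⟨x⟩ = (1 + x²)^{1/2}`. -/
def bracket (x : ℝ) : ℝ := Real.sqrt (1 + x ^ 2)

/-- The weight `⟨(ξ, τ)⟩^s ⟨τ - ξ²⟩^b`. -/
def weight (s b : ℝ) (ζ : SpaceTime) : ℝ :=
  bracket (parabolicNorm ζ) ^ s * bracket (modulation ζ) ^ b

/-- The function `φ₀ : [0, ∞) → ℝ`: nonnegative, smooth, equal to `1` on `[0, 1]` and to `0` on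
`[2, ∞)`. Only its values on `[0, ∞)` are ever used. -/
structure IsCutoff (φ₀ : ℝ → ℝ) : Prop where
  smooth : ContDiffOn ℝ ∞ φ₀ (Set.Ici 0)
  nonneg : ∀ x, 0 ≤ x → 0 ≤ φ₀ x
  eq_one : ∀ x, 0 ≤ x → x ≤ 1 → φ₀ x = 1
  eq_zero : ∀ x, 2 ≤ x → φ₀ x = 0

/-- `φ₀` itself for `i = 0`, and `φᵢ(x) = φ₀(2^{-i} x) - φ₀(2^{-i+1} x)` for `i ≥ 1`. -/
def dyadicCutoff (φ₀ : ℝ → ℝ) (i : ℕ) (x : ℝ) : ℝ :=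
  if i = 0 then φ₀ x else φ₀ ((2 : ℝ) ^ (-(i : ℤ)) * x) - φ₀ ((2 : ℝ) ^ (-(i : ℤ) + 1) * x)

/-- The exponents `ℓ` of the dyadic numbers `d = 2^ℓ` in `Iᵢ = {2^{-i}, 2^{-i+1}, …, 2^{i+2}}`. -/
def exponents (i : ℕ) : Set ℤ := Set.Icc (-(i : ℤ)) ((i : ℤ) + 2)

/-- `φ_{i,d}(ξ, τ) = φᵢ(|(ξ, τ)|) φ_{i + log₂ d}(|τ - ξ²|)` for `d = 2^ℓ`, `ℓ ∈ exponents i`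
(so that `i + ℓ ≥ 0`). -/
def pieceCutoff (φ₀ : ℝ → ℝ) (i : ℕ) (ℓ : ℤ) (ζ : SpaceTime) : ℝ :=
  dyadicCutoff φ₀ i (parabolicNorm ζ) * dyadicCutoff φ₀ ((i : ℤ) + ℓ).toNat |modulation ζ|

/-- `A_{i,d}`, the (closed) support of `φ_{i,d}`, `d = 2^ℓ`. -/
def region (φ₀ : ℝ → ℝ) (i : ℕ) (ℓ : ℤ) : Set SpaceTime := tsupport (pieceCutoff φ₀ i ℓ)

/-- The Fourier transform `ψ̂(ζ) = ∫ e^{-i z·ζ} ψ(z) dz` of a Schwartz function, in the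
normalization for which free waves of `i u_t - Δ u = 0` live on the paraboloid `τ = ξ²`. -/
def fourierSchwartz (ψ : 𝓢(SpaceTime, ℂ)) (ζ : SpaceTime) : ℂ :=
  ∫ z, Complex.exp (-(Complex.I * ((⟪z, ζ⟫_ℝ : ℝ) : ℂ))) * ψ z

/-- `û = g` in the sense of tempered distributions: `∫ u ψ̂ = ∫ g ψ` for all Schwartz `ψ`. -/
def IsFourierTransform (u g : SpaceTime → ℂ) : Prop :=
  ∀ ψ : 𝓢(SpaceTime, ℂ),
    Integrable (fun z => u z * fourierSchwartz ψ z) ∧ Integrable (fun ζ => g ζ * ψ ζ) ∧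
      ∫ z, u z * fourierSchwartz ψ z = ∫ ζ, g ζ * ψ ζ

/-- `‖⟨(ξ, τ)⟩^s ⟨τ - ξ²⟩^b g‖_{L²}`. -/
def weightedL2 (s b : ℝ) (g : SpaceTime → ℂ) : ℝ≥0∞ :=
  eLpNorm (fun ζ => (weight s b ζ : ℂ) * g ζ) 2 volume

/-- The norm of `X^{s,b}`, with value `∞` when `û` is not a function. The function `û` is unique
up to null sets, so the infimum only serves to select it. -/
def normX (s b : ℝ) (u : SpaceTime → ℂ) : ℝ≥0∞ :=
  ⨅ (g : SpaceTime → ℂ) (_ : IsFourierTransform u g), weightedL2 s b g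

/-- `u ∈ X^{s,b}_{i,d}`, `d = 2^ℓ`: `u` is in `X^{s,b}` and `û` is supported in `A_{i,d}`.
As `A_{i,d}` is compact, a tempered distribution with this property is a smooth function, and
it is this smooth representative that we work with. -/
def MemXPiece (φ₀ : ℝ → ℝ) (s b : ℝ) (i : ℕ) (ℓ : ℤ) (u : SpaceTime → ℂ) : Prop :=
  ContDiff ℝ ∞ u ∧
    ∃ g : SpaceTime → ℂ, IsFourierTransform u g ∧ weightedL2 s b g < ⊤ ∧
      ∀ᵐ ζ ∂(volume : Measure SpaceTime), ζ ∉ region φ₀ i ℓ → g ζ = 0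

/-- `‖F‖_{X^{s,b}_{i,d}}`, `d = 2^ℓ`, for an `F` that need not be localized: the `X^{s,b}` norm of
the part `𝓕⁻¹(χ_{A_{i,d}} 𝓕 F)` of `F`, with value `∞` when `𝓕 F` is not a function. -/
def normXPiece (φ₀ : ℝ → ℝ) (s b : ℝ) (i : ℕ) (ℓ : ℤ) (F : SpaceTime → ℂ) : ℝ≥0∞ :=
  ⨅ (g : SpaceTime → ℂ) (_ : IsFourierTransform F g),
    weightedL2 s b ((region φ₀ i ℓ).indicator g)

/-- The spatial derivative `u_{x_a}`, `a ∈ {1, 2}` (indexed by `Fin 2`). -/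
def spatialDeriv (a : Fin 2) (u : SpaceTime → ℂ) (z : SpaceTime) : ℂ :=
  fderiv ℝ u z (EuclideanSpace.single a.castSucc (1 : ℝ))

/-- The bilinear form `B(u, v) = ∑_{a,b ∈ {1,2}} c_{ab} u_{x_a} v_{x_b}`. -/
def bilinearB (c : Fin 2 → Fin 2 → ℂ) (u v : SpaceTime → ℂ) (z : SpaceTime) : ℂ :=
  ∑ a : Fin 2, ∑ b : Fin 2, c a b * spatialDeriv a u z * spatialDeriv b v z

/-- The complex conjugate `ū` of a function. -/
def conjFun (u : SpaceTime → ℂ) (z : SpaceTime) : ℂ := conj (u z)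

/-- `B(u, v)`, `B(ū, v)` and `B(u, v̄)` are all bounded by `K ‖u‖ ‖v‖`, with
`u ∈ X^{0,1/2}_{i,d₁}`, `v ∈ X^{0,1/2}_{j,d₂}` and the output measured in `X^{0,-1/2}_{k,d₃}`,
where `d₁ = 2^ℓ₁`, `d₂ = 2^ℓ₂`, `d₃ = 2^ℓ₃`. -/
def BilinearBound (φ₀ : ℝ → ℝ) (c : Fin 2 → Fin 2 → ℂ) (i j k : ℕ) (ℓ₁ ℓ₂ ℓ₃ : ℤ) (K : ℝ) :
    Prop :=
  ∀ u v : SpaceTime → ℂ, MemXPiece φ₀ 0 (1 / 2) i ℓ₁ u → MemXPiece φ₀ 0 (1 / 2) j ℓ₂ v →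
    ∀ F ∈ ({bilinearB c u v, bilinearB c (conjFun u) v, bilinearB c u (conjFun v)} :
        Set (SpaceTime → ℂ)),
      normXPiece φ₀ 0 (-(1 / 2)) k ℓ₃ F
        ≤ ENNReal.ofReal K * normX 0 (1 / 2) u * normX 0 (1 / 2) v

end SchrodingerBilinear

end

/-! On `A_{i,d}` the modulation `τ - |ξ|²` has size about `M = 2^i d`. For functions localized there
the `X^{0,±1/2}` norms are, up to constants, `M^{±1/2}` times the `L²` norm of the Fourier
transform, and the derivatives in `B` cost a factor `2^i 2^j`. By duality (`l2_indicator_lconv_le`)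
everything reduces to bounding `∫∫ f₁(x) f₂(y) f₃(x + y)` by `κ^{1/2} ‖f₁‖ ‖f₂‖ ‖f₃‖`, with `x`,
`y`, `x + y` in three prescribed pieces. Two applications of Cauchy-Schwarz bound `κ` by a volume
(`triBound_of_measure_le`). Conjugating a factor reflects its support, and `TriBound.reflect` turns
this into an interchange of that factor's partner with the sum. So it only matters whether the low
frequency is a summand or the sum.

Let `N ≤ H` be the low and high frequency sizes, `M₁` the low modulation and `M₂, M₃` the high ones.
The target estimates follow from `κ ≲ M₁ min(M₂, M₃) N / H` and `κ ≲ M₁ M₂ M₃ / (N H)`.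

The first uses two modulation constraints (`volume_translate_le`, `volume_reflect_le`). Once the
modulation of the low variable is fixed, the other constraint cuts its spatial frequency down to a
strip, or to a piece of an annulus, of area about `M N / H`.

The second follows from the first if `M₂` or `M₃` is at least `N²/64`. Otherwise the identity
`modulation (x + y) = modulation x + modulation y - 2 x·y` controls `x·y`, and all three constraints
are used at once (`volume_transversal_le`); the gain is the reciprocal of a cross product of spatial
frequencies. For comparable frequencies with small modulations, `x` and `y` are almost orthogonal,
which gives transversality (`sqBound_comparable`). If the sum is the low frequency and `N ≪ H`, no
pair exists, since `τ = |ξ|²` is positive on both factors. The delicate case is a low summand with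
`N ≪ H` close to the `τ`-axis (`sqBound_low_high_axis`). There `M₁ ≤ N²/8`, which is what `d ≤
2^{i-3}` says for the low frequency, forces its modulation to within `2|ξ|²` of `±N²/4`. This
narrower window compensates for the smaller cross product, and the dyadic sum over `|ξ|` converges
geometrically. The remaining almost parallel pairs are split into angular sectors, which are almost
orthogonal (`sqBound_collinear_chart`). -/

namespace SchrodingerBilinear

/-! ### Trilinear convolution forms restricted to a set of pairs -/

section L2

variable {G : Type*} [MeasurableSpace G] (μ : Measure G)

/-- The `L²` norm of a nonnegative function. -/
noncomputable def l2 (f : G → ℝ≥0∞) : ℝ≥0∞ := (∫⁻ x, f x ^ (2 : ℝ) ∂μ) ^ (1 / 2 : ℝ)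

variable {μ}

lemma mul_le_half_add_sq (a b : ℝ≥0∞) : 2 * (a * b) ≤ a ^ (2 : ℝ) + b ^ (2 : ℝ) := by
  rcases eq_or_ne a ⊤ with rfl | ha
  · simp
  rcases eq_or_ne b ⊤ with rfl | hb
  · simp
  lift a to NNReal using ha
  lift b to NNReal using hb
  norm_cast
  rw [← mul_assoc]
  exact two_mul_le_add_sq a b

lemma lintegral_mul_le_l2 {f g : G → ℝ≥0∞} (hf : Measurable f) (hg : Measurable g) :
    ∫⁻ x, f x * g x ∂μ ≤ l2 μ f * l2 μ g :=
  ENNReal.lintegral_mul_le_Lp_mul_Lq μ (Real.HolderConjugate.two_two) hf.aemeasurable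
    hg.aemeasurable

lemma l2_sq (f : G → ℝ≥0∞) : l2 μ f ^ (2 : ℝ) = ∫⁻ x, f x ^ (2 : ℝ) ∂μ := by
  unfold l2; rw [← ENNReal.rpow_mul]; norm_num

end L2

section Trilinear

variable {G : Type*} [AddCommGroup G] [MeasurableSpace G] (μ : Measure G)

/-- The trilinear form `∫∫_E f₁(x) f₂(y) f₃(x + y)`. -/
noncomputable def triForm (E : Set (G × G)) (f₁ f₂ f₃ : G → ℝ≥0∞) : ℝ≥0∞ :=
  ∫⁻ x, ∫⁻ y, E.indicator 1 (x, y) * (f₁ x * f₂ y * f₃ (x + y)) ∂μ ∂μ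

/-- The trilinear form restricted to `E` is bounded on `L² × L² × L²` with constant `K`. -/
def TriBound (E : Set (G × G)) (K : ℝ≥0∞) : Prop :=
  ∀ f₁ f₂ f₃ : G → ℝ≥0∞, Measurable f₁ → Measurable f₂ → Measurable f₃ →
    triForm μ E f₁ f₂ f₃ ≤ K * (l2 μ f₁ * l2 μ f₂ * l2 μ f₃)

variable {μ}

lemma TriBound.mono {E F : Set (G × G)} {K L : ℝ≥0∞} (h : TriBound μ F K) (hEF : E ⊆ F)
    (hKL : K ≤ L) : TriBound μ E L := by
  intro f₁ f₂ f₃ h₁ h₂ h₃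
  calc triForm μ E f₁ f₂ f₃ ≤ triForm μ F f₁ f₂ f₃ := by
        unfold triForm
        gcongr with x y
    _ ≤ _ := h f₁ f₂ f₃ h₁ h₂ h₃
    _ ≤ _ := by gcongr

variable [MeasurableAdd₂ G] [SFinite μ]

lemma measurable_triForm_integrand {E : Set (G × G)} (hE : MeasurableSet E)
    {f₁ f₂ f₃ : G → ℝ≥0∞} (h₁ : Measurable f₁) (h₂ : Measurable f₂) (h₃ : Measurable f₃) :
    Measurable fun p : G × G =>
      E.indicator (1 : G × G → ℝ≥0∞) (p.1, p.2) * (f₁ p.1 * f₂ p.2 * f₃ (p.1 + p.2)) := by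
  have he : Measurable (E.indicator (1 : G × G → ℝ≥0∞)) := measurable_one.indicator hE
  fun_prop

lemma measurable_triForm_slice {E : Set (G × G)} (hE : MeasurableSet E)
    {f₁ f₂ f₃ : G → ℝ≥0∞} (h₁ : Measurable f₁) (h₂ : Measurable f₂) (h₃ : Measurable f₃) (x : G) :
    Measurable fun y : G =>
      E.indicator (1 : G × G → ℝ≥0∞) (x, y) * (f₁ x * f₂ y * f₃ (x + y)) :=
  (measurable_triForm_integrand hE h₁ h₂ h₃).comp measurable_prodMk_left

lemma TriBound.iUnion {E : ℕ → Set (G × G)} {K : ℕ → ℝ≥0∞} (hE : ∀ n, MeasurableSet (E n))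
    (h : ∀ n, TriBound μ (E n) (K n)) : TriBound μ (⋃ n, E n) (∑' n, K n) := by
  intro f₁ f₂ f₃ h₁ h₂ h₃
  calc triForm μ (⋃ n, E n) f₁ f₂ f₃ ≤ ∑' n, triForm μ (E n) f₁ f₂ f₃ := by
        unfold triForm
        rw [← lintegral_tsum fun n =>
          (measurable_triForm_integrand (hE n) h₁ h₂ h₃).lintegral_prod_right'.aemeasurable]
        gcongr with x
        dsimp only
        rw [← lintegral_tsum fun n => (measurable_triForm_slice (hE n) h₁ h₂ h₃ x).aemeasurable]
        gcongr with y
        rw [ENNReal.tsum_mul_right]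
        gcongr
        by_cases hxy : (x, y) ∈ ⋃ n, E n
        · obtain ⟨n, hn⟩ := Set.mem_iUnion.1 hxy
          refine le_trans ?_ (ENNReal.le_tsum n)
          simp [hxy, hn]
        · simp [hxy]
    _ ≤ ∑' n, K n * (l2 μ f₁ * l2 μ f₂ * l2 μ f₃) := by
        gcongr with n; exact h n f₁ f₂ f₃ h₁ h₂ h₃
    _ = _ := ENNReal.tsum_mul_right

lemma TriBound.union {E F : Set (G × G)} {K L : ℝ≥0∞} (hE : MeasurableSet E)
    (h : TriBound μ E K) (h' : TriBound μ F L) :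
    TriBound μ (E ∪ F) (K + L) := by
  intro f₁ f₂ f₃ h₁ h₂ h₃
  calc triForm μ (E ∪ F) f₁ f₂ f₃ ≤ triForm μ E f₁ f₂ f₃ + triForm μ F f₁ f₂ f₃ := by
        unfold triForm
        rw [← lintegral_add_left
          (measurable_triForm_integrand hE h₁ h₂ h₃).lintegral_prod_right']
        gcongr with x
        dsimp only
        rw [← lintegral_add_left (measurable_triForm_slice hE h₁ h₂ h₃ x)]
        gcongr with y
        rw [← add_mul]
        gcongr
        by_cases hx : (x, y) ∈ E <;> by_cases hy : (x, y) ∈ F <;> simp [hx, hy]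
    _ ≤ _ := add_le_add (h _ _ _ h₁ h₂ h₃) (h' _ _ _ h₁ h₂ h₃)
    _ = _ := by ring

lemma TriBound.swap {E : Set (G × G)} {K : ℝ≥0∞} (hE : MeasurableSet E) (h : TriBound μ E K) :
    TriBound μ (Prod.swap ⁻¹' E) K := by
  intro f₁ f₂ f₃ h₁ h₂ h₃
  have := h f₂ f₁ f₃ h₂ h₁ h₃
  unfold triForm at this ⊢
  rw [lintegral_lintegral_swap (measurable_triForm_integrand hE h₂ h₁ h₃).aemeasurable] at this
  calc _ = ∫⁻ y, ∫⁻ x, E.indicator 1 (x, y) * (f₂ x * f₁ y * f₃ (x + y)) ∂μ ∂μ := by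
        refine lintegral_congr fun x => lintegral_congr fun y => ?_
        rw [mul_comm (f₁ x), add_comm x y]; rfl
    _ ≤ _ := this
    _ = _ := by ring

/-- Almost orthogonality: if labels of the second and third variable agree on `E`, it is enough
to bound the pieces with a fixed label. -/
lemma triBound_of_labels {E : Set (G × G)} (hE : MeasurableSet E) {K : ℝ≥0∞} {p q : G → ℤ}
    (hp : Measurable p) (hq : Measurable q) (hpq : ∀ x y, (x, y) ∈ E → q (x + y) = p y)
    (h : ∀ n, TriBound μ (E ∩ {z | p z.2 = n}) K) : TriBound μ E K := by
  intro f₁ f₂ f₃ h₁ h₂ h₃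
  -- A piece of `f₂` meets only the piece of `f₃` with the same label. The squared norms of the
  -- pieces add up to the whole, so Cauchy-Schwarz over the labels loses nothing.
  set F₂ : ℤ → G → ℝ≥0∞ := fun n => (p ⁻¹' {n}).indicator f₂ with hF₂
  set F₃ : ℤ → G → ℝ≥0∞ := fun n => (q ⁻¹' {n}).indicator f₃ with hF₃
  have m₂ : ∀ n, Measurable (F₂ n) := fun n => h₂.indicator (hp (measurableSet_singleton n))
  have m₃ : ∀ n, Measurable (F₃ n) := fun n => h₃.indicator (hq (measurableSet_singleton n))
  have hl2 : ∀ (r : G → ℤ) (f : G → ℝ≥0∞), Measurable r → Measurable f →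
      ∑' n, l2 μ ((r ⁻¹' {n}).indicator f) ^ (2 : ℝ) = l2 μ f ^ (2 : ℝ) := by
    intro r f hr hf
    simp only [l2_sq]
    rw [← lintegral_tsum fun n =>
      ((hf.indicator (hr (measurableSet_singleton n))).pow_const _).aemeasurable]
    refine lintegral_congr fun x => ?_
    rw [tsum_eq_single (r x)]
    · simp
    · intro n hn
      rw [Set.indicator_of_notMem (by simpa using hn.symm)]
      simp
  have hEn : ∀ n, MeasurableSet (E ∩ {z | p z.2 = n}) := fun n =>
    hE.inter ((hp.comp measurable_snd) (measurableSet_singleton n))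
  calc triForm μ E f₁ f₂ f₃ ≤ ∑' n, triForm μ (E ∩ {z | p z.2 = n}) f₁ (F₂ n) (F₃ n) := by
        unfold triForm
        rw [← lintegral_tsum fun n => (measurable_triForm_integrand (hEn n) h₁ (m₂ n)
          (m₃ n)).lintegral_prod_right'.aemeasurable]
        gcongr with x
        dsimp only
        rw [← lintegral_tsum fun n =>
          (measurable_triForm_slice (hEn n) h₁ (m₂ n) (m₃ n) x).aemeasurable]
        gcongr with y
        by_cases hxy : (x, y) ∈ E
        · refine le_trans (le_of_eq ?_) (ENNReal.le_tsum (p y))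
          simp [hxy, hF₂, hF₃, hpq x y hxy]
        · simp [hxy]
    _ ≤ ∑' n, K * (l2 μ f₁ * l2 μ (F₂ n) * l2 μ (F₃ n)) := by
        gcongr with n; exact h n _ _ _ h₁ (m₂ n) (m₃ n)
    _ = K * l2 μ f₁ * ∑' n, l2 μ (F₂ n) * l2 μ (F₃ n) := by
        rw [← ENNReal.tsum_mul_left]; congr 1; ext n; ring
    _ ≤ K * l2 μ f₁ * (l2 μ f₂ * l2 μ f₃) := by
        gcongr
        have := ENNReal.lintegral_mul_le_Lp_mul_Lq (Measure.count : Measure ℤ)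
          (Real.HolderConjugate.two_two) (f := fun n => l2 μ (F₂ n)) (g := fun n => l2 μ (F₃ n))
          (Measurable.of_discrete).aemeasurable (Measurable.of_discrete).aemeasurable
        simp only [lintegral_count, Pi.mul_apply, hF₂, hF₃, hl2 p f₂ hp h₂, hl2 q f₃ hq h₃,
          ← ENNReal.rpow_mul] at this
        simpa using this
    _ = _ := by ring

variable [MeasurableNeg G] [μ.IsAddLeftInvariant]

/-- Cauchy--Schwarz in the second variable, followed by Cauchy--Schwarz in the pair of first
variables with crossed arguments. -/
lemma triBound_of_measure_le {E : Set (G × G)} (hE : MeasurableSet E) {κ : ℝ≥0∞}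
    (h : ∀ x w, μ {y | (x, y) ∈ E ∧ (w - y, y) ∈ E} ≤ κ) : TriBound μ E (κ ^ (1 / 2 : ℝ)) := by
  intro f₁ f₂ f₃ h₁ h₂ h₃
  set e : G × G → ℝ≥0∞ := E.indicator 1 with he_def
  have he : Measurable e := measurable_one.indicator hE
  have hsub : Measurable fun p : G × G => p.1 - p.2 := by
    simp only [sub_eq_add_neg]; fun_prop
  set P : G → ℝ≥0∞ := fun y => ∫⁻ x, e (x, y) * (f₁ x * f₃ (x + y)) ∂μ with hP_def
  have hPint : Measurable fun p : G × G => e (p.2, p.1) * (f₁ p.2 * f₃ (p.2 + p.1)) := by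
    fun_prop
  have hP : Measurable P := hPint.lintegral_prod_right'
  have hT : triForm μ E f₁ f₂ f₃ = ∫⁻ y, f₂ y * P y ∂μ := by
    unfold triForm
    rw [lintegral_lintegral_swap (measurable_triForm_integrand hE h₁ h₂ h₃).aemeasurable]
    refine lintegral_congr fun y => ?_
    have hm : Measurable fun x => e (x, y) * (f₁ x * f₃ (x + y)) :=
      hPint.comp measurable_prodMk_left
    rw [hP_def, ← lintegral_const_mul _ hm]
    refine lintegral_congr fun x => ?_
    simp only [he_def]; ring
  -- Expanding `P y ^ 2` gives a double integral in `x` and `x'`. The factors are paired crosswise,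
  -- `f₁ x` with `f₃ (x' + y)`, so that after the arithmetic-geometric inequality the substitution
  -- `w = x' + y` leaves squares that do not depend on `y`.
  set J : ℝ≥0∞ := ∫⁻ y, ∫⁻ x, ∫⁻ x', e (x, y) * e (x', y) *
      (f₁ x * f₃ (x' + y)) ^ (2 : ℝ) ∂μ ∂μ ∂μ with hJ
  have hsq : ∀ y, P y ^ (2 : ℝ) = ∫⁻ x, ∫⁻ x', e (x, y) * e (x', y) *
      ((f₁ x * f₃ (x' + y)) * (f₁ x' * f₃ (x + y))) ∂μ ∂μ := by
    intro y
    have hm : Measurable fun x => e (x, y) * (f₁ x * f₃ (x + y)) :=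
      hPint.comp measurable_prodMk_left
    rw [ENNReal.rpow_two, sq, hP_def]
    simp only
    rw [← lintegral_mul_const _ hm]
    refine lintegral_congr fun x => ?_
    rw [← lintegral_const_mul _ hm]
    refine lintegral_congr fun x' => ?_
    ring
  have hA : Measurable fun q : (G × G) × G => e (q.1.2, q.1.1) * e (q.2, q.1.1) *
      (f₁ q.1.2 * f₃ (q.2 + q.1.1)) ^ (2 : ℝ) := by fun_prop
  have hB : Measurable fun q : (G × G) × G => e (q.1.2, q.1.1) * e (q.2, q.1.1) *
      (f₁ q.2 * f₃ (q.1.2 + q.1.1)) ^ (2 : ℝ) := by fun_prop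
  have hPJ : 2 * ∫⁻ y, P y ^ (2 : ℝ) ∂μ ≤ 2 * J := by
    calc 2 * ∫⁻ y, P y ^ (2 : ℝ) ∂μ
        ≤ ∫⁻ y, ∫⁻ x, ∫⁻ x', (e (x, y) * e (x', y) * (f₁ x * f₃ (x' + y)) ^ (2 : ℝ) +
            e (x, y) * e (x', y) * (f₁ x' * f₃ (x + y)) ^ (2 : ℝ)) ∂μ ∂μ ∂μ := by
          rw [← lintegral_const_mul _ (hP.pow_const _)]
          refine lintegral_mono fun y => ?_
          rw [hsq, ← lintegral_const_mul' _ _ (by simp)]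
          refine lintegral_mono fun x => ?_
          rw [← lintegral_const_mul' _ _ (by simp)]
          refine lintegral_mono fun x' => ?_
          rw [← mul_add, mul_left_comm]
          exact mul_le_mul_right (mul_le_half_add_sq _ _) _
      _ = J + ∫⁻ y, ∫⁻ x, ∫⁻ x', e (x, y) * e (x', y) *
            (f₁ x' * f₃ (x + y)) ^ (2 : ℝ) ∂μ ∂μ ∂μ := by
          rw [hJ, ← lintegral_add_left hA.lintegral_prod_right'.lintegral_prod_right']
          refine lintegral_congr fun y => ?_
          have hAy : Measurable fun x => ∫⁻ x', e (x, y) * e (x', y) *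
              (f₁ x * f₃ (x' + y)) ^ (2 : ℝ) ∂μ :=
            hA.lintegral_prod_right'.comp (measurable_prodMk_left (x := y))
          rw [← lintegral_add_left hAy]
          refine lintegral_congr fun x => ?_
          exact lintegral_add_left (hA.comp (measurable_prodMk_left (x := (y, x)))) _
      _ = 2 * J := by
          rw [two_mul]
          congr 1
          refine lintegral_congr fun y => ?_
          rw [lintegral_lintegral_swap]
          · refine lintegral_congr fun x => lintegral_congr fun x' => ?_
            ring
          · have : Measurable fun q : G × G => e (q.1, y) * e (q.2, y) *
              (f₁ q.2 * f₃ (q.1 + y)) ^ (2 : ℝ) := by fun_prop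
            exact this.aemeasurable
  have hJle : J ≤ κ * (l2 μ f₁ ^ (2 : ℝ) * l2 μ f₃ ^ (2 : ℝ)) := by
    have h1 : J = ∫⁻ x, ∫⁻ y, ∫⁻ w, e (x, y) * e (w - y, y) *
        (f₁ x ^ (2 : ℝ) * f₃ w ^ (2 : ℝ)) ∂μ ∂μ ∂μ := by
      rw [hJ, lintegral_lintegral_swap hA.lintegral_prod_right'.aemeasurable]
      refine lintegral_congr fun x => lintegral_congr fun y => ?_
      rw [← lintegral_sub_right_eq_self _ y]
      refine lintegral_congr fun w => ?_
      rw [sub_add_cancel, ENNReal.mul_rpow_of_nonneg _ _ (by norm_num)]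
    rw [h1]
    calc _ = ∫⁻ x, ∫⁻ w, (f₁ x ^ (2 : ℝ) * f₃ w ^ (2 : ℝ)) *
          μ {y | (x, y) ∈ E ∧ (w - y, y) ∈ E} ∂μ ∂μ := by
          refine lintegral_congr fun x => ?_
          have hC : Measurable fun q : G × G => e (x, q.1) * e (q.2 - q.1, q.1) *
            (f₁ x ^ (2 : ℝ) * f₃ q.2 ^ (2 : ℝ)) := by
            have : Measurable fun q : G × G => q.2 - q.1 := hsub.comp measurable_swap
            fun_prop
          rw [lintegral_lintegral_swap hC.aemeasurable]
          refine lintegral_congr fun w => ?_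
          have hms : MeasurableSet {y | (x, y) ∈ E ∧ (w - y, y) ∈ E} :=
            (hE.preimage (by fun_prop)).inter (hE.preimage (by
              have : Measurable fun y => w - y := hsub.comp measurable_prodMk_left
              fun_prop))
          rw [← lintegral_indicator_one hms, ← lintegral_const_mul _ (measurable_one.indicator hms)]
          refine lintegral_congr fun y => ?_
          rw [mul_comm]
          congr 1
          by_cases ha : (x, y) ∈ E <;> by_cases hb : (w - y, y) ∈ E <;> simp [he_def, ha, hb]
      _ ≤ ∫⁻ x, ∫⁻ w, (f₁ x ^ (2 : ℝ) * f₃ w ^ (2 : ℝ)) * κ ∂μ ∂μ := by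
          gcongr with x w; exact h x w
      _ = _ := by
          rw [l2_sq, l2_sq, ← lintegral_mul_const _ (h₁.pow_const _),
            ← lintegral_const_mul _ (by fun_prop)]
          refine lintegral_congr fun x => ?_
          rw [← lintegral_const_mul _ (by fun_prop), ← lintegral_const_mul _ (by fun_prop)]
          refine lintegral_congr fun w => ?_
          ring
  have hPκ : l2 μ P ≤ κ ^ (1 / 2 : ℝ) * (l2 μ f₁ * l2 μ f₃) := by
    have h2 : ∫⁻ y, P y ^ (2 : ℝ) ∂μ ≤ J :=
      (ENNReal.mul_le_mul_iff_right (by simp) (by simp)).1 hPJ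
    calc l2 μ P ≤ (κ * (l2 μ f₁ ^ (2 : ℝ) * l2 μ f₃ ^ (2 : ℝ))) ^ (1 / 2 : ℝ) :=
          ENNReal.rpow_le_rpow (h2.trans hJle) (by norm_num)
      _ = _ := by
          rw [ENNReal.mul_rpow_of_nonneg _ _ (by norm_num),
            ENNReal.mul_rpow_of_nonneg _ _ (by norm_num), ← ENNReal.rpow_mul,
            ← ENNReal.rpow_mul]
          norm_num
  calc triForm μ E f₁ f₂ f₃ ≤ l2 μ f₂ * l2 μ P := hT ▸ lintegral_mul_le_l2 h₂ hP
    _ ≤ l2 μ f₂ * (κ ^ (1 / 2 : ℝ) * (l2 μ f₁ * l2 μ f₃)) := by gcongr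
    _ = _ := by ring

/-- Of the two memberships in `triBound_of_measure_le` one is dropped; dropping the other one gives
the version with the sum fixed. -/
lemma triBound_of_fst_slice {E : Set (G × G)} (hE : MeasurableSet E) {κ : ℝ≥0∞}
    (h : ∀ x, μ {y | (x, y) ∈ E} ≤ κ) : TriBound μ E (κ ^ (1 / 2 : ℝ)) :=
  triBound_of_measure_le hE fun x _ => (measure_mono fun _ hy => hy.1).trans (h x)

lemma triBound_of_snd_slice {E : Set (G × G)} (hE : MeasurableSet E) {κ : ℝ≥0∞}
    (h : ∀ y, μ {x | (x, y) ∈ E} ≤ κ) : TriBound μ E (κ ^ (1 / 2 : ℝ)) :=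
  (triBound_of_fst_slice (hE.preimage measurable_swap) h).swap
    (hE.preimage measurable_swap)

lemma triBound_of_sum_slice {E : Set (G × G)} (hE : MeasurableSet E) {κ : ℝ≥0∞}
    (h : ∀ w, μ {y | (w - y, y) ∈ E} ≤ κ) : TriBound μ E (κ ^ (1 / 2 : ℝ)) :=
  triBound_of_measure_le hE fun _ w => (measure_mono fun _ hy => hy.2).trans (h w)

end Trilinear


/-! ### Volumes of sets cut out by modulations -/

/-- The point of space-time with given time and spatial coordinates. -/
noncomputable def pt (τ : ℝ) (p : ℝ × ℝ) : SpaceTime := WithLp.toLp 2 ![p.1, p.2, τ]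

@[simp] lemma pt_zero (τ : ℝ) (p : ℝ × ℝ) : pt τ p 0 = p.1 := rfl
@[simp] lemma pt_one (τ : ℝ) (p : ℝ × ℝ) : pt τ p 1 = p.2 := rfl
@[simp] lemma pt_two (τ : ℝ) (p : ℝ × ℝ) : pt τ p 2 = τ := rfl

lemma measurePreserving_pt :
    MeasurePreserving (fun q : ℝ × (ℝ × ℝ) => pt q.1 q.2) volume volume := by
  have h1 := (volume_preserving_piFinSuccAbove (fun _ : Fin 3 => ℝ) 2).symm
  have h2 := (volume_preserving_finTwoArrow ℝ).symm
  have h3 : MeasurePreserving (Prod.map (id : ℝ → ℝ) (MeasurableEquiv.finTwoArrow (α := ℝ)).symm)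
    volume volume := (MeasurePreserving.id volume).prod h2
  have h4 := (PiLp.volume_preserving_toLp (Fin 3)).comp (h1.comp h3)
  have h5 : (fun q : ℝ × (ℝ × ℝ) => pt q.1 q.2) = WithLp.toLp 2 ∘
      ⇑(MeasurableEquiv.piFinSuccAbove (fun _ : Fin 3 => ℝ) 2).symm ∘
        Prod.map (id : ℝ → ℝ) ⇑(MeasurableEquiv.finTwoArrow (α := ℝ)).symm :=
    funext fun q => PiLp.ext fun i => by fin_cases i <;> rfl
  rw [h5]
  exact h4

lemma volume_eq_lintegral_pt {S : Set SpaceTime} (hS : MeasurableSet S) :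
    volume S = ∫⁻ p : ℝ × ℝ, volume {τ | pt τ p ∈ S} := by
  rw [← measurePreserving_pt.measure_preimage hS.nullMeasurableSet]
  exact Measure.prod_apply_symm (measurePreserving_pt.measurable hS)

lemma real_volume_le {s : Set ℝ} {L : ℝ} (h : ∀ x ∈ s, ∀ y ∈ s, |x - y| ≤ L) :
    volume s ≤ ENNReal.ofReal L := by
  refine (Real.volume_le_diam s).trans (Metric.ediam_le fun x hx y hy => ?_)
  rw [edist_dist, Real.dist_eq]
  exact ENNReal.ofReal_le_ofReal (h x hx y hy)

lemma volume_le_of_time_slices {S : Set SpaceTime} (hS : MeasurableSet S) {R L : ℝ} (hR : 0 ≤ R)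
    (h : ∀ ζ ∈ S, |ζ 0| ≤ R ∧ |ζ 1| ≤ R)
    (hL : ∀ ζ ∈ S, ∀ η ∈ S, ζ 0 = η 0 → ζ 1 = η 1 → |ζ 2 - η 2| ≤ L) :
    volume S ≤ ENNReal.ofReal (4 * R ^ 2 * L) := by
  rw [volume_eq_lintegral_pt hS]
  have hle : ∀ p : ℝ × ℝ, volume {τ | pt τ p ∈ S} ≤
      (Set.Icc (-R) R ×ˢ Set.Icc (-R) R).indicator (fun _ => ENNReal.ofReal L) p := by
    intro p
    by_cases hp : p ∈ Set.Icc (-R) R ×ˢ Set.Icc (-R) R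
    · rw [Set.indicator_of_mem hp]
      exact real_volume_le fun x hx y hy => by simpa using hL _ hx _ hy rfl rfl
    · have : {τ | pt τ p ∈ S} = ∅ := by
        ext τ
        simp only [Set.mem_ofPred_eq, Set.mem_empty_iff_false, iff_false]
        intro hτ
        have := h _ hτ
        simp only [pt_zero, pt_one, abs_le] at this
        exact hp ⟨this.1, this.2⟩
      simp [this]
  calc _ ≤ ∫⁻ p : ℝ × ℝ, (Set.Icc (-R) R ×ˢ Set.Icc (-R) R).indicator
        (fun _ => ENNReal.ofReal L) p := lintegral_mono hle
    _ = ENNReal.ofReal L * volume (Set.Icc (-R) R ×ˢ Set.Icc (-R) R) := by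
        rw [lintegral_indicator_const (measurableSet_Icc.prod measurableSet_Icc)]
    _ ≤ _ := by
        rw [Measure.volume_eq_prod, Measure.prod_prod, Real.volume_Icc,
          ← ENNReal.ofReal_mul (by linarith)]
        by_cases hL0 : 0 ≤ L
        · rw [← ENNReal.ofReal_mul hL0]
          apply ENNReal.ofReal_le_ofReal
          nlinarith
        · rw [ENNReal.ofReal_of_nonpos (not_le.1 hL0).le, zero_mul]; exact zero_le

lemma measurable_pt : Measurable fun q : ℝ × (ℝ × ℝ) => pt q.1 q.2 :=
  measurePreserving_pt.measurable

/-- Volume bound by slicing along the modulation. -/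
lemma volume_le_of_modulation_slices {S : Set SpaceTime} (hS : MeasurableSet S) {c D : ℝ}
    {κ : ℝ≥0∞} (hD : ∀ ζ ∈ S, |modulation ζ - c| ≤ D)
    (h : ∀ m, volume {p : ℝ × ℝ | pt (m + (p.1 ^ 2 + p.2 ^ 2)) p ∈ S} ≤ κ) :
    volume S ≤ ENNReal.ofReal (2 * D) * κ := by
  have hm : MeasurableSet {q : (ℝ × ℝ) × ℝ | pt (q.2 + (q.1.1 ^ 2 + q.1.2 ^ 2)) q.1 ∈ S} := by
    have h1 : Measurable fun q : (ℝ × ℝ) × ℝ => (q.2 + (q.1.1 ^ 2 + q.1.2 ^ 2), q.1) := by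
      fun_prop
    exact (measurable_pt.comp h1) hS
  calc volume S = ∫⁻ p : ℝ × ℝ, volume {m | pt (m + (p.1 ^ 2 + p.2 ^ 2)) p ∈ S} := by
        rw [volume_eq_lintegral_pt hS]
        refine lintegral_congr fun p => ?_
        -- For each `ξ` the shear `τ = m + |ξ|²` is a translation in time frequency, so the
        -- modulation can replace `τ` as a coordinate without a Jacobian.
        exact (measure_preimage_add_right volume (p.1 ^ 2 + p.2 ^ 2) {τ | pt τ p ∈ S}).symm
    _ = (volume : Measure ((ℝ × ℝ) × ℝ))
          {q : (ℝ × ℝ) × ℝ | pt (q.2 + (q.1.1 ^ 2 + q.1.2 ^ 2)) q.1 ∈ S} :=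
        (Measure.prod_apply hm).symm
    _ = ∫⁻ m, volume {p : ℝ × ℝ | pt (m + (p.1 ^ 2 + p.2 ^ 2)) p ∈ S} :=
        Measure.prod_apply_symm hm
    _ ≤ ∫⁻ m, (Set.Icc (c - D) (c + D)).indicator (fun _ => κ) m := by
        refine lintegral_mono fun m => ?_
        by_cases hmem : m ∈ Set.Icc (c - D) (c + D)
        · rw [Set.indicator_of_mem hmem]; exact h m
        · have : {p : ℝ × ℝ | pt (m + (p.1 ^ 2 + p.2 ^ 2)) p ∈ S} = ∅ := by
            ext p
            simp only [Set.mem_ofPred_eq, Set.mem_empty_iff_false, iff_false]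
            intro hp
            have := hD _ hp
            simp only [modulation, xiSq, pt_zero, pt_one, pt_two, abs_le] at this
            exact hmem ⟨by linarith, by linarith⟩
          simp [this]
    _ = _ := by
        rw [lintegral_indicator_const measurableSet_Icc, Real.volume_Icc, mul_comm]
        congr 2; ring

/-- The area of a planar set whose image under a linear change of coordinates has bounded first
coordinate and short vertical slices. -/
lemma area_le_of_linear {S : Set (ℝ × ℝ)} (hS : MeasurableSet S) {a b c d α L₁ L₂ : ℝ}
    (hdet : a * d - b * c ≠ 0) (hL₁ : 0 ≤ L₁)
    (h₁ : ∀ X ∈ S, |a * X.1 + b * X.2 - α| ≤ L₁)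
    (h₂ : ∀ X ∈ S, ∀ Y ∈ S, a * X.1 + b * X.2 = a * Y.1 + b * Y.2 →
      |(c * X.1 + d * X.2) - (c * Y.1 + d * Y.2)| ≤ L₂) :
    volume S ≤ ENNReal.ofReal (2 * L₁ * L₂ / |a * d - b * c|) := by
  set δ := a * d - b * c with hδ
  set T : Set (ℝ × ℝ) := {w | ((d * w.1 - b * w.2) / δ, (a * w.2 - c * w.1) / δ) ∈ S} with hT
  have hTm : MeasurableSet T := by
    have : Measurable fun w : ℝ × ℝ => ((d * w.1 - b * w.2) / δ, (a * w.2 - c * w.1) / δ) := by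
      fun_prop
    exact this hS
  set f : (ℝ × ℝ) →ₗ[ℝ] (ℝ × ℝ) :=
    Matrix.toLin (Module.Basis.finTwoProd ℝ) (Module.Basis.finTwoProd ℝ) !![a, b; c, d] with hf
  have hfdet : LinearMap.det f = δ := by
    rw [hf, LinearMap.det_toLin, Matrix.det_fin_two_of]
  have hfa : ∀ X, f X = (a * X.1 + b * X.2, c * X.1 + d * X.2) := fun X => by
    rw [hf, Matrix.toLin_finTwoProd_apply]
  have hST : S = f ⁻¹' T := by
    ext X
    have : ((d * (f X).1 - b * (f X).2) / δ, (a * (f X).2 - c * (f X).1) / δ) = X := by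
      rw [hfa]
      ext
      · simp only; rw [div_eq_iff hdet]; simp only [hδ]; ring
      · simp only; rw [div_eq_iff hdet]; simp only [hδ]; ring
    simp only [Set.mem_preimage, hT, Set.mem_ofPred_eq, this]
  have hpt : ∀ w : ℝ × ℝ, a * ((d * w.1 - b * w.2) / δ) + b * ((a * w.2 - c * w.1) / δ) = w.1 := by
    intro w; field_simp; simp only [hδ]; ring
  have hpt' : ∀ w : ℝ × ℝ, c * ((d * w.1 - b * w.2) / δ) + d * ((a * w.2 - c * w.1) / δ) = w.2 := by
    intro w; field_simp; simp only [hδ]; ring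
  have hTle : volume T ≤ ENNReal.ofReal L₂ * ENNReal.ofReal (2 * L₁) := by
    rw [Measure.volume_eq_prod, Measure.prod_apply hTm]
    calc _ ≤ ∫⁻ p, (Set.Icc (α - L₁) (α + L₁)).indicator (fun _ => ENNReal.ofReal L₂) p := by
          refine lintegral_mono fun p => ?_
          by_cases hp : p ∈ Set.Icc (α - L₁) (α + L₁)
          · rw [Set.indicator_of_mem hp]
            refine real_volume_le fun x hx y hy => ?_
            have := h₂ _ hx _ hy (by rw [hpt (p, x), hpt (p, y)])
            rwa [hpt' (p, x), hpt' (p, y)] at this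
          · have : Prod.mk p ⁻¹' T = ∅ := by
              ext q
              simp only [Set.mem_preimage, Set.mem_empty_iff_false, iff_false]
              intro hq
              have := h₁ _ hq
              rw [hpt (p, q), abs_le] at this
              exact hp ⟨by linarith, by linarith⟩
            simp [this]
      _ = _ := by
          rw [lintegral_indicator_const measurableSet_Icc, Real.volume_Icc]
          congr 2; ring
  rw [hST, Measure.addHaar_preimage_linearMap _ (by rw [hfdet]; exact hdet), hfdet]
  calc _ ≤ ENNReal.ofReal |δ⁻¹| * (ENNReal.ofReal L₂ * ENNReal.ofReal (2 * L₁)) := by gcongr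
    _ = ENNReal.ofReal (2 * L₁ * L₂ / |δ|) := by
        rw [← ENNReal.ofReal_mul' (by linarith), ← ENNReal.ofReal_mul (abs_nonneg _)]
        congr 1
        rw [abs_inv]; field_simp

lemma area_disc (r : ℝ) :
    volume {p : ℝ × ℝ | p.1 ^ 2 + p.2 ^ 2 < r} = ENNReal.ofReal (Real.pi * r) := by
  have hm : MeasurableSet {p : ℝ × ℝ | p.1 ^ 2 + p.2 ^ 2 < r} :=
    measurableSet_lt (by fun_prop) (by fun_prop)
  rw [← Complex.volume_preserving_equiv_real_prod.measure_preimage hm.nullMeasurableSet]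
  by_cases hr : 0 ≤ r
  · have : Complex.measurableEquivRealProd ⁻¹' {p : ℝ × ℝ | p.1 ^ 2 + p.2 ^ 2 < r} =
        Metric.ball (0 : ℂ) (Real.sqrt r) := by
      ext z
      simp only [Set.mem_preimage, Complex.measurableEquivRealProd_apply, Set.mem_ofPred_eq,
        mem_ball_zero_iff]
      rw [Real.lt_sqrt (norm_nonneg _), Complex.sq_norm, Complex.normSq_apply, sq, sq]
    rw [this, Complex.volume_ball, ← ENNReal.ofReal_pow (Real.sqrt_nonneg _), Real.sq_sqrt hr,
      mul_comm, ENNReal.ofReal_mul Real.pi_pos.le]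
    congr 1
    rw [← NNReal.coe_real_pi, ENNReal.ofReal_coe_nnreal]
  · have : {p : ℝ × ℝ | p.1 ^ 2 + p.2 ^ 2 < r} = ∅ := by
      ext p
      simp only [Set.mem_ofPred_eq, Set.mem_empty_iff_false, iff_false, not_lt]
      nlinarith [sq_nonneg p.1, sq_nonneg p.2]
    rw [this, ENNReal.ofReal_of_nonpos]
    · simp
    · nlinarith [Real.pi_pos]

/-- The area of an annulus depends only on the difference of the squared radii, hence the uniformity
in `r`. The outer disc is open, so it is taken with `r + 2δ`; the resulting `3πδ` is below `12δ`. -/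
lemma area_annulus {r δ : ℝ} (hδ : 0 < δ) (a : ℝ × ℝ) :
    volume {p : ℝ × ℝ | |(p.1 - a.1) ^ 2 + (p.2 - a.2) ^ 2 - r| ≤ δ} ≤ ENNReal.ofReal (12 * δ) := by
  have hms : MeasurableSet {p : ℝ × ℝ | |p.1 ^ 2 + p.2 ^ 2 - r| ≤ δ} :=
    measurableSet_le (by fun_prop) (by fun_prop)
  have h0 : volume {p : ℝ × ℝ | |(p.1 - a.1) ^ 2 + (p.2 - a.2) ^ 2 - r| ≤ δ} =
      volume {p : ℝ × ℝ | |p.1 ^ 2 + p.2 ^ 2 - r| ≤ δ} :=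
    (measurePreserving_sub_right volume a).measure_preimage hms.nullMeasurableSet
  rw [h0]
  have hsub : {p : ℝ × ℝ | |p.1 ^ 2 + p.2 ^ 2 - r| ≤ δ} ⊆
      {p : ℝ × ℝ | p.1 ^ 2 + p.2 ^ 2 < r + 2 * δ} \ {p : ℝ × ℝ | p.1 ^ 2 + p.2 ^ 2 < r - δ} := by
    intro p hp
    simp only [Set.mem_ofPred_eq, abs_le, Set.mem_sdiff, not_lt] at hp ⊢
    constructor <;> linarith
  have hm : MeasurableSet {p : ℝ × ℝ | p.1 ^ 2 + p.2 ^ 2 < r - δ} :=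
    measurableSet_lt (by fun_prop) (by fun_prop)
  refine (measure_mono hsub).trans ?_
  rw [measure_sdiff (fun p hp => by simp only [Set.mem_ofPred_eq] at hp ⊢; linarith)
    hm.nullMeasurableSet (by rw [area_disc]; simp), area_disc, area_disc]
  rw [tsub_le_iff_right]
  refine (ENNReal.ofReal_le_ofReal ?_).trans ENNReal.ofReal_add_le
  nlinarith [Real.pi_lt_four]


/-! ### Volumes determined by two or three modulation constraints. -/

/-- The inner product of the spatial frequencies. -/
def dot (ζ η : SpaceTime) : ℝ := ζ 0 * η 0 + ζ 1 * η 1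

/-- The cross product of the spatial frequencies. -/
def crs (ζ η : SpaceTime) : ℝ := ζ 0 * η 1 - ζ 1 * η 0

lemma dot_sq_add_crs_sq (ζ η : SpaceTime) : dot ζ η ^ 2 + crs ζ η ^ 2 = xiSq ζ * xiSq η := by
  simp only [dot, crs, xiSq]; ring

lemma modulation_add (ζ η : SpaceTime) :
    modulation (ζ + η) = modulation ζ + modulation η - 2 * dot ζ η := by
  simp only [modulation, dot, xiSq, PiLp.add_apply]; ring

lemma modulation_sub (ζ η : SpaceTime) :
    modulation (ζ - η) = modulation ζ - modulation η - 2 * xiSq η + 2 * dot ζ η := by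
  simp only [modulation, dot, xiSq, PiLp.sub_apply]; ring

lemma xiSq_nonneg (ζ : SpaceTime) : 0 ≤ xiSq ζ := by unfold xiSq; positivity

@[fun_prop] lemma continuous_xiSq : Continuous xiSq := by unfold xiSq; fun_prop
@[fun_prop] lemma continuous_modulation : Continuous modulation := by unfold modulation; fun_prop
@[fun_prop] lemma Continuous.crs {α : Type*} [TopologicalSpace α] {f g : α → SpaceTime}
    (hf : Continuous f) (hg : Continuous g) : Continuous fun a => crs (f a) (g a) := by
  unfold SchrodingerBilinear.crs; fun_prop

lemma abs_coord_le {ζ : SpaceTime} {R : ℝ} (hR : 0 ≤ R) (h : xiSq ζ ≤ R ^ 2) :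
    |ζ 0| ≤ R ∧ |ζ 1| ≤ R := by
  unfold xiSq at h
  constructor <;> apply abs_le_of_sq_le_sq _ hR <;> nlinarith [sq_nonneg (ζ 0), sq_nonneg (ζ 1)]

lemma volume_le_trivial (ζ₀ : SpaceTime) {N M : ℝ} (hN : 0 ≤ N) (ε : ℝ)
    (hε : ε = 1 ∨ ε = -1) {S : Set SpaceTime} (hS : MeasurableSet S)
    (h : ∀ ζ ∈ S, xiSq ζ ≤ 4 * N ^ 2 ∧ |modulation (ζ₀ + ε • ζ)| ≤ 2 * M) :
    volume S ≤ ENNReal.ofReal (64 * N ^ 2 * M) := by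
  have := volume_le_of_time_slices hS (R := 2 * N) (L := 4 * M) (by positivity)
    (fun ζ hζ => abs_coord_le (by positivity) (by linarith [(h ζ hζ).1])) ?_
  · refine this.trans (ENNReal.ofReal_le_ofReal (le_of_eq (by ring)))
  · intro ζ hζ η hη h0 h1
    have h2 := (h ζ hζ).2
    have h3 := (h η hη).2
    simp only [modulation, xiSq, PiLp.add_apply, PiLp.smul_apply, smul_eq_mul, h0, h1, abs_le]
      at h2 h3 ⊢
    rcases hε with rfl | rfl <;> constructor <;> linarith [h2.1, h2.2, h3.1, h3.2]

lemma isClosed_setOf_and {α : Type*} [TopologicalSpace α] {p q : α → Prop}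
    (hp : IsClosed {x | p x}) (hq : IsClosed {x | q x}) : IsClosed {x | p x ∧ q x} :=
  hp.inter hq

/-- The set of frequencies of parabolic size at most `2N` and modulation at most `2M`. -/
def ballMod (N M : ℝ) : Set SpaceTime :=
  {ζ | |ζ 2| + xiSq ζ ≤ 4 * N ^ 2 ∧ |modulation ζ| ≤ 2 * M}

lemma isClosed_ballMod (N M : ℝ) : IsClosed (ballMod N M) :=
  isClosed_setOf_and (isClosed_le (by fun_prop) (by fun_prop))
    (isClosed_le (by fun_prop) (by fun_prop))

/-- With the modulation of `ζ` fixed, `modulation_add` turns the second constraint into a strip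
normal to the spatial part `ξ₀` of `ζ₀`. It has width about `M' / |ξ₀|` and meets the disc of radius
`2N` in area about `N M' / |ξ₀|`, which is enough if `|ξ₀| ≥ H / (64Λ)`. Otherwise `ζ₀` lies near
the `τ`-axis and has modulation at least `H²/8`, while the dot product is small. Then `M` or `M'` is
at least `H²/64`, and `N²` times the other one suffices. -/
lemma volume_translate_le {N M M' H Λ : ℝ} (hM : 0 < M) (hM' : 0 < M') (hH : 0 < H)
    (hN : 0 < N) (hΛ : 1 ≤ Λ) (hNH : N ≤ Λ * H) {ζ₀ : SpaceTime}
    (h₀ : H ^ 2 / 4 ≤ |ζ₀ 2| + xiSq ζ₀) :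
    volume {ζ | ζ ∈ ballMod N M ∧ |modulation (ζ + ζ₀)| ≤ 2 * M'} ≤
      ENNReal.ofReal (4096 * Λ * (M * M' * N / H)) := by
  set S := {ζ | ζ ∈ ballMod N M ∧ |modulation (ζ + ζ₀)| ≤ 2 * M'} with hSdef
  have hS : MeasurableSet S :=
    (isClosed_setOf_and (isClosed_ballMod N M)
      (isClosed_le (by fun_prop) (by fun_prop))).measurableSet
  have hxi : ∀ ζ ∈ S, xiSq ζ ≤ 4 * N ^ 2 := fun ζ hζ => by
    have := hζ.1.1; linarith [abs_nonneg (ζ 2)]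
  by_cases hX : (H / (64 * Λ)) ^ 2 ≤ xiSq ζ₀
  · have hpos : 0 < xiSq ζ₀ := lt_of_lt_of_le (by positivity) hX
    set r := Real.sqrt (xiSq ζ₀) with hr
    have hr2 : r ^ 2 = xiSq ζ₀ := Real.sq_sqrt hpos.le
    have hr0 : 0 < r := Real.sqrt_pos.2 hpos
    have hrH : H / (64 * Λ) ≤ r := Real.le_sqrt_of_sq_le hX
    refine (volume_le_of_modulation_slices hS (c := 0) (D := 2 * M)
      (κ := ENNReal.ofReal (2 * M' * (4 * N * r) / r ^ 2)) ?_ ?_).trans ?_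
    · intro ζ hζ; simpa using hζ.1.2
    · intro m
      have hm : MeasurableSet {p : ℝ × ℝ | pt (m + (p.1 ^ 2 + p.2 ^ 2)) p ∈ S} :=
        (measurable_pt.comp (by fun_prop : Measurable fun p : ℝ × ℝ =>
          (m + (p.1 ^ 2 + p.2 ^ 2), p))) hS
      have hdet : ζ₀ 0 * ζ₀ 0 - ζ₀ 1 * -ζ₀ 1 = xiSq ζ₀ := by simp only [xiSq]; ring
      refine (area_le_of_linear hm (a := ζ₀ 0) (b := ζ₀ 1) (c := -ζ₀ 1) (d := ζ₀ 0)
        (α := (m + modulation ζ₀) / 2) (L₁ := M') (L₂ := 4 * N * r) (by rw [hdet]; exact hpos.ne')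
        hM'.le ?_ ?_).trans ?_
      · intro p hp
        have := hp.2
        rw [modulation_add] at this
        simp only [modulation, xiSq, dot, pt_zero, pt_one, pt_two, abs_le] at this ⊢
        constructor <;> linarith [this.1, this.2]
      · intro p hp q hq _
        have hcr : ∀ p : ℝ × ℝ, pt (m + (p.1 ^ 2 + p.2 ^ 2)) p ∈ S →
            |-ζ₀ 1 * p.1 + ζ₀ 0 * p.2| ≤ 2 * N * r := by
          intro p hp
          apply abs_le_of_sq_le_sq _ (by positivity)
          have h1 := hxi _ hp
          simp only [xiSq, pt_zero, pt_one] at h1 hr2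
          have h2 : (-ζ₀ 1 * p.1 + ζ₀ 0 * p.2) ^ 2 ≤ (p.1 ^ 2 + p.2 ^ 2) * r ^ 2 := by
            rw [hr2]; nlinarith [sq_nonneg (ζ₀ 0 * p.1 + ζ₀ 1 * p.2)]
          nlinarith [sq_nonneg r]
        have h1 := hcr p hp
        have h2 := hcr q hq
        rw [abs_le] at h1 h2 ⊢
        constructor <;> linarith [h1.1, h1.2, h2.1, h2.2]
      · rw [hdet, abs_of_pos hpos, hr2]
    · rw [← ENNReal.ofReal_mul (by positivity)]
      apply ENNReal.ofReal_le_ofReal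
      have h1 : 2 * (2 * M) * (2 * M' * (4 * N * r) / r ^ 2) = 32 * (M * M' * N) / r := by
        field_simp; norm_num
      rw [h1, div_le_iff₀ hr0]
      have h2 : 1 ≤ 64 * Λ * r / H := by
        rw [le_div_iff₀ hH]; rw [div_le_iff₀ (by positivity)] at hrH; linarith
      calc 32 * (M * M' * N) ≤ 32 * (M * M' * N) * (64 * Λ * r / H) :=
            le_mul_of_one_le_right (by positivity) h2
        _ ≤ 4096 * Λ * (M * M' * N / H) * r := by
            have : 0 ≤ Λ * (M * M' * N / H) * r := by positivity
            calc _ = 2048 * (Λ * (M * M' * N / H) * r) := by ring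
              _ ≤ _ := by linarith
  · push Not at hX
    rcases S.eq_empty_or_nonempty with hem | ⟨ζ, hζ⟩
    · simp [hem]
    have hX' : xiSq ζ₀ ≤ H ^ 2 / 4096 := by
      refine hX.le.trans ?_
      rw [div_pow, mul_pow]
      apply div_le_div_of_nonneg_left (by positivity) (by norm_num)
      nlinarith
    have hdot : |2 * dot ζ ζ₀| ≤ H ^ 2 / 16 := by
      apply abs_le_of_sq_le_sq _ (by positivity)
      have h1 := dot_sq_add_crs_sq ζ ζ₀
      have h2 : xiSq ζ * xiSq ζ₀ ≤ (4 * N ^ 2) * (H / (64 * Λ)) ^ 2 :=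
        mul_le_mul (hxi ζ hζ) hX.le (xiSq_nonneg _) (by positivity)
      have h3 : N / Λ ≤ H := by rw [div_le_iff₀ (by positivity)]; linarith
      have h4 : (4 * N ^ 2) * (H / (64 * Λ)) ^ 2 = (N / Λ) ^ 2 * H ^ 2 / 1024 := by
        field_simp; norm_num
      have h5 : (N / Λ) ^ 2 ≤ H ^ 2 := by gcongr
      nlinarith [sq_nonneg (crs ζ ζ₀), sq_nonneg H]
    have hmm : H ^ 2 / 16 ≤ 2 * M + 2 * M' := by
      have h1 := hζ.2
      rw [modulation_add] at h1
      have h2 := hζ.1.2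
      have h3 : H ^ 2 / 8 ≤ |modulation ζ₀| := by
        have : |ζ₀ 2| - xiSq ζ₀ ≤ |modulation ζ₀| := by
          unfold modulation
          have := abs_sub_abs_le_abs_sub (ζ₀ 2) (xiSq ζ₀)
          rwa [abs_of_nonneg (xiSq_nonneg ζ₀)] at this
        nlinarith [sq_nonneg H]
      rw [abs_le] at h1 h2 hdot
      rcases le_abs.1 h3 with h | h <;> linarith [h1.1, h1.2, h2.1, h2.2, hdot.1, hdot.2]
    have hNN : N ^ 2 ≤ Λ * N * H := by nlinarith
    by_cases hMM : H ^ 2 / 64 ≤ M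
    · refine (volume_le_trivial ζ₀ hN.le 1 (Or.inl rfl) hS (M := M') fun ζ hζ =>
        ⟨hxi ζ hζ, by simpa [add_comm] using hζ.2⟩).trans ?_
      apply ENNReal.ofReal_le_ofReal
      rw [show 4096 * Λ * (M * M' * N / H) = 4096 * (Λ * N * H) * M' * (M / H ^ 2) by field_simp]
      have : 1 / 64 ≤ M / H ^ 2 := by rw [le_div_iff₀ (by positivity)]; linarith
      calc 64 * N ^ 2 * M' = 4096 * N ^ 2 * M' * (1 / 64) := by ring
        _ ≤ _ := by gcongr
    · have hMM' : H ^ 2 / 64 ≤ M' := by linarith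
      refine (volume_le_trivial 0 hN.le 1 (Or.inl rfl) hS (M := M) fun ζ hζ =>
        ⟨hxi ζ hζ, by simpa using hζ.1.2⟩).trans ?_
      apply ENNReal.ofReal_le_ofReal
      rw [show 4096 * Λ * (M * M' * N / H) = 4096 * (Λ * N * H) * M * (M' / H ^ 2) by field_simp]
      have : 1 / 64 ≤ M' / H ^ 2 := by rw [le_div_iff₀ (by positivity)]; linarith
      calc 64 * N ^ 2 * M = 4096 * N ^ 2 * M * (1 / 64) := by ring
        _ ≤ _ := by gcongr


lemma measurableSet_slice {S : Set SpaceTime} (hS : MeasurableSet S) (m : ℝ) :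
    MeasurableSet {p : ℝ × ℝ | pt (m + (p.1 ^ 2 + p.2 ^ 2)) p ∈ S} :=
  (measurable_pt.comp (by fun_prop : Measurable fun p : ℝ × ℝ =>
    (m + (p.1 ^ 2 + p.2 ^ 2), p))) hS

lemma two_mul_dot_le (ζ η : SpaceTime) {a b : ℝ} (ha : 0 ≤ a) (hb : 0 ≤ b)
    (hζ : xiSq ζ ≤ a ^ 2) (hη : xiSq η ≤ b ^ 2) : |dot ζ η| ≤ a * b := by
  apply abs_le_of_sq_le_sq _ (by positivity)
  have h1 := dot_sq_add_crs_sq ζ η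
  have h2 := mul_le_mul hζ hη (xiSq_nonneg _) (by positivity)
  nlinarith [sq_nonneg (crs ζ η)]

lemma crs_le (ζ η : SpaceTime) {a b : ℝ} (ha : 0 ≤ a) (hb : 0 ≤ b)
    (hζ : xiSq ζ ≤ a ^ 2) (hη : xiSq η ≤ b ^ 2) : |crs ζ η| ≤ a * b := by
  apply abs_le_of_sq_le_sq _ (by positivity)
  have h1 := dot_sq_add_crs_sq ζ η
  have h2 := mul_le_mul hζ hη (xiSq_nonneg _) (by positivity)
  nlinarith [sq_nonneg (dot ζ η)]

-- With the modulation of `ζ` fixed, the second constraint is an annulus centred at half of `ξ₀`,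
-- the spatial part of `ζ₀`; its area, about `M'`, is enough when `H ≤ 64N`. If `N ≪ H` and `|ξ₀| ≥
-- H/8`, only the part of the annulus within distance `2N` of the origin counts. There the quadratic
-- `|ξ|² - ξ₀·ξ` is monotone along `ξ₀` with slope about `|ξ₀|`, so the area is about `N M' / H`.
-- For small `ξ₀` the modulation of `ζ₀` is large, as for translates.
set_option maxHeartbeats 800000 in
lemma volume_reflect_le {N M M' H : ℝ} (hM : 0 < M) (hM' : 0 < M') (hH : 0 < H)
    (hN : 0 < N) {ζ₀ : SpaceTime} (h₀ : H ^ 2 / 4 ≤ |ζ₀ 2| + xiSq ζ₀) :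
    volume {ζ | ζ ∈ ballMod N M ∧ |modulation (ζ₀ - ζ)| ≤ 2 * M'} ≤
      ENNReal.ofReal (4096 * (M * M' * N / H)) := by
  set S := {ζ | ζ ∈ ballMod N M ∧ |modulation (ζ₀ - ζ)| ≤ 2 * M'} with hSdef
  have hS : MeasurableSet S :=
    (isClosed_setOf_and (isClosed_ballMod N M)
      (isClosed_le (by fun_prop) (by fun_prop))).measurableSet
  have hxi : ∀ ζ ∈ S, xiSq ζ ≤ (2 * N) ^ 2 := fun ζ hζ => by
    have := hζ.1.1; nlinarith [abs_nonneg (ζ 2)]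
  have hmod : ∀ ζ ∈ S, |modulation ζ - 0| ≤ 2 * M := fun ζ hζ => by simpa using hζ.1.2
  by_cases hNH : H ≤ 64 * N
  · refine (volume_le_of_modulation_slices hS (κ := ENNReal.ofReal (12 * M')) hmod ?_).trans ?_
    · intro m
      refine (measure_mono ?_).trans (area_annulus (r := (modulation ζ₀ - m) / 2 + xiSq ζ₀ / 4)
        hM' (ζ₀ 0 / 2, ζ₀ 1 / 2))
      intro p hp
      have := hp.2
      rw [modulation_sub] at this
      simp only [modulation, xiSq, dot, pt_zero, pt_one, pt_two, abs_le, Set.mem_ofPred_eq]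
        at this ⊢
      constructor <;> linarith [this.1, this.2]
    · rw [← ENNReal.ofReal_mul (by positivity)]
      apply ENNReal.ofReal_le_ofReal
      have : 1 ≤ 64 * N / H := by rw [le_div_iff₀ hH]; linarith
      calc 2 * (2 * M) * (12 * M') = 48 * M * M' * 1 := by ring
        _ ≤ 48 * M * M' * (64 * N / H) := by gcongr
        _ = 3072 * (M * M' * N / H) := by ring
        _ ≤ _ := by gcongr; norm_num
  push Not at hNH
  by_cases hX : (H / 8) ^ 2 ≤ xiSq ζ₀
  · have hpos : 0 < xiSq ζ₀ := lt_of_lt_of_le (by positivity) hX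
    set r := Real.sqrt (xiSq ζ₀) with hr
    have hr2 : r ^ 2 = xiSq ζ₀ := Real.sq_sqrt hpos.le
    have hr0 : 0 < r := Real.sqrt_pos.2 hpos
    have hrH : H / 8 ≤ r := Real.le_sqrt_of_sq_le hX
    refine (volume_le_of_modulation_slices hS
      (κ := ENNReal.ofReal (2 * (2 * N * r) * (4 * M') / r ^ 2)) hmod ?_).trans ?_
    · intro m
      have hdet : -ζ₀ 1 * ζ₀ 1 - ζ₀ 0 * ζ₀ 0 = -xiSq ζ₀ := by simp only [xiSq]; ring
      have hc : ∀ p : ℝ × ℝ, pt (m + (p.1 ^ 2 + p.2 ^ 2)) p ∈ S →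
          |-ζ₀ 1 * p.1 + ζ₀ 0 * p.2| ≤ 2 * N * r ∧ |ζ₀ 0 * p.1 + ζ₀ 1 * p.2| ≤ 2 * N * r := by
        intro p hp
        have h1 := crs_le ζ₀ _ hr0.le (by positivity) hr2.ge (hxi _ hp)
        have h2 := two_mul_dot_le ζ₀ _ hr0.le (by positivity) hr2.ge (hxi _ hp)
        simp only [crs, dot, pt_zero, pt_one] at h1 h2
        constructor
        · rw [show -ζ₀ 1 * p.1 + ζ₀ 0 * p.2 = ζ₀ 0 * p.2 - ζ₀ 1 * p.1 by ring]; linarith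
        · linarith
      refine (area_le_of_linear (measurableSet_slice hS m) (a := -ζ₀ 1) (b := ζ₀ 0) (c := ζ₀ 0)
        (d := ζ₀ 1) (α := 0) (L₁ := 2 * N * r) (L₂ := 4 * M')
        (by rw [hdet]; exact neg_ne_zero.2 hpos.ne') (by positivity) ?_ ?_).trans ?_
      · intro p hp
        simpa using (hc p hp).1
      · intro p hp q hq hpq
        have h1 := hp.2
        have h2 := hq.2
        have h3 := (hc p hp).2
        have h4 := (hc q hq).2
        rw [modulation_sub] at h1 h2
        simp only [modulation, xiSq, dot, pt_zero, pt_one, pt_two] at h1 h2 hr2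
        -- `P` and `Q` are `r` times the coordinates across and along `ζ₀`. With `P` fixed, the
        -- increment of the quadratic factors as `(Q - Q')(r² - (Q + Q'))`. The second factor is at
        -- least `r²/2`, because `2N < H/32 ≤ r/4`.
        set P := -ζ₀ 1 * p.1 + ζ₀ 0 * p.2 with hP
        set Q := ζ₀ 0 * p.1 + ζ₀ 1 * p.2 with hQ
        set Q' := ζ₀ 0 * q.1 + ζ₀ 1 * q.2 with hQ'
        have e1 : r ^ 2 * (p.1 ^ 2 + p.2 ^ 2) = P ^ 2 + Q ^ 2 := by rw [hr2, hP, hQ]; ring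
        have e2 : r ^ 2 * (q.1 ^ 2 + q.2 ^ 2) = P ^ 2 + Q' ^ 2 := by rw [hpq, hr2, hQ']; ring
        have e3 : r ^ 2 * ((p.1 ^ 2 + p.2 ^ 2 - Q) - (q.1 ^ 2 + q.2 ^ 2 - Q')) =
            -((Q - Q') * (r ^ 2 - (Q + Q'))) := by
          linear_combination e1 - e2
        have h5 : |(p.1 ^ 2 + p.2 ^ 2 - Q) - (q.1 ^ 2 + q.2 ^ 2 - Q')| ≤ 2 * M' := by
          rw [abs_le] at h1 h2 ⊢
          constructor <;> linarith [h1.1, h1.2, h2.1, h2.2]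
        have h6 : r ^ 2 / 2 ≤ r ^ 2 - (Q + Q') := by
          rw [abs_le] at h3 h4
          nlinarith [h3.2, h4.2]
        have h7 : |Q - Q'| * (r ^ 2 / 2) ≤ r ^ 2 * (2 * M') := by
          calc |Q - Q'| * (r ^ 2 / 2) ≤ |Q - Q'| * |r ^ 2 - (Q + Q')| := by
                gcongr; exact h6.trans (le_abs_self _)
            _ = r ^ 2 * |(p.1 ^ 2 + p.2 ^ 2 - Q) - (q.1 ^ 2 + q.2 ^ 2 - Q')| := by
                rw [← abs_mul, ← abs_neg, ← e3, abs_mul, abs_of_pos (by positivity : 0 < r ^ 2)]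
            _ ≤ _ := by gcongr
        have h8 : 0 < r ^ 2 := by positivity
        nlinarith
      · rw [hdet, abs_neg, abs_of_pos hpos, hr2]
    · rw [← ENNReal.ofReal_mul (by positivity)]
      apply ENNReal.ofReal_le_ofReal
      have h1 : 2 * (2 * M) * (2 * (2 * N * r) * (4 * M') / r ^ 2) = 64 * (M * M' * N) / r := by
        field_simp; norm_num
      rw [h1, div_le_iff₀ hr0]
      have h2 : 1 ≤ 8 * r / H := by rw [le_div_iff₀ hH]; linarith
      calc 64 * (M * M' * N) ≤ 64 * (M * M' * N) * (8 * r / H) :=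
            le_mul_of_one_le_right (by positivity) h2
        _ ≤ 4096 * (M * M' * N / H) * r := by
            have : 0 ≤ (M * M' * N / H) * r := by positivity
            calc _ = 512 * ((M * M' * N / H) * r) := by ring
              _ ≤ _ := by linarith
  · push Not at hX
    rcases S.eq_empty_or_nonempty with hem | ⟨ζ, hζ⟩
    · simp [hem]
    have hdot := two_mul_dot_le ζ ζ₀ (by positivity) (by positivity) (hxi ζ hζ) hX.le
    have hmm : H ^ 2 / 8 ≤ 2 * M + 2 * M' := by
      have h1 := hζ.2
      rw [modulation_sub] at h1
      have h2 := hζ.1.2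
      have h3 : 7 * H ^ 2 / 32 ≤ |modulation ζ₀| := by
        have : |ζ₀ 2| - xiSq ζ₀ ≤ |modulation ζ₀| := by
          unfold modulation
          have := abs_sub_abs_le_abs_sub (ζ₀ 2) (xiSq ζ₀)
          rwa [abs_of_nonneg (xiSq_nonneg ζ₀)] at this
        nlinarith [sq_nonneg H]
      have h4 : 2 * N * (H / 8) ≤ H ^ 2 / 256 := by nlinarith
      have h5 : xiSq ζ ≤ H ^ 2 / 1024 := (hxi ζ hζ).trans (by nlinarith)
      have h6 := xiSq_nonneg ζ
      have h7 : dot ζ₀ ζ = dot ζ ζ₀ := by simp only [dot]; ring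
      rw [h7] at h1
      rw [abs_le] at h1 h2 hdot
      rcases le_abs.1 h3 with h | h <;>
        linarith [h1.1, h1.2, h2.1, h2.2, hdot.1, hdot.2, sq_nonneg H]
    have hNN : N ^ 2 ≤ N * H := by nlinarith
    by_cases hMM : H ^ 2 / 64 ≤ M
    · refine (volume_le_trivial ζ₀ hN.le (-1) (Or.inr rfl) hS (M := M') fun ζ hζ =>
        ⟨by nlinarith [hxi ζ hζ], by simpa [← sub_eq_add_neg] using hζ.2⟩).trans ?_
      apply ENNReal.ofReal_le_ofReal
      rw [show 4096 * (M * M' * N / H) = 4096 * (N * H) * M' * (M / H ^ 2) by field_simp]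
      have : 1 / 64 ≤ M / H ^ 2 := by rw [le_div_iff₀ (by positivity)]; linarith
      calc 64 * N ^ 2 * M' = 4096 * N ^ 2 * M' * (1 / 64) := by ring
        _ ≤ _ := by gcongr
    · have hMM' : H ^ 2 / 64 ≤ M' := by nlinarith [sq_nonneg H]
      refine (volume_le_trivial 0 hN.le 1 (Or.inl rfl) hS (M := M) fun ζ hζ =>
        ⟨by nlinarith [hxi ζ hζ], by simpa using hζ.1.2⟩).trans ?_
      apply ENNReal.ofReal_le_ofReal
      rw [show 4096 * (M * M' * N / H) = 4096 * (N * H) * M * (M' / H ^ 2) by field_simp]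
      have : 1 / 64 ≤ M' / H ^ 2 := by rw [le_div_iff₀ (by positivity)]; linarith
      calc 64 * N ^ 2 * M = 4096 * N ^ 2 * M * (1 / 64) := by ring
        _ ≤ _ := by gcongr

/-- Three transversal modulation constraints. -/
lemma volume_transversal_le {ζ₁ ζ₃ : SpaceTime} {M₂ M₃ c D β : ℝ} (hM₂ : 0 ≤ M₂) (hM₃ : 0 ≤ M₃)
    (hD : 0 ≤ D) (hβ : 0 < β) {S : Set SpaceTime} (hS : MeasurableSet S)
    (h : ∀ ζ ∈ S, |modulation ζ| ≤ 2 * M₂ ∧ |modulation (ζ₁ + ζ)| ≤ 2 * M₃ ∧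
      |modulation (ζ₃ - ζ) - c| ≤ D ∧ β ≤ |crs ζ₁ (ζ - (ζ₃ - ζ))|) :
    volume S ≤ ENNReal.ofReal (16 * (D * M₂ * M₃ / β)) := by
  rcases S.eq_empty_or_nonempty with hem | ⟨ζ', hζ'⟩
  · simp [hem]
  have hpos : 0 < xiSq ζ₁ := by
    rcases (xiSq_nonneg ζ₁).lt_or_eq with h0 | h0
    · exact h0
    · have h1 := dot_sq_add_crs_sq ζ₁ (ζ' - (ζ₃ - ζ'))
      rw [← h0, zero_mul] at h1
      have h2 : crs ζ₁ (ζ' - (ζ₃ - ζ')) = 0 := by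
        have := sq_nonneg (dot ζ₁ (ζ' - (ζ₃ - ζ')))
        exact pow_eq_zero_iff two_ne_zero |>.1 (le_antisymm (by linarith) (sq_nonneg _))
      have h3 := (h ζ' hζ').2.2.2
      rw [h2, abs_zero] at h3
      linarith
  -- On a line with fixed dot product against `ζ₁`, the third constraint is quadratic. Its increment
  -- between two points is proportional to their distance times the average of the cross products at
  -- the two points. Fixing the sign keeps this average at least `β` in absolute value.
  have key : ∀ σ : ℝ, (σ = 1 ∨ σ = -1) →
      volume (S ∩ {ζ | β ≤ σ * crs ζ₁ (ζ - (ζ₃ - ζ))}) ≤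
        ENNReal.ofReal (8 * (D * M₂ * M₃ / β)) := by
    intro σ hσ
    have hσ2 : σ ^ 2 = 1 := by rcases hσ with rfl | rfl <;> norm_num
    have hS' : MeasurableSet (S ∩ {ζ | β ≤ σ * crs ζ₁ (ζ - (ζ₃ - ζ))}) :=
      hS.inter (isClosed_le (by fun_prop) (by fun_prop)).measurableSet
    refine (volume_le_of_modulation_slices hS' (c := 0) (D := 2 * M₂)
      (κ := ENNReal.ofReal (2 * M₃ * (D * xiSq ζ₁ / β) / xiSq ζ₁))
      (fun ζ hζ => by simpa using (h ζ hζ.1).1) ?_).trans ?_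
    · intro m
      have hdet : ζ₁ 0 * ζ₁ 0 - ζ₁ 1 * -ζ₁ 1 = xiSq ζ₁ := by simp only [xiSq]; ring
      refine (area_le_of_linear (measurableSet_slice hS' m) (a := ζ₁ 0) (b := ζ₁ 1) (c := -ζ₁ 1)
        (d := ζ₁ 0) (α := (m + modulation ζ₁) / 2) (L₁ := M₃) (L₂ := D * xiSq ζ₁ / β)
        (by rw [hdet]; exact hpos.ne') hM₃ ?_ ?_).trans ?_
      · intro p hp
        have := (h _ hp.1).2.1
        rw [modulation_add] at this
        simp only [modulation, xiSq, dot, pt_zero, pt_one, pt_two, abs_le] at this ⊢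
        constructor <;> linarith [this.1, this.2]
      · intro p hp q hq hpq
        have h1 := (h _ hp.1).2.2.1
        have h2 := (h _ hq.1).2.2.1
        have h3 : β ≤ _ := hp.2
        have h4 : β ≤ _ := hq.2
        rw [modulation_sub] at h1 h2
        simp only [modulation, xiSq, dot, crs, pt_zero, pt_one, pt_two, PiLp.sub_apply]
          at h1 h2 h3 h4 hpos ⊢
        set P := ζ₁ 0 * p.1 + ζ₁ 1 * p.2 with hP
        set Q := -ζ₁ 1 * p.1 + ζ₁ 0 * p.2 with hQ
        set Q' := -ζ₁ 1 * q.1 + ζ₁ 0 * q.2 with hQ'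
        set R := ζ₁ 0 ^ 2 + ζ₁ 1 ^ 2 with hR
        set Y := ζ₁ 0 * ζ₃ 1 - ζ₁ 1 * ζ₃ 0 with hY
        have e3 : R * ((-2 * (p.1 ^ 2 + p.2 ^ 2) + 2 * (ζ₃ 0 * p.1 + ζ₃ 1 * p.2)) -
            (-2 * (q.1 ^ 2 + q.2 ^ 2) + 2 * (ζ₃ 0 * q.1 + ζ₃ 1 * q.2))) =
            -(2 * (Q - Q') * (Q + Q' - Y)) := by
          have e1 : R * (p.1 ^ 2 + p.2 ^ 2) = P ^ 2 + Q ^ 2 := by rw [hR, hP, hQ]; ring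
          have e2 : R * (q.1 ^ 2 + q.2 ^ 2) = P ^ 2 + Q' ^ 2 := by rw [hpq, hR, hQ']; ring
          have e4 : R * (ζ₃ 0 * p.1 + ζ₃ 1 * p.2) = P * (ζ₁ 0 * ζ₃ 0 + ζ₁ 1 * ζ₃ 1) + Q * Y := by
            rw [hR, hP, hQ, hY]; ring
          have e5 : R * (ζ₃ 0 * q.1 + ζ₃ 1 * q.2) = P * (ζ₁ 0 * ζ₃ 0 + ζ₁ 1 * ζ₃ 1) + Q' * Y := by
            rw [hpq, hR, hQ', hY]; ring
          linear_combination -2 * e1 + 2 * e2 + 2 * e4 - 2 * e5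
        have h5 : |(-2 * (p.1 ^ 2 + p.2 ^ 2) + 2 * (ζ₃ 0 * p.1 + ζ₃ 1 * p.2)) -
            (-2 * (q.1 ^ 2 + q.2 ^ 2) + 2 * (ζ₃ 0 * q.1 + ζ₃ 1 * q.2))| ≤ 2 * D := by
          rw [abs_le] at h1 h2 ⊢
          constructor <;> linarith [h1.1, h1.2, h2.1, h2.2]
        have h6 : β ≤ |Q + Q' - Y| := by
          have : β ≤ σ * (Q + Q' - Y) := by
            have e6 : σ * (Q + Q' - Y) =
              (σ * (ζ₁ 0 * (p.2 - (ζ₃ 1 - p.2)) - ζ₁ 1 * (p.1 - (ζ₃ 0 - p.1))) +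
              σ * (ζ₁ 0 * (q.2 - (ζ₃ 1 - q.2)) - ζ₁ 1 * (q.1 - (ζ₃ 0 - q.1)))) / 2 := by
                rw [hQ, hQ', hY]; ring
            rw [e6]; linarith
          rcases hσ with rfl | rfl
          · exact le_abs.2 (Or.inl (by linarith))
          · exact le_abs.2 (Or.inr (by linarith))
        rw [le_div_iff₀ hβ]
        have h7 : 2 * |Q - Q'| * β ≤ R * (2 * D) := by
          calc 2 * |Q - Q'| * β ≤ 2 * |Q - Q'| * |Q + Q' - Y| := by gcongr
            _ = R * |(-2 * (p.1 ^ 2 + p.2 ^ 2) + 2 * (ζ₃ 0 * p.1 + ζ₃ 1 * p.2)) -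
              (-2 * (q.1 ^ 2 + q.2 ^ 2) + 2 * (ζ₃ 0 * q.1 + ζ₃ 1 * q.2))| := by
                rw [← abs_of_pos hpos, ← abs_mul, e3, abs_neg, abs_mul, abs_mul]; norm_num
            _ ≤ _ := by gcongr
        linarith
      · rw [hdet, abs_of_pos hpos]
    · rw [← ENNReal.ofReal_mul (by positivity)]
      apply ENNReal.ofReal_le_ofReal
      apply le_of_eq
      field_simp; ring
  have hcov : S ⊆ (S ∩ {ζ | β ≤ (1 : ℝ) * crs ζ₁ (ζ - (ζ₃ - ζ))}) ∪
      (S ∩ {ζ | β ≤ (-1 : ℝ) * crs ζ₁ (ζ - (ζ₃ - ζ))}) := by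
    intro ζ hζ
    rcases le_abs.1 (h ζ hζ).2.2.2 with h1 | h1
    · exact Or.inl ⟨hζ, by simpa using h1⟩
    · exact Or.inr ⟨hζ, by simpa using h1⟩
  refine (measure_mono hcov).trans ((measure_union_le _ _).trans
    ((add_le_add (key 1 (Or.inl rfl)) (key (-1) (Or.inr rfl))).trans ?_))
  rw [← ENNReal.ofReal_add (by positivity) (by positivity)]
  exact ENNReal.ofReal_le_ofReal (le_of_eq (by ring))

/-- Two modulation constraints inside a sector. -/
lemma volume_sector_le {ζ₁ : SpaceTime} {M₂ M₃ s L A : ℝ} (hM₂ : 0 ≤ M₂)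
    (hL : 0 ≤ L) (hA : 0 < A) {i j : Fin 3} (hij : i = 0 ∧ j = 1 ∨ i = 1 ∧ j = 0)
    {S : Set SpaceTime} (hS : MeasurableSet S) (hs : A ≤ |ζ₁ i + ζ₁ j * s|)
    (h : ∀ ζ ∈ S, |modulation ζ| ≤ 2 * M₂ ∧ |modulation (ζ₁ + ζ)| ≤ 2 * M₃ ∧
      |ζ j - s * ζ i| ≤ L) :
    volume S ≤ ENNReal.ofReal (16 * (L * M₂ * M₃ / A)) := by
  refine (volume_le_of_modulation_slices hS (c := 0) (D := 2 * M₂)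
      (κ := ENNReal.ofReal (2 * L * (2 * M₃ / A)))
      (fun ζ hζ => by simpa using (h ζ hζ).1) ?_).trans ?_
  · intro m
    -- Along a line with `ζ j - s * ζ i` constant, the dot product with `ζ₁` changes at the rate `ζ₁
    -- i + ζ₁ j * s` in the coordinate `ζ i`.
    have hfin : ∀ P Q : ℝ, |2 * (P - Q) * (ζ₁ i + ζ₁ j * s)| ≤ 4 * M₃ → |P - Q| ≤ 2 * M₃ / A := by
      intro P Q hPQ
      rw [le_div_iff₀ hA]
      rw [abs_mul, abs_mul] at hPQ
      norm_num at hPQ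
      nlinarith [mul_le_mul_of_nonneg_left hs (abs_nonneg (P - Q))]
    rcases hij with ⟨rfl, rfl⟩ | ⟨rfl, rfl⟩
    · refine (area_le_of_linear (measurableSet_slice hS m) (a := -s) (b := 1) (c := 1) (d := 0)
        (α := 0) (L₁ := L) (L₂ := 2 * M₃ / A) (by norm_num) hL ?_ ?_).trans (by norm_num)
      · intro p hp
        have := (h _ hp).2.2
        simp only [pt_zero, pt_one] at this
        rw [show -s * p.1 + 1 * p.2 - 0 = p.2 - s * p.1 by ring]; exact this
      · intro p hp q hq hpq
        rw [show 1 * p.1 + 0 * p.2 - (1 * q.1 + 0 * q.2) = p.1 - q.1 by ring]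
        apply hfin
        have h1 := (h _ hp).2.1
        have h2 := (h _ hq).2.1
        rw [modulation_add] at h1 h2
        simp only [modulation, xiSq, dot, pt_zero, pt_one, pt_two] at h1 h2
        have e : 2 * (p.1 - q.1) * (ζ₁ 0 + ζ₁ 1 * s) =
            2 * (ζ₁ 0 * p.1 + ζ₁ 1 * p.2) - 2 * (ζ₁ 0 * q.1 + ζ₁ 1 * q.2) := by
          linear_combination -2 * ζ₁ 1 * hpq
        rw [e]
        rw [abs_le] at h1 h2 ⊢
        constructor <;> linarith [h1.1, h1.2, h2.1, h2.2]
    · refine (area_le_of_linear (measurableSet_slice hS m) (a := 1) (b := -s) (c := 0) (d := 1)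
        (α := 0) (L₁ := L) (L₂ := 2 * M₃ / A) (by norm_num) hL ?_ ?_).trans (by norm_num)
      · intro p hp
        have := (h _ hp).2.2
        simp only [pt_zero, pt_one] at this
        rw [show 1 * p.1 + -s * p.2 - 0 = p.1 - s * p.2 by ring]; exact this
      · intro p hp q hq hpq
        rw [show 0 * p.1 + 1 * p.2 - (0 * q.1 + 1 * q.2) = p.2 - q.2 by ring]
        apply hfin
        have h1 := (h _ hp).2.1
        have h2 := (h _ hq).2.1
        rw [modulation_add] at h1 h2
        simp only [modulation, xiSq, dot, pt_zero, pt_one, pt_two] at h1 h2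
        have e : 2 * (p.2 - q.2) * (ζ₁ 1 + ζ₁ 0 * s) =
            2 * (ζ₁ 0 * p.1 + ζ₁ 1 * p.2) - 2 * (ζ₁ 0 * q.1 + ζ₁ 1 * q.2) := by
          linear_combination -2 * ζ₁ 0 * hpq
        rw [e]
        rw [abs_le] at h1 h2 ⊢
        constructor <;> linarith [h1.1, h1.2, h2.1, h2.2]
  · rw [← ENNReal.ofReal_mul (by positivity)]
    apply ENNReal.ofReal_le_ofReal
    apply le_of_eq
    field_simp; ring


/-! ### Trilinear estimates for dyadic pieces -/

/-- The trilinear form restricted to `E` is bounded with constant `κ^{1/2}`. -/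
def SqBound (E : Set (SpaceTime × SpaceTime)) (κ : ℝ) : Prop :=
  TriBound volume E (ENNReal.ofReal κ ^ (1 / 2 : ℝ))

lemma SqBound.mono {E F : Set (SpaceTime × SpaceTime)} {κ κ' : ℝ} (h : SqBound F κ) (hEF : E ⊆ F)
    (hκ : κ ≤ κ') : SqBound E κ' :=
  TriBound.mono h hEF (ENNReal.rpow_le_rpow (ENNReal.ofReal_le_ofReal hκ) (by norm_num))

lemma SqBound.mono_const {E : Set (SpaceTime × SpaceTime)} {κ κ' : ℝ} (h : SqBound E κ)
    (hκ : κ ≤ κ') : SqBound E κ' := h.mono subset_rfl hκ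

lemma sqrt_four_mul (κ : ℝ) : ENNReal.ofReal (4 * κ) ^ (1 / 2 : ℝ) =
    2 * ENNReal.ofReal κ ^ (1 / 2 : ℝ) := by
  rw [ENNReal.ofReal_mul (by norm_num), ENNReal.mul_rpow_of_nonneg _ _ (by norm_num)]
  congr 1
  rw [show (4 : ℝ) = 2 ^ (2 : ℝ) by norm_num, ← ENNReal.ofReal_rpow_of_pos (by norm_num),
    ← ENNReal.rpow_mul]
  norm_num

/-- It is the square roots that add, so merging two pieces with equal constants costs a factor `4`.
-/
lemma SqBound.union {E F : Set (SpaceTime × SpaceTime)} {κ : ℝ} (hE : MeasurableSet E)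
    (h : SqBound E κ) (h' : SqBound F κ) : SqBound (E ∪ F) (4 * κ) := by
  unfold SqBound
  rw [sqrt_four_mul, two_mul]
  exact TriBound.union hE h h'

lemma SqBound.of_cover {E F G : Set (SpaceTime × SpaceTime)} {κ : ℝ} (hE : MeasurableSet E)
    (h : SqBound E κ) (h' : SqBound F κ) (hG : G ⊆ E ∪ F) : SqBound G (4 * κ) :=
  (h.union hE h').mono hG le_rfl

/-- Again the square roots add: they form a geometric series of ratio `1/2`, with sum `2 κ^{1/2}`.
-/
lemma SqBound.iUnion_geometric {E : ℕ → Set (SpaceTime × SpaceTime)} {κ : ℝ}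
    (hE : ∀ n, MeasurableSet (E n)) (h : ∀ n, SqBound (E n) (κ * (1 / 4) ^ n)) :
    SqBound (⋃ n, E n) (4 * κ) := by
  unfold SqBound
  have := TriBound.iUnion hE h
  suffices heq : ENNReal.ofReal (4 * κ) ^ (1 / 2 : ℝ) =
      ∑' n : ℕ, ENNReal.ofReal (κ * (1 / 4) ^ n) ^ (1 / 2 : ℝ) by rw [heq]; exact this
  have h1 : ∀ n : ℕ, ENNReal.ofReal (κ * (1 / 4) ^ n) ^ (1 / 2 : ℝ) =
      ENNReal.ofReal κ ^ (1 / 2 : ℝ) * (2⁻¹ : ℝ≥0∞) ^ n := by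
    intro n
    rw [ENNReal.ofReal_mul' (by positivity), ENNReal.mul_rpow_of_nonneg _ _ (by norm_num)]
    congr 1
    rw [show ((1 : ℝ) / 4) ^ n = ((1 / 2) ^ n) ^ (2 : ℝ) by
      rw [Real.rpow_two, ← pow_mul, mul_comm, pow_mul]; norm_num,
      ← ENNReal.ofReal_rpow_of_pos (by positivity), ← ENNReal.rpow_mul]
    have h2 : ENNReal.ofReal (1 / 2) = 2⁻¹ := by
      rw [one_div, ENNReal.ofReal_inv_of_pos (by norm_num)]; norm_num
    norm_num [ENNReal.ofReal_pow, h2]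
  simp_rw [h1]
  rw [ENNReal.tsum_mul_left, ENNReal.tsum_geometric, sqrt_four_mul, ENNReal.one_sub_inv_two, inv_inv,
    mul_comm]

lemma sqBound_empty {E : Set (SpaceTime × SpaceTime)} (hE : ∀ p, p ∉ E) (κ : ℝ) : SqBound E κ := by
  intro f₁ f₂ f₃ _ _ _
  have : E = ∅ := Set.eq_empty_iff_forall_notMem.2 hE
  simp [triForm, this]

/-- Frequencies of parabolic size in `[N/2, 2N]` and modulation at most `2M`. -/
def annMod (N M : ℝ) : Set SpaceTime := {ζ | ζ ∈ ballMod N M ∧ N ^ 2 / 4 ≤ |ζ 2| + xiSq ζ}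

lemma isClosed_annMod (N M : ℝ) : IsClosed (annMod N M) :=
  isClosed_setOf_and (isClosed_ballMod N M) (isClosed_le (by fun_prop) (by fun_prop))

lemma ballMod.xiSq_le {N M : ℝ} {ζ : SpaceTime} (h : ζ ∈ ballMod N M) : xiSq ζ ≤ 4 * N ^ 2 := by
  linarith [h.1, abs_nonneg (ζ 2)]

/-- Subtract `|τ| - |ξ|² ≤ |modulation| ≤ 2M` from `|τ| + |ξ|² ≥ N²/4`: away from large modulation,
the spatial frequency carries the size. -/
lemma annMod.le_xiSq {N M : ℝ} {ζ : SpaceTime} (h : ζ ∈ annMod N M) :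
    N ^ 2 / 8 - M ≤ xiSq ζ := by
  have h1 := h.2
  have h2 := h.1.2
  have : |ζ 2| - xiSq ζ ≤ |modulation ζ| := by
    unfold modulation
    have := abs_sub_abs_le_abs_sub (ζ 2) (xiSq ζ)
    rwa [abs_of_nonneg (xiSq_nonneg ζ)] at this
  linarith

lemma sqBound_of_sum_slice_fst {E : Set (SpaceTime × SpaceTime)} (hE : MeasurableSet E) {κ : ℝ}
    (h : ∀ w, volume {x | (x, w - x) ∈ E} ≤ ENNReal.ofReal κ) : SqBound E κ :=
  (triBound_of_sum_slice (E := Prod.swap ⁻¹' E) (hE.preimage measurable_swap) h).swap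
    (hE.preimage measurable_swap)

/-- Low frequency in the first variable. -/
lemma sqBound_low_fst {N H H' M₁ M₂ M₃ Λ : ℝ} (hN : 0 < N) (hH : 0 < H) (hH' : 0 < H')
    (hM₁ : 0 < M₁) (hM₂ : 0 < M₂) (hM₃ : 0 < M₃) (hΛ : 1 ≤ Λ) (hNH : N ≤ Λ * H)
    {E : Set (SpaceTime × SpaceTime)} (hE : MeasurableSet E)
    (h : ∀ p ∈ E, p.1 ∈ ballMod N M₁ ∧ p.2 ∈ annMod H M₂ ∧ p.1 + p.2 ∈ annMod H' M₃) :
    SqBound E (4096 * Λ * (M₁ * M₃ * N / H)) ∧ SqBound E (4096 * Λ * (M₁ * M₂ * N / H')) := by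
  constructor
  -- Fixing `y` uses the modulations of `x` and `x + y` and gives up `M₂`. Fixing the sum, in the
  -- second half, uses those of `x` and `y` and gives up `M₃`.
  · refine triBound_of_snd_slice hE fun y => ?_
    rcases Set.eq_empty_or_nonempty {x | (x, y) ∈ E} with hem | ⟨x, hx⟩
    · simp [hem]
    refine (measure_mono fun x hx => ?_).trans
      (volume_translate_le hM₁ hM₃ hH hN hΛ hNH (h _ hx).2.1.2)
    exact ⟨(h _ hx).1, (h _ hx).2.2.1.2⟩
  · refine SqBound.mono_const (κ := 4096 * (M₁ * M₂ * N / H')) ?_ ?_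
    · refine sqBound_of_sum_slice_fst hE fun w => ?_
      rcases Set.eq_empty_or_nonempty {x | (x, w - x) ∈ E} with hem | ⟨x, hx⟩
      · simp [hem]
      have hw := (h _ hx).2.2.2
      simp only [add_sub_cancel] at hw
      refine (measure_mono fun x hx => ?_).trans (volume_reflect_le hM₁ hM₂ hH' hN hw)
      exact ⟨(h _ hx).1, (h _ hx).2.1.1.2⟩
    · gcongr
      linarith

/-- Low frequency in the sum. -/
lemma sqBound_low_sum_aux {N H M₁ M₃ Λ : ℝ} (hN : 0 < N) (hH : 0 < H)
    (hM₁ : 0 < M₁) (hM₃ : 0 < M₃) (hΛ : 1 ≤ Λ) (hNH : N ≤ Λ * H)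
    {E : Set (SpaceTime × SpaceTime)} (hE : MeasurableSet E)
    (h : ∀ p ∈ E, |modulation p.1| ≤ 2 * M₁ ∧ H ^ 2 / 4 ≤ |p.2 2| + xiSq p.2 ∧
      p.1 + p.2 ∈ ballMod N M₃) :
    SqBound E (4096 * Λ * (M₃ * M₁ * N / H)) := by
  refine triBound_of_snd_slice hE fun y => ?_
  rcases Set.eq_empty_or_nonempty {x | (x, y) ∈ E} with hem | ⟨x, hx⟩
  · simp [hem]
  have hy : H ^ 2 / 4 ≤ |(-y) 2| + xiSq (-y) := by
    simpa [xiSq] using (h _ hx).2.1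
  -- The slice is described by the sum, which is the low variable here; the first factor is then its
  -- translate by `-y`.
  refine le_trans (le_trans (measure_mono fun x hx => ?_) (measure_preimage_add_right volume y
    {ζ | ζ ∈ ballMod N M₃ ∧ |modulation (ζ + -y)| ≤ 2 * M₁}).le)
    (volume_translate_le hM₃ hM₁ hH hN hΛ hNH hy)
  exact ⟨(h _ hx).2.2, by simpa using (h _ hx).1⟩

lemma sqBound_low_sum {N H H' M₁ M₂ M₃ Λ : ℝ} (hN : 0 < N) (hH : 0 < H) (hH' : 0 < H')
    (hM₁ : 0 < M₁) (hM₂ : 0 < M₂) (hM₃ : 0 < M₃) (hΛ : 1 ≤ Λ) (hNH : N ≤ Λ * H)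
    (hNH' : N ≤ Λ * H') {E : Set (SpaceTime × SpaceTime)} (hE : MeasurableSet E)
    (h : ∀ p ∈ E, p.1 ∈ annMod H M₁ ∧ p.2 ∈ annMod H' M₂ ∧ p.1 + p.2 ∈ ballMod N M₃) :
    SqBound E (4096 * Λ * (M₃ * M₁ * N / H')) ∧ SqBound E (4096 * Λ * (M₃ * M₂ * N / H)) := by
  constructor
  · exact sqBound_low_sum_aux hN hH' hM₁ hM₃ hΛ hNH' hE fun p hp =>
      ⟨(h p hp).1.1.2, (h p hp).2.1.2, (h p hp).2.2⟩
  · have := sqBound_low_sum_aux hN hH hM₂ hM₃ hΛ hNH (hE.preimage measurable_swap)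
      fun p hp => ⟨(h _ hp).2.1.1.2, (h _ hp).1.2, by
        have := (h _ hp).2.2; simpa [add_comm] using this⟩
    exact TriBound.swap (hE.preimage measurable_swap) this

/-- Transversal interactions. -/
lemma sqBound_transversal {M₂ M₃ c D β : ℝ} (hM₂ : 0 ≤ M₂) (hM₃ : 0 ≤ M₃)
    (hD : 0 ≤ D) (hβ : 0 < β) {E : Set (SpaceTime × SpaceTime)} (hE : MeasurableSet E)
    (h : ∀ p ∈ E, |modulation p.1 - c| ≤ D ∧ |modulation p.2| ≤ 2 * M₂ ∧
      |modulation (p.1 + p.2)| ≤ 2 * M₃)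
    (hcrs : ∀ x x' y, (x, y) ∈ E → (x', y) ∈ E → β ≤ |crs x (y - x')|) :
    SqBound E (16 * (D * M₂ * M₃ / β)) := by
  refine triBound_of_measure_le hE fun x w => ?_
  refine volume_transversal_le (ζ₁ := x) (ζ₃ := w) (c := c) hM₂ hM₃ hD hβ ?_ ?_
  · exact (hE.preimage (by fun_prop : Measurable fun y => (x, y))).inter
      (hE.preimage (by fun_prop : Measurable fun y => (w - y, y)))
  · intro y hy
    exact ⟨(h _ hy.1).2.1, (h _ hy.1).2.2, (h _ hy.2).1, hcrs _ _ _ hy.1 hy.2⟩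

lemma crs_sub_right (x y y' : SpaceTime) : crs x (y - y') = crs x y - crs x y' := by
  simp only [crs, PiLp.sub_apply]; ring

/-- Expand `x` and `x'` in the orthogonal frame of `y` and its rotation. Consequently two vectors
almost orthogonal to the same `y` are almost parallel. -/
lemma crs_mul_xiSq (x x' y : SpaceTime) :
    crs x x' * xiSq y = dot x' y * crs x y - dot x y * crs x' y := by
  simp only [crs, dot, xiSq]; ring

/-- Interactions of three comparable frequencies. -/
lemma sqBound_comparable {N₁ N₂ N₃ M₁ M₂ M₃ Λ r : ℝ} (hr : 0 < r) (hΛ : 1 ≤ Λ)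
    (hM₁ : 0 < M₁) (hM₂ : 0 < M₂) (hM₃ : 0 < M₃)
    (h₁ : r ≤ N₁) (h₁' : N₁ ≤ Λ * r) (h₂ : r ≤ N₂) (h₂' : N₂ ≤ Λ * r) (h₃ : r ≤ N₃)
    {E : Set (SpaceTime × SpaceTime)} (hE : MeasurableSet E)
    (h : ∀ p ∈ E, p.1 ∈ annMod N₁ M₁ ∧ p.2 ∈ annMod N₂ M₂ ∧ p.1 + p.2 ∈ annMod N₃ M₃) :
    SqBound E (2 ^ 27 * Λ ^ 4 * (M₁ * M₂ * M₃ / r ^ 2)) := by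
  -- Threshold for a large modulation. The exponent `15` serves the bound `|crs x x'| ≤ 384 ε Λ² ≤
  -- r²/64` below.
  set ε := r ^ 2 / (2 ^ 15 * Λ ^ 2) with hε
  have hε0 : 0 < ε := by positivity
  have hN₁ : 0 < N₁ := hr.trans_le h₁
  have hN₂ : 0 < N₂ := hr.trans_le h₂
  have hN₃ : 0 < N₃ := hr.trans_le h₃
  -- If one modulation `C` is at least `ε`, the bound by the other two already suffices, since `C /
  -- r²` is bounded below.
  have key : ∀ {A B C P Q κ : ℝ}, 0 < A → 0 < B → ε ≤ C → 0 < P → r ≤ Q → P ≤ Λ * r →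
      κ = A * B * C → 4096 * Λ * (A * B * P / Q) ≤ 2 ^ 27 * Λ ^ 4 * (κ / r ^ 2) := by
    intro A B C P Q κ hA hB hC hP hQ hPr hκ
    have hPQ : P / Q ≤ Λ := by
      rw [div_le_iff₀ (hr.trans_le hQ)]; exact hPr.trans (by gcongr)
    have h1 : 1 ≤ 2 ^ 15 * Λ ^ 2 * (C / r ^ 2) := by
      rw [hε, div_le_iff₀ (by positivity)] at hC
      rw [← mul_div_assoc, le_div_iff₀ (by positivity)]; linarith
    calc 4096 * Λ * (A * B * P / Q) = 4096 * Λ * (A * B) * (P / Q) := by ring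
      _ ≤ 4096 * Λ * (A * B) * Λ * 1 := by rw [mul_one]; gcongr
      _ ≤ 4096 * Λ * (A * B) * Λ * (2 ^ 15 * Λ ^ 2 * (C / r ^ 2)) := by gcongr
      _ = _ := by rw [hκ]; ring
  by_cases hc₁ : ε ≤ M₁
  · have hsw := (sqBound_low_fst hN₂ hN₁ hN₃ hM₂ hM₁ hM₃ hΛ
      (h₂'.trans (by gcongr)) (hE.preimage measurable_swap) fun p hp =>
        ⟨(h _ hp).2.1.1, (h _ hp).1, by have := (h _ hp).2.2; simpa [add_comm] using this⟩).1
    have hsw' : SqBound E _ := TriBound.swap (hE.preimage measurable_swap) hsw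
    exact hsw'.mono_const (key hM₂ hM₃ hc₁ hN₂ h₁ h₂' (by ring))
  have hlow := sqBound_low_fst hN₁ hN₂ hN₃ hM₁ hM₂ hM₃ hΛ (h₁'.trans (by gcongr)) hE fun p hp =>
        ⟨(h _ hp).1.1, (h _ hp).2.1, (h _ hp).2.2⟩
  by_cases hc₂ : ε ≤ M₂
  · exact hlow.1.mono_const (key hM₁ hM₃ hc₂ hN₁ h₂ h₁' (by ring))
  by_cases hc₃ : ε ≤ M₃
  · exact hlow.2.mono_const (key hM₁ hM₂ hc₃ hN₁ h₃ h₁' (by ring))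
  push Not at hc₁ hc₂ hc₃
  have hεr : 2 ^ 15 * ε ≤ r ^ 2 := by
    rw [hε, ← mul_div_assoc, div_le_iff₀ (by positivity)]
    nlinarith [sq_nonneg r, sq_nonneg (Λ - 1), mul_le_mul hΛ hΛ zero_le_one (by linarith)]
  have hεΛ : 2 ^ 15 * (ε * Λ ^ 2) = r ^ 2 := by rw [hε]; field_simp
  have hdot : ∀ x y, (x, y) ∈ E → |dot x y| ≤ 3 * ε := by
    intro x y hxy
    have a1 := (h _ hxy).1.1.2
    have a2 := (h _ hxy).2.1.1.2
    have a3 := (h _ hxy).2.2.1.2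
    rw [modulation_add] at a3
    simp only [abs_le] at a1 a2 a3 ⊢
    constructor <;> linarith [a1.1, a1.2, a2.1, a2.2, a3.1, a3.2]
  have hx : ∀ x y, (x, y) ∈ E → (r / 4) ^ 2 ≤ xiSq x ∧ (r / 4) ^ 2 ≤ xiSq y := by
    intro x y hxy
    have a1 := annMod.le_xiSq (h _ hxy).1
    have a2 := annMod.le_xiSq (h _ hxy).2.1
    have b1 : r ^ 2 ≤ N₁ ^ 2 := by gcongr
    have b2 : r ^ 2 ≤ N₂ ^ 2 := by gcongr
    constructor <;> nlinarith
  have hcrs1 : ∀ x y, (x, y) ∈ E → r ^ 2 / 32 ≤ |crs x y| := by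
    intro x y hxy
    have a1 := dot_sq_add_crs_sq x y
    have a2 := mul_le_mul (hx x y hxy).1 (hx x y hxy).2 (by positivity) (xiSq_nonneg _)
    have a3 : dot x y ^ 2 ≤ (3 * ε) ^ 2 := sq_le_sq' (abs_le.1 (hdot x y hxy)).1
      (abs_le.1 (hdot x y hxy)).2
    have a4 : (3 * ε) ^ 2 ≤ (r ^ 2 / 100) ^ 2 := by gcongr; linarith
    apply le_of_sq_le_sq _ (abs_nonneg _)
    rw [sq_abs]
    nlinarith [sq_nonneg (r ^ 2)]
  have hcrs2 : ∀ x y, (x, y) ∈ E → |crs x y| ≤ 4 * (Λ * r) ^ 2 := by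
    intro x y hxy
    have a1 := ballMod.xiSq_le (h _ hxy).1.1
    have a2 := ballMod.xiSq_le (h _ hxy).2.1.1
    have b1 : N₁ ^ 2 ≤ (Λ * r) ^ 2 := by gcongr
    have b2 : N₂ ^ 2 ≤ (Λ * r) ^ 2 := by gcongr
    refine (crs_le x y (a := 2 * (Λ * r)) (b := 2 * (Λ * r)) (by positivity) (by positivity)
      (by nlinarith) (by nlinarith)).trans (le_of_eq (by ring))
  have := sqBound_transversal (c := 0) (D := 2 * M₁) (β := r ^ 2 / 64) hM₂.le hM₃.le
    (by positivity) (by positivity) hE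
    (fun p hp => ⟨by simpa using (h p hp).1.1.2, (h p hp).2.1.1.2, (h p hp).2.2.1.2⟩) ?_
  · refine this.mono_const ?_
    rw [show 16 * (2 * M₁ * M₂ * M₃ / (r ^ 2 / 64)) = 2048 * (M₁ * M₂ * M₃ / r ^ 2) by
      field_simp; ring]
    gcongr
    have : 1 ≤ Λ ^ 4 := one_le_pow₀ hΛ
    linarith
  · intro x x' y hxy hx'y
    -- Both `x` and `x'` are almost orthogonal to `y`, hence almost parallel to each other. So `crs
    -- x (y - x')` stays close to `crs x y`, which is at least `r²/32` in absolute value.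
    have a1 : |crs x x'| ≤ r ^ 2 / 64 := by
      have b1 := crs_mul_xiSq x x' y
      have b2 : |crs x x'| * xiSq y ≤ 24 * (ε * Λ ^ 2) * r ^ 2 := by
        rw [← abs_of_nonneg (xiSq_nonneg y), ← abs_mul, b1]
        calc _ ≤ |dot x' y * crs x y| + |dot x y * crs x' y| := abs_sub _ _
          _ = |dot x' y| * |crs x y| + |dot x y| * |crs x' y| := by rw [abs_mul, abs_mul]
          _ ≤ (3 * ε) * (4 * (Λ * r) ^ 2) + (3 * ε) * (4 * (Λ * r) ^ 2) := by
            gcongr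
            · exact hdot _ _ hx'y
            · exact hcrs2 _ _ hxy
            · exact hdot _ _ hxy
            · exact hcrs2 _ _ hx'y
          _ = _ := by ring
      have b3 : |crs x x'| * (r / 4) ^ 2 ≤ |crs x x'| * xiSq y := by
        gcongr; exact (hx x y hxy).2
      have b4 : |crs x x'| * r ^ 2 ≤ (384 * (ε * Λ ^ 2)) * r ^ 2 := by nlinarith
      have b5 := le_of_mul_le_mul_right b4 (by positivity)
      linarith
    rw [crs_sub_right]
    have a2 := hcrs1 x y hxy
    have a3 := abs_sub_abs_le_abs_sub (crs x y) (crs x x')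
    linarith


/-! ### A low frequency interacting with two much higher ones. -/

lemma floor_sub_floor_mem {a b θ : ℝ} (hθ : 0 < θ) (h : |a - b| ≤ θ) :
    ⌊a / θ⌋ = ⌊b / θ⌋ + 1 ∨ ⌊a / θ⌋ = ⌊b / θ⌋ ∨ ⌊a / θ⌋ = ⌊b / θ⌋ - 1 := by
  have h1 : |a / θ - b / θ| ≤ 1 := by
    rw [← sub_div, abs_div, abs_of_pos hθ]; exact (div_le_one hθ).2 h
  rw [abs_le] at h1
  have h2 : ⌊a / θ⌋ ≤ ⌊b / θ⌋ + 1 := by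
    have := Int.floor_le_floor (show a / θ ≤ b / θ + 1 by linarith)
    rwa [Int.floor_add_one] at this
  have h3 : ⌊b / θ⌋ ≤ ⌊a / θ⌋ + 1 := by
    have := Int.floor_le_floor (show b / θ ≤ a / θ + 1 by linarith)
    rwa [Int.floor_add_one] at this
  omega

/-- Almost collinear interactions, in the chart where the coordinate `i` dominates. -/
lemma sqBound_collinear_chart {N H M₂ M₃ : ℝ} (hN : 0 < N) (hNH : 1024 * N ≤ H)
    (hM₂ : 0 ≤ M₂) (hM₃ : 0 ≤ M₃) {i j : Fin 3} (hij : i = 0 ∧ j = 1 ∨ i = 1 ∧ j = 0)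
    {E : Set (SpaceTime × SpaceTime)} (hE : MeasurableSet E)
    (h : ∀ p ∈ E, |modulation p.2| ≤ 2 * M₂ ∧ |modulation (p.1 + p.2)| ≤ 2 * M₃ ∧
      |crs p.1 p.2| ≤ N ^ 3 / H ∧ N ^ 2 / 32 ≤ |dot p.1 p.2| ∧ xiSq p.1 ≤ (N / 4) ^ 2 ∧
      (H / 4) ^ 2 ≤ xiSq p.2 ∧ xiSq p.2 ≤ (2 * H) ^ 2 ∧ |p.2 j| ≤ |p.2 i|) :
    SqBound E (2 ^ 22 * (M₂ * M₃ * N / H)) := by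
  have hH : 0 < H := by linarith
  -- The angular width of a sector, chosen so that adding `x` changes the slope of `y` by at most
  -- `θ`. The change is the cross product, at most `N³/H`, divided by `(x + y) i * y i`, which is at
  -- least `(H/8)(H/6)` in absolute value.
  set θ : ℝ := 48 * N ^ 3 / H ^ 3 with hθ
  have hθ0 : 0 < θ := by positivity
  set sl : SpaceTime → ℤ := fun ζ => ⌊(ζ j / ζ i) / θ⌋ with hsl
  have hslm : Measurable sl := by
    apply Measurable.floor
    fun_prop
  have hxi : ∀ ζ : SpaceTime, xiSq ζ = ζ i ^ 2 + ζ j ^ 2 := by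
    intro ζ; rcases hij with ⟨rfl, rfl⟩ | ⟨rfl, rfl⟩ <;> simp only [xiSq]; ring
  have hdot : ∀ ζ η : SpaceTime, dot ζ η = ζ i * η i + ζ j * η j := by
    intro ζ η; rcases hij with ⟨rfl, rfl⟩ | ⟨rfl, rfl⟩ <;> simp only [dot]; ring
  have hcrs : ∀ ζ η : SpaceTime, |crs ζ η| = |ζ j * η i - ζ i * η j| := by
    intro ζ η
    rcases hij with ⟨rfl, rfl⟩ | ⟨rfl, rfl⟩ <;> simp only [crs]
    exact abs_sub_comm _ _
  have hyi : ∀ p ∈ E, H / 6 ≤ |p.2 i| ∧ |p.2 i| ≤ 2 * H := by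
    intro p hp
    obtain ⟨-, -, -, -, -, h6, h7, h8⟩ := h p hp
    rw [hxi] at h6 h7
    have h9 : p.2 j ^ 2 ≤ p.2 i ^ 2 := sq_le_sq.2 h8
    constructor
    · apply le_of_sq_le_sq _ (abs_nonneg _); rw [sq_abs]; nlinarith [sq_nonneg H]
    · apply abs_le_of_sq_le_sq _ (by positivity); nlinarith [sq_nonneg (p.2 j)]
  have hx : ∀ p ∈ E, |p.1 i| ≤ N / 4 ∧ |p.1 j| ≤ N / 4 := by
    intro p hp
    have h5 := (h p hp).2.2.2.2.1
    rw [hxi] at h5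
    constructor <;> apply abs_le_of_sq_le_sq _ (by positivity) <;>
      nlinarith [sq_nonneg (p.1 i), sq_nonneg (p.1 j)]
  have hslope : ∀ p ∈ E, |(p.1 + p.2) j / (p.1 + p.2) i - p.2 j / p.2 i| ≤ θ := by
    intro p hp
    have h1 := hyi p hp
    have h2 := hx p hp
    have h3 := (h p hp).2.2.1
    rw [hcrs] at h3
    simp only [PiLp.add_apply]
    have h4 : H / 8 ≤ |p.1 i + p.2 i| := by
      have := abs_sub_abs_le_abs_sub (p.2 i) (-p.1 i)
      rw [abs_neg, sub_neg_eq_add, add_comm] at this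
      linarith [h1.1, h2.1]
    have h5 : p.2 i ≠ 0 := abs_pos.1 (lt_of_lt_of_le (by positivity) h1.1)
    have h6 : p.1 i + p.2 i ≠ 0 := abs_pos.1 (lt_of_lt_of_le (by positivity) h4)
    rw [show (p.1 j + p.2 j) / (p.1 i + p.2 i) - p.2 j / p.2 i =
      (p.1 j * p.2 i - p.1 i * p.2 j) / ((p.1 i + p.2 i) * p.2 i) by field_simp; ring,
      abs_div, abs_mul]
    rw [div_le_iff₀ (by positivity)]
    calc _ ≤ N ^ 3 / H := h3
      _ = θ * (H / 8 * (H / 6)) := by rw [hθ]; field_simp; norm_num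
      _ ≤ _ := by gcongr; exact h1.1
  -- For a fixed label shift `k`, the sector of `x + y` is determined by that of `y`. By
  -- orthogonality it is enough to treat one sector; only `k = 1, 0, -1` occur.
  have hpiece : ∀ k : ℤ, SqBound (E ∩ {p | sl (p.1 + p.2) = sl p.2 + k})
      (2 ^ 18 * (M₂ * M₃ * N / H)) := by
    intro k
    have hEk : MeasurableSet (E ∩ {p | sl (p.1 + p.2) = sl p.2 + k}) :=
      hE.inter (measurableSet_eq_fun
        (hslm.comp (by fun_prop : Measurable fun p : SpaceTime × SpaceTime => p.1 + p.2))
        ((hslm.comp measurable_snd).add_const k))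
    refine triBound_of_labels hEk hslm (hslm.sub_const k)
      (fun x y hxy => by have : sl (x + y) = sl y + k := hxy.2; simp only [this]; ring) ?_
    intro n
    have hEn : MeasurableSet (E ∩ {p | sl (p.1 + p.2) = sl p.2 + k} ∩ {p | sl p.2 = n}) :=
      hEk.inter ((hslm.comp measurable_snd) (measurableSet_singleton n))
    refine triBound_of_fst_slice hEn fun x => ?_
    rcases Set.eq_empty_or_nonempty
      {y | (x, y) ∈ E ∩ {p | sl (p.1 + p.2) = sl p.2 + k} ∩ {p | sl p.2 = n}} with hem | ⟨y₀, hy₀⟩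
    · rw [hem]; simp
    have hstrip : ∀ y, (x, y) ∈ E → sl y = n → |y j - n * θ * y i| ≤ θ * (2 * H) := by
      intro y hy hyn
      have h1 := hyi _ hy
      have h5 : y i ≠ 0 := abs_pos.1 (lt_of_lt_of_le (by positivity) h1.1)
      have h2 : (n : ℝ) ≤ y j / y i / θ := by rw [← hyn]; exact Int.floor_le _
      have h3 : y j / y i / θ < n + 1 := by rw [← hyn]; exact Int.lt_floor_add_one _
      rw [le_div_iff₀ hθ0] at h2
      rw [div_lt_iff₀ hθ0] at h3
      have h4 : |y j / y i - n * θ| ≤ θ := by rw [abs_le]; constructor <;> linarith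
      calc |y j - n * θ * y i| = |y j / y i - n * θ| * |y i| := by
            rw [← abs_mul]; congr 1; field_simp
        _ ≤ θ * (2 * H) := by gcongr; exact h1.2
    -- In the sector, the dot product of `x` and `y` is `(x i + x j * (n * θ)) * y i` up to `N²/64`.
    -- It is at least `N²/32` in absolute value and `|y i| ≤ 2H`.
    have hA : N ^ 2 / (128 * H) ≤ |x i + x j * (n * θ)| := by
      have hy := hy₀.1.1
      have h1 := hyi _ hy
      have h2 := hstrip y₀ hy hy₀.2
      have h3 := (hx _ hy).2
      have h4 := (h _ hy).2.2.2.1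
      rw [hdot] at h4
      have h5 : |x i * y₀ i + x j * y₀ j| ≤ |x i + x j * (n * θ)| * (2 * H) + N ^ 2 / 64 := by
        calc |x i * y₀ i + x j * y₀ j| =
              |(x i + x j * (n * θ)) * y₀ i + x j * (y₀ j - n * θ * y₀ i)| := by congr 1; ring
          _ ≤ |x i + x j * (n * θ)| * |y₀ i| + |x j| * |y₀ j - n * θ * y₀ i| := by
              rw [← abs_mul, ← abs_mul]; exact abs_add_le _ _
          _ ≤ |x i + x j * (n * θ)| * (2 * H) + N / 4 * (θ * (2 * H)) := by
              gcongr; exact h1.2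
          _ ≤ _ := by
              gcongr
              rw [hθ, show N / 4 * (48 * N ^ 3 / H ^ 3 * (2 * H)) = 24 * N ^ 2 * (N / H) ^ 2 by
                field_simp; norm_num]
              have : N / H ≤ 1 / 1024 := by rw [div_le_iff₀ hH]; linarith
              have h6 : (N / H) ^ 2 ≤ (1 / 1024) ^ 2 := by gcongr
              nlinarith [sq_nonneg N]
      rw [div_le_iff₀ (by positivity)]
      linarith
    refine (volume_sector_le (ζ₁ := x) (s := n * θ) (L := θ * (2 * H)) (M₂ := M₂) (M₃ := M₃)
      hM₂ (by positivity) (by positivity) hij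
      (hEn.preimage (by fun_prop : Measurable fun y => (x, y))) hA ?_).trans ?_
    · intro y hy
      exact ⟨(h _ hy.1.1).1, (h _ hy.1.1).2.1, hstrip y hy.1.1 hy.2⟩
    · apply ENNReal.ofReal_le_ofReal
      rw [hθ, show 16 * (48 * N ^ 3 / H ^ 3 * (2 * H) * M₂ * M₃ / (N ^ 2 / (128 * H))) =
        196608 * (M₂ * M₃ * N / H) by field_simp; ring]
      gcongr
      norm_num
  have hmeas : ∀ k : ℤ, MeasurableSet (E ∩ {p | sl (p.1 + p.2) = sl p.2 + k}) := fun k =>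
      hE.inter (measurableSet_eq_fun
        (hslm.comp (by fun_prop : Measurable fun p : SpaceTime × SpaceTime => p.1 + p.2))
        ((hslm.comp measurable_snd).add_const k))
  have h01 := (hpiece 1).union (hmeas 1) (hpiece 0)
  have hm1 : SqBound (E ∩ {p | sl (p.1 + p.2) = sl p.2 + (-1)})
      (4 * (2 ^ 18 * (M₂ * M₃ * N / H))) := (hpiece (-1)).mono_const (by
        have : 0 ≤ M₂ * M₃ * N / H := by positivity
        linarith)
  refine (SqBound.of_cover ((hmeas 1).union (hmeas 0)) h01 hm1 ?_).mono_const (by ring_nf; rfl)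
  intro p hp
  rcases floor_sub_floor_mem hθ0 (hslope p hp) with h1 | h1 | h1
  · exact Or.inl (Or.inl ⟨hp, h1⟩)
  · exact Or.inl (Or.inr ⟨hp, by simp only [add_zero]; exact h1⟩)
  · exact Or.inr ⟨hp, h1⟩

lemma sqBound_collinear {N H M₂ M₃ : ℝ} (hN : 0 < N) (hNH : 1024 * N ≤ H)
    (hM₂ : 0 ≤ M₂) (hM₃ : 0 ≤ M₃) {E : Set (SpaceTime × SpaceTime)} (hE : MeasurableSet E)
    (h : ∀ p ∈ E, |modulation p.2| ≤ 2 * M₂ ∧ |modulation (p.1 + p.2)| ≤ 2 * M₃ ∧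
      |crs p.1 p.2| ≤ N ^ 3 / H ∧ N ^ 2 / 32 ≤ |dot p.1 p.2| ∧ xiSq p.1 ≤ (N / 4) ^ 2 ∧
      (H / 4) ^ 2 ≤ xiSq p.2 ∧ xiSq p.2 ≤ (2 * H) ^ 2) :
    SqBound E (2 ^ 24 * (M₂ * M₃ * N / H)) := by
  have hm : ∀ i j : Fin 3, MeasurableSet (E ∩ {p | |p.2 j| ≤ |p.2 i|}) := fun i j =>
    hE.inter (isClosed_le (by fun_prop) (by fun_prop)).measurableSet
  have h1 := sqBound_collinear_chart hN hNH hM₂ hM₃ (i := 0) (j := 1) (by simp) (hm 0 1)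
    fun p hp => by
      obtain ⟨a, b, c, d, e, f, g⟩ := h p hp.1
      exact ⟨a, b, c, d, e, f, g, hp.2⟩
  have h2 := sqBound_collinear_chart hN hNH hM₂ hM₃ (i := 1) (j := 0) (by simp) (hm 1 0)
    fun p hp => by
      obtain ⟨a, b, c, d, e, f, g⟩ := h p hp.1
      exact ⟨a, b, c, d, e, f, g, hp.2⟩
  refine (SqBound.of_cover (hm 0 1) h1 h2 ?_).mono_const (by ring_nf; rfl)
  intro p hp
  rcases le_total |p.2 1| |p.2 0| with h | h
  · exact Or.inl ⟨hp, h⟩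
  · exact Or.inr ⟨hp, h⟩


/-- The cross product of two admissible first variables is at most `ρ² ≤ β`, so transversality for a
pair of them follows from a lower bound `2β` at each single pair. -/
lemma sqBound_transversal_of_small {M₂ M₃ c D β ρ : ℝ} (hM₂ : 0 ≤ M₂) (hM₃ : 0 ≤ M₃)
    (hD : 0 ≤ D) (hβ : 0 < β) (hρ : 0 ≤ ρ) (hρβ : ρ * ρ ≤ β)
    {E : Set (SpaceTime × SpaceTime)} (hE : MeasurableSet E)
    (h : ∀ p ∈ E, |modulation p.1 - c| ≤ D ∧ |modulation p.2| ≤ 2 * M₂ ∧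
      |modulation (p.1 + p.2)| ≤ 2 * M₃ ∧ xiSq p.1 ≤ ρ ^ 2 ∧ 2 * β ≤ |crs p.1 p.2|) :
    SqBound E (16 * (D * M₂ * M₃ / β)) := by
  refine sqBound_transversal hM₂ hM₃ hD hβ hE
    (fun p hp => ⟨(h p hp).1, (h p hp).2.1, (h p hp).2.2.1⟩) fun x x' y hxy hx'y => ?_
  rw [crs_sub_right]
  have h1 := crs_le x x' hρ hρ (h _ hxy).2.2.2.1 (h _ hx'y).2.2.2.1
  have h2 := (h _ hxy).2.2.2.2
  have h3 := abs_sub_abs_le_abs_sub (crs x y) (crs x x')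
  linarith

/-- Interactions of a low frequency, close to the time frequency axis, with high frequencies. -/
lemma sqBound_low_high_axis {N H M₂ M₃ c : ℝ} (hN : 0 < N) (hNH : 1024 * N ≤ H)
    (hM₂ : 0 ≤ M₂) (hM₃ : 0 ≤ M₃) (hM₂N : M₂ ≤ N ^ 2 / 64) (hM₃N : M₃ ≤ N ^ 2 / 64)
    (hc : |c| = N ^ 2 / 4)
    {E : Set (SpaceTime × SpaceTime)} (hE : MeasurableSet E)
    (h : ∀ p ∈ E, |modulation p.2| ≤ 2 * M₂ ∧ |modulation (p.1 + p.2)| ≤ 2 * M₃ ∧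
      |dot p.1 p.2| ≤ N ^ 2 / 4 ∧ xiSq p.1 ≤ (N / 4) ^ 2 ∧
      (H / 4) ^ 2 ≤ xiSq p.2 ∧ xiSq p.2 ≤ (2 * H) ^ 2 ∧ |modulation p.1 - c| ≤ 2 * xiSq p.1) :
    SqBound E (2 ^ 26 * (M₂ * M₃ * N / H)) := by
  have hH : 0 < H := by linarith
  have hκ0 : 0 ≤ M₂ * M₃ * N / H := by positivity
  -- The modulation of the low variable is within `N²/8` of `c`, and the two high ones are at most
  -- `N²/32`. Hence twice the dot product is within `3N²/16` of `c`.
  have hdot : ∀ p ∈ E, N ^ 2 / 32 ≤ |dot p.1 p.2| := by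
    intro p hp
    obtain ⟨h1, h2, -, h4, -, -, h7⟩ := h p hp
    rw [modulation_add] at h2
    have h8 : |2 * dot p.1 p.2 - c| ≤ 3 * N ^ 2 / 16 := by
      rw [abs_le] at h1 h2 h7 ⊢
      constructor <;> linarith [h1.1, h1.2, h2.1, h2.2, h7.1, h7.2]
    have h9 := abs_sub_abs_le_abs_sub c (2 * dot p.1 p.2)
    rw [abs_sub_comm, hc, abs_mul, abs_two] at h9
    linarith
  have hcm : MeasurableSet {p : SpaceTime × SpaceTime | |crs p.1 p.2| ≤ N ^ 3 / H} :=
    (isClosed_le (by fun_prop) (by fun_prop)).measurableSet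
  have hcm' : MeasurableSet {p : SpaceTime × SpaceTime | N ^ 3 / H ≤ |crs p.1 p.2|} :=
    (isClosed_le (by fun_prop) (by fun_prop)).measurableSet
  have hcol := sqBound_collinear hN hNH hM₂ hM₃ (hE.inter hcm) fun p hp => by
    obtain ⟨h1, h2, h3, h4, h5, h6, h7⟩ := h p hp.1
    exact ⟨h1, h2, hp.2, hdot p hp.1, h4, h5, h6⟩
  have hle : ∀ a : ℝ, MeasurableSet {p : SpaceTime × SpaceTime | xiSq p.1 ≤ a} := fun a =>
    (isClosed_le (by fun_prop) (by fun_prop)).measurableSet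
  have hge : ∀ a : ℝ, MeasurableSet {p : SpaceTime × SpaceTime | a ≤ xiSq p.1} := fun a =>
    (isClosed_le (by fun_prop) (by fun_prop)).measurableSet
  -- Not collinear, with `|ξ| ≤ 4N²/H` for the low variable. The window `2|ξ|²` is of order `N⁴/H²`
  -- and the cross product at least `N³/H`, with quotient of order `N/H`.
  have hZ₁m : MeasurableSet (E ∩ {p | N ^ 3 / H ≤ |crs p.1 p.2|} ∩
      {p | xiSq p.1 ≤ (4 * N ^ 2 / H) ^ 2}) := (hE.inter hcm').inter (hle _)
  have hNH' : N / H ≤ 1 / 1024 := by rw [div_le_iff₀ hH]; linarith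
  have hZ₁ : SqBound (E ∩ {p | N ^ 3 / H ≤ |crs p.1 p.2|} ∩
      {p | xiSq p.1 ≤ (4 * N ^ 2 / H) ^ 2}) (2048 * (M₂ * M₃ * N / H)) := by
    refine (sqBound_transversal_of_small (c := c) (D := 2 * (4 * N ^ 2 / H) ^ 2)
      (β := N ^ 3 / (2 * H)) (ρ := 4 * N ^ 2 / H) hM₂ hM₃ (by positivity) (by positivity)
      (by positivity) ?_ hZ₁m ?_).mono_const ?_
    · rw [show 4 * N ^ 2 / H * (4 * N ^ 2 / H) = 16 * (N ^ 3 / H) * (N / H) by field_simp; ring,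
        show N ^ 3 / (2 * H) = 16 * (N ^ 3 / H) * (1 / 32) by field_simp; ring]
      exact mul_le_mul_of_nonneg_left (by linarith) (by positivity)
    · intro p hp
      have h1 := h p hp.1.1
      refine ⟨h1.2.2.2.2.2.2.trans ?_, h1.1, h1.2.1, hp.2, le_trans (le_of_eq ?_) hp.1.2⟩
      · have : xiSq p.1 ≤ (4 * N ^ 2 / H) ^ 2 := hp.2
        linarith
      · field_simp
    · rw [show 16 * (2 * (4 * N ^ 2 / H) ^ 2 * M₂ * M₃ / (N ^ 3 / (2 * H))) =
        1024 * (M₂ * M₃ * N / H) by field_simp; ring]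
      linarith
  -- Shells `|ξ| ~ ρ` with `ρ = 4^{-n} N/4`. Beyond `4N²/H` the product `|ξ| |η|`, where `η` is the
  -- high spatial frequency, dominates the dot product, so the cross product is of order `ρH`. With
  -- window `2ρ²` the shell contributes `ρ M₂ M₃ / H`; the ratio `4` of the scales matches
  -- `SqBound.iUnion_geometric`.
  set Z : ℕ → Set (SpaceTime × SpaceTime) := fun n =>
    E ∩ {p | (4 * N ^ 2 / H) ^ 2 ≤ xiSq p.1} ∩ {p | ((1 / 4) ^ n * (N / 16)) ^ 2 ≤ xiSq p.1} ∩
      {p | xiSq p.1 ≤ ((1 / 4) ^ n * (N / 4)) ^ 2} with hZ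
  have hZm : ∀ n, MeasurableSet (Z n) := fun n => ((hE.inter (hge _)).inter (hge _)).inter (hle _)
  have hZ₂ : SqBound (⋃ n, Z n) (4 * (512 * (M₂ * M₃ * N / H))) := by
    refine SqBound.iUnion_geometric hZm fun n => ?_
    set ρ : ℝ := (1 / 4) ^ n * (N / 4) with hρ
    have hρ0 : 0 < ρ := by positivity
    have hρN : ρ ≤ N / 4 := by
      rw [hρ]
      exact mul_le_of_le_one_left (by positivity) (pow_le_one₀ (by norm_num) (by norm_num))
    refine (sqBound_transversal_of_small (c := c) (D := 2 * ρ ^ 2)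
      (β := ρ * H / 64) (ρ := ρ) hM₂ hM₃ (by positivity) (by positivity)
      hρ0.le (by nlinarith) (hZm n) ?_).mono_const (le_of_eq ?_)
    · intro p hp
      have h1 := h p hp.1.1.1
      have h2 : (4 * N ^ 2 / H) ^ 2 ≤ xiSq p.1 := hp.1.1.2
      have h3 : ((1 / 4) ^ n * (N / 16)) ^ 2 ≤ xiSq p.1 := hp.1.2
      have h4 : xiSq p.1 ≤ ρ ^ 2 := hp.2
      refine ⟨h1.2.2.2.2.2.2.trans (by linarith), h1.1, h1.2.1, h4, ?_⟩
      rw [show (1 / 4 : ℝ) ^ n * (N / 16) = ρ / 4 by rw [hρ]; ring] at h3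
      have h5 := dot_sq_add_crs_sq p.1 p.2
      have h6 : N ^ 4 ≤ xiSq p.1 * xiSq p.2 := by
        calc N ^ 4 = (4 * N ^ 2 / H) ^ 2 * (H / 4) ^ 2 := by field_simp
          _ ≤ _ := mul_le_mul h2 h1.2.2.2.2.1 (by positivity) (xiSq_nonneg _)
      have h7 : (ρ / 4) ^ 2 * (H / 4) ^ 2 ≤ xiSq p.1 * xiSq p.2 :=
        mul_le_mul h3 h1.2.2.2.2.1 (by positivity) (xiSq_nonneg _)
      have h8 : dot p.1 p.2 ^ 2 ≤ (N ^ 2 / 4) ^ 2 :=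
        sq_le_sq' (abs_le.1 h1.2.2.1).1 (abs_le.1 h1.2.2.1).2
      apply le_of_sq_le_sq _ (abs_nonneg _)
      rw [sq_abs]
      nlinarith
    · rw [show (512 : ℝ) * (M₂ * M₃ * N / H) * (1 / 4) ^ n = 2048 * (M₂ * M₃ * ρ / H) by
        rw [hρ]; ring]
      field_simp; ring
  have hcov : E ∩ {p | N ^ 3 / H ≤ |crs p.1 p.2|} ⊆ (E ∩ {p | N ^ 3 / H ≤ |crs p.1 p.2|} ∩
      {p | xiSq p.1 ≤ (4 * N ^ 2 / H) ^ 2}) ∪ ⋃ n, Z n := by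
    intro p hp
    rcases le_or_gt (xiSq p.1) ((4 * N ^ 2 / H) ^ 2) with h1 | h1
    · exact Or.inl ⟨hp, h1⟩
    right
    set r := Real.sqrt (xiSq p.1) with hr
    have hx0 : 0 < xiSq p.1 := lt_of_le_of_lt (by positivity) h1
    have hr0 : 0 < r := Real.sqrt_pos.2 hx0
    have hr2 : r ^ 2 = xiSq p.1 := Real.sq_sqrt hx0.le
    have hr4 : r ≤ N / 4 := by
      apply le_of_sq_le_sq _ (by positivity)
      rw [hr2]; exact (h p hp.1).2.2.2.1
    obtain ⟨n, hn1, hn2⟩ := exists_nat_pow_near_of_lt_one (x := r / (N / 4)) (y := 1 / 4)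
      (by positivity) ((div_le_one (by positivity)).2 hr4) (by norm_num) (by norm_num)
    rw [lt_div_iff₀ (by positivity)] at hn1
    rw [div_le_iff₀ (by positivity)] at hn2
    refine Set.mem_iUnion.2 ⟨n, ⟨⟨hp.1, h1.le⟩, ?_⟩, ?_⟩
    · show ((1 / 4) ^ n * (N / 16)) ^ 2 ≤ xiSq p.1
      rw [← hr2]
      gcongr
      rw [pow_succ] at hn1
      linarith
    · show xiSq p.1 ≤ ((1 / 4) ^ n * (N / 4)) ^ 2
      rw [← hr2]
      gcongr
  have hZ' := SqBound.of_cover hZ₁m hZ₁ (hZ₂.mono_const (by linarith)) hcov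
  refine (SqBound.of_cover (hE.inter hcm) hcol (hZ'.mono_const (by linarith)) ?_).mono_const
    (by ring_nf; rfl)
  intro p hp
  rcases le_total |crs p.1 p.2| (N ^ 3 / H) with h1 | h1
  · exact Or.inl ⟨hp, h1⟩
  · exact Or.inr ⟨hp, h1⟩

/-- Interactions of a low frequency with high frequencies, all modulations being small. -/
lemma sqBound_low_high {N H M₁ M₂ M₃ : ℝ} (hN : 0 < N) (hNH : 1024 * N ≤ H)
    (hM₁ : 0 < M₁) (hM₂ : 0 ≤ M₂) (hM₃ : 0 ≤ M₃) (hM₁N : M₁ ≤ N ^ 2 / 8)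
    (hM₂N : M₂ ≤ N ^ 2 / 64) (hM₃N : M₃ ≤ N ^ 2 / 64)
    {E : Set (SpaceTime × SpaceTime)} (hE : MeasurableSet E)
    (h : ∀ p ∈ E, p.1 ∈ annMod N M₁ ∧ p.2 ∈ annMod H M₂ ∧ |modulation (p.1 + p.2)| ≤ 2 * M₃) :
    SqBound E (2 ^ 34 * (M₁ * M₂ * M₃ / (N * H))) := by
  have hH : 0 < H := by linarith
  have hκ0 : 0 ≤ M₁ * M₂ * M₃ / (N * H) := by positivity
  have hNN : 1024 * N ^ 2 ≤ N * H := by nlinarith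
  have hNH2 : 1024 ^ 2 * N ^ 2 ≤ H ^ 2 := by nlinarith
  have hdot : ∀ p ∈ E, |dot p.1 p.2| ≤ N ^ 2 / 4 := by
    intro p hp
    obtain ⟨h1, h2, h3⟩ := h p hp
    have h4 := h1.1.2
    have h5 := h2.1.2
    rw [modulation_add] at h3
    rw [abs_le] at h3 h4 h5 ⊢
    constructor <;> linarith [h3.1, h3.2, h4.1, h4.2, h5.1, h5.2, sq_nonneg N]
  have hy : ∀ p ∈ E, (H / 4) ^ 2 ≤ xiSq p.2 ∧ xiSq p.2 ≤ (2 * H) ^ 2 := by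
    intro p hp
    have h1 := annMod.le_xiSq (h p hp).2.1
    have h2 := ballMod.xiSq_le (h p hp).2.1.1
    constructor <;> nlinarith
  have hge : MeasurableSet {p : SpaceTime × SpaceTime | (N / 4) ^ 2 ≤ xiSq p.1} :=
    (isClosed_le (by fun_prop) (by fun_prop)).measurableSet
  have hle : MeasurableSet {p : SpaceTime × SpaceTime | xiSq p.1 ≤ (N / 4) ^ 2} :=
    (isClosed_le (by fun_prop) (by fun_prop)).measurableSet
  -- Away from the `τ`-axis the dot product, at most `N²/4`, is negligible against `N H`. The cross
  -- product is therefore of order `N H`, and no localization of `M₁` is needed.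
  have ha : SqBound (E ∩ {p | (N / 4) ^ 2 ≤ xiSq p.1}) (2048 * (M₁ * M₂ * M₃ / (N * H))) := by
    refine (sqBound_transversal_of_small (c := 0) (D := 2 * M₁) (β := N * H / 64) (ρ := 2 * N)
      hM₂ hM₃ (by positivity) (by positivity) (by positivity) (by nlinarith) (hE.inter hge)
      ?_).mono_const (le_of_eq (by field_simp; ring))
    intro p hp
    obtain ⟨h1, h2, h3⟩ := h p hp.1
    refine ⟨by simpa using h1.1.2, h2.1.2, h3, (ballMod.xiSq_le h1.1).trans (by nlinarith), ?_⟩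
    have h5 := dot_sq_add_crs_sq p.1 p.2
    have h4 : (N / 4) ^ 2 ≤ xiSq p.1 := hp.2
    have h6 : (N / 4) ^ 2 * (H / 4) ^ 2 ≤ xiSq p.1 * xiSq p.2 :=
      mul_le_mul h4 (hy p hp.1).1 (by positivity) (xiSq_nonneg _)
    have h7 : dot p.1 p.2 ^ 2 ≤ (N ^ 2 / 4) ^ 2 :=
      sq_le_sq' (abs_le.1 (hdot p hp.1)).1 (abs_le.1 (hdot p hp.1)).2
    have h8 : N ^ 2 * (1024 ^ 2 * N ^ 2) ≤ N ^ 2 * H ^ 2 := by gcongr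
    apply le_of_sq_le_sq _ (abs_nonneg _)
    rw [sq_abs]
    nlinarith
  have hb : ∀ σ : ℝ, (σ = 1 ∨ σ = -1) →
      SqBound (E ∩ {p | xiSq p.1 ≤ (N / 4) ^ 2} ∩ {p | 0 ≤ σ * p.1 2})
        (2 ^ 30 * (M₁ * M₂ * M₃ / (N * H))) := by
    intro σ hσ
    have hm : MeasurableSet (E ∩ {p | xiSq p.1 ≤ (N / 4) ^ 2} ∩ {p | 0 ≤ σ * p.1 2}) :=
      (hE.inter hle).inter (isClosed_le (by fun_prop) (by fun_prop)).measurableSet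
    have habs : ∀ p : SpaceTime × SpaceTime, 0 ≤ σ * p.1 2 → |p.1 2| = σ * p.1 2 := by
      intro p hp
      rcases hσ with rfl | rfl
      · rw [one_mul] at hp ⊢; exact abs_of_nonneg hp
      · rw [abs_of_nonpos (by linarith)]; ring
    by_cases hM₁' : N ^ 2 / 16 ≤ M₁
    -- `|τ| + |ξ|² ≥ N²/4` bounds the modulation from one side and `2M₁ ≤ N²/4` from the other.
    -- Together they place it within `2|ξ|²` of `±N²/4`, the sign being that of `τ`; a larger upper
    -- bound on `M₁` would destroy this window.
    · refine (sqBound_low_high_axis (c := σ * (N ^ 2 / 4)) hN hNH hM₂ hM₃ hM₂N hM₃N ?_ hm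
        ?_).mono_const ?_
      · rw [abs_mul, abs_of_pos (by positivity : 0 < N ^ 2 / 4)]
        rcases hσ with rfl | rfl <;> simp
      · intro p hp
        obtain ⟨h1, h2, h3⟩ := h p hp.1.1
        refine ⟨h2.1.2, h3, hdot p hp.1.1, hp.1.2, (hy p hp.1.1).1, (hy p hp.1.1).2, ?_⟩
        have h4 := habs p hp.2
        have h5 := h1.2
        have h6 := h1.1.2
        rw [h4] at h5
        unfold modulation at h6 ⊢
        have h7 := xiSq_nonneg p.1
        rw [abs_le] at h6 ⊢
        rcases hσ with rfl | rfl <;> constructor <;> linarith [h6.1, h6.2]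
      · have h1 : M₂ * M₃ * N / H ≤ 16 * (M₁ * M₂ * M₃ / (N * H)) := by
          calc M₂ * M₃ * N / H = 16 * ((N ^ 2 / 16) * M₂ * M₃ / (N * H)) := by field_simp
            _ ≤ _ := by gcongr
        linarith
    -- Near the `τ`-axis the modulation is comparable to `N²`, so `M₁ < N²/16` is impossible.
    · refine sqBound_empty (fun p hp => hM₁' ?_) _
      obtain ⟨h1, -, -⟩ := h p hp.1.1
      have h2 := annMod.le_xiSq h1
      have h3 : xiSq p.1 ≤ (N / 4) ^ 2 := hp.1.2
      nlinarith
  have hbm : MeasurableSet (E ∩ {p | xiSq p.1 ≤ (N / 4) ^ 2} ∩ {p | 0 ≤ (1 : ℝ) * p.1 2}) :=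
    (hE.inter hle).inter (isClosed_le (by fun_prop) (by fun_prop)).measurableSet
  have hbb : SqBound (E ∩ {p | xiSq p.1 ≤ (N / 4) ^ 2})
      (4 * (2 ^ 30 * (M₁ * M₂ * M₃ / (N * H)))) := by
    refine SqBound.of_cover hbm (hb 1 (Or.inl rfl)) (hb (-1) (Or.inr rfl)) fun p hp => ?_
    rcases le_total 0 (p.1 2) with h1 | h1
    · exact Or.inl ⟨hp, by simpa using h1⟩
    · exact Or.inr ⟨hp, by simpa using h1⟩
  refine (SqBound.of_cover (hE.inter hge) (ha.mono_const (by linarith)) hbb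
    fun p hp => ?_).mono_const (by ring_nf; rfl)
  rcases le_total ((N / 4) ^ 2) (xiSq p.1) with h1 | h1
  · exact Or.inl ⟨hp, h1⟩
  · exact Or.inr ⟨hp, h1⟩


/-! ### Assembling the cases on dyadic pieces. -/

/-- The closed dyadic set containing the region with size index `i` and modulation index `n`. -/
def piece (i n : ℕ) : Set SpaceTime :=
  {ζ | ζ ∈ ballMod (2 ^ i) (2 ^ n) ∧ (1 ≤ i → ((2 : ℝ) ^ i) ^ 2 / 4 ≤ |ζ 2| + xiSq ζ)}

lemma isClosed_piece (i n : ℕ) : IsClosed (piece i n) := by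
  by_cases hi : 1 ≤ i
  · have : piece i n = annMod (2 ^ i) (2 ^ n) := by
      ext ζ
      exact ⟨fun h => ⟨h.1, h.2 hi⟩, fun h => ⟨h.1, fun _ => h.2⟩⟩
    rw [this]; exact isClosed_annMod _ _
  · have : piece i n = ballMod (2 ^ i) (2 ^ n) := by
      ext ζ
      exact ⟨fun h => h.1, fun h => ⟨h, fun h' => absurd h' hi⟩⟩
    rw [this]; exact isClosed_ballMod _ _

lemma mem_annMod_of_mem_piece {i n : ℕ} (hi : 1 ≤ i) {ζ : SpaceTime} (h : ζ ∈ piece i n) :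
    ζ ∈ annMod (2 ^ i) (2 ^ n) := ⟨h.1, h.2 hi⟩

/-- Pairs of frequencies in `A` and `B` whose sum lies in `C`. -/
def pairs (A B C : Set SpaceTime) : Set (SpaceTime × SpaceTime) :=
  {p | p.1 ∈ A ∧ p.2 ∈ B ∧ p.1 + p.2 ∈ C}

lemma measurableSet_pairs {A B C : Set SpaceTime} (hA : MeasurableSet A) (hB : MeasurableSet B)
    (hC : MeasurableSet C) : MeasurableSet (pairs A B C) :=
  (hA.preimage measurable_fst).inter ((hB.preimage measurable_snd).inter
    (hC.preimage (by fun_prop : Measurable fun p : SpaceTime × SpaceTime => p.1 + p.2)))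

/-- If a high modulation is at least `N²/64`, the two-modulation bound suffices. Otherwise `1 ≤ M₂ <
N²/64` forces `N > 1`, so the low variable also lies in an annulus, and the separated or the
comparable case applies. Taking `r = H/1024` and `Λ = 1024` in the latter produces `2^87`. -/
lemma sqBound_low_fst_all {N H H' M₁ M₂ M₃ : ℝ} (hN : 0 < N)
    (hM₁ : 0 < M₁) (hM₂ : 1 ≤ M₂) (hM₃ : 1 ≤ M₃) (hNH : N ≤ H) (hNH' : N ≤ H') (hHH' : H ≤ 2 * H')
    (hcond : 1024 * N ≤ H → M₁ ≤ N ^ 2 / 8)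
    {E : Set (SpaceTime × SpaceTime)} (hE : MeasurableSet E)
    (h : ∀ p ∈ E, p.1 ∈ ballMod N M₁ ∧ p.2 ∈ annMod H M₂ ∧ p.1 + p.2 ∈ annMod H' M₃)
    (hlow : 1 < N → ∀ p ∈ E, p.1 ∈ annMod N M₁) :
    SqBound E (2 ^ 87 * (M₁ * M₂ * M₃ / (N * H))) := by
  have hH : 0 < H := hN.trans_le hNH
  have hH' : 0 < H' := hN.trans_le hNH'
  have hκ0 : 0 ≤ M₁ * M₂ * M₃ / (N * H) := by positivity
  have hlf := sqBound_low_fst (Λ := 1) hN hH hH' hM₁ (by linarith) (by linarith) le_rfl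
    (by linarith) hE h
  by_cases h₂ : N ^ 2 / 64 ≤ M₂
  · refine hlf.1.mono_const ?_
    have : M₁ * M₃ * N / H ≤ 64 * (M₁ * M₂ * M₃ / (N * H)) := by
      calc M₁ * M₃ * N / H = 64 * (M₁ * (N ^ 2 / 64) * M₃ / (N * H)) := by field_simp
        _ ≤ _ := by gcongr
    linarith
  by_cases h₃ : N ^ 2 / 64 ≤ M₃
  · refine hlf.2.mono_const ?_
    have : M₁ * M₂ * N / H' ≤ 128 * (M₁ * M₂ * M₃ / (N * H)) := by
      calc M₁ * M₂ * N / H' ≤ M₁ * M₂ * N / (H / 2) := by gcongr; linarith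
        _ = 128 * (M₁ * M₂ * (N ^ 2 / 64) / (N * H)) := by field_simp; norm_num
        _ ≤ _ := by gcongr
    linarith
  push Not at h₂ h₃
  have hN1 : 1 < N := by nlinarith
  by_cases hc : 1024 * N ≤ H
  · refine (sqBound_low_high hN hc hM₁ (by linarith) (by linarith) (hcond hc) h₂.le h₃.le hE
      fun p hp => ⟨hlow hN1 p hp, (h p hp).2.1, (h p hp).2.2.1.2⟩).mono_const ?_
    linarith
  · push Not at hc
    refine (sqBound_comparable (r := H / 1024) (Λ := 1024) (N₁ := N) (N₂ := H) (N₃ := H')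
      (by positivity) (by norm_num) hM₁ (by linarith) (by linarith) (by linarith) (by linarith)
      (by linarith) (by linarith) (by linarith) hE
      fun p hp => ⟨hlow hN1 p hp, (h p hp).2.1, (h p hp).2.2⟩).mono_const ?_
    rw [show (2 : ℝ) ^ 27 * 1024 ^ 4 * (M₁ * M₂ * M₃ / (H / 1024) ^ 2) =
      2 ^ 87 * (M₁ * M₂ * M₃ / (H * H)) by field_simp; norm_num]
    gcongr

/-- The scheme is that of a low summand, but when `N ≪ H` small high modulations are incompatible
with a low sum, so the low modulation needs no upper bound. In the comparable case `H' ≤ 2H`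
requires `Λ = 2048`, whence `2^91`. -/
lemma sqBound_low_sum_all {N H H' M₁ M₂ M₃ : ℝ} (hN : 0 < N)
    (hM₁ : 1 ≤ M₁) (hM₂ : 1 ≤ M₂) (hM₃ : 0 < M₃) (hNH : N ≤ H) (hNH' : N ≤ H') (hHH' : H ≤ 2 * H')
    (hH'H : H' ≤ 2 * H) {E : Set (SpaceTime × SpaceTime)} (hE : MeasurableSet E)
    (h : ∀ p ∈ E, p.1 ∈ annMod H M₁ ∧ p.2 ∈ annMod H' M₂ ∧ p.1 + p.2 ∈ ballMod N M₃)
    (hlow : 1 < N → ∀ p ∈ E, p.1 + p.2 ∈ annMod N M₃) :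
    SqBound E (2 ^ 91 * (M₁ * M₂ * M₃ / (N * H))) := by
  have hH : 0 < H := hN.trans_le hNH
  have hH' : 0 < H' := hN.trans_le hNH'
  have hκ0 : 0 ≤ M₁ * M₂ * M₃ / (N * H) := by positivity
  have hlf := sqBound_low_sum (Λ := 1) hN hH hH' (by linarith) (by linarith) hM₃ le_rfl
    (by linarith) (by linarith) hE h
  by_cases h₂ : N ^ 2 / 64 ≤ M₂
  · refine hlf.1.mono_const ?_
    have : M₃ * M₁ * N / H' ≤ 128 * (M₁ * M₂ * M₃ / (N * H)) := by
      calc M₃ * M₁ * N / H' ≤ M₃ * M₁ * N / (H / 2) := by gcongr; linarith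
        _ = 128 * (M₁ * (N ^ 2 / 64) * M₃ / (N * H)) := by field_simp; norm_num
        _ ≤ _ := by gcongr
    linarith
  by_cases h₁ : N ^ 2 / 64 ≤ M₁
  · refine hlf.2.mono_const ?_
    have : M₃ * M₂ * N / H ≤ 64 * (M₁ * M₂ * M₃ / (N * H)) := by
      calc M₃ * M₂ * N / H = 64 * ((N ^ 2 / 64) * M₂ * M₃ / (N * H)) := by field_simp
        _ ≤ _ := by gcongr
    linarith
  push Not at h₁ h₂
  have hN1 : 1 < N := by nlinarith
  by_cases hc : 1024 * N ≤ H
  -- Both `τ` components are positive up to `2M`, and the first exceeds a multiple of `H²`. Their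
  -- sum cannot be bounded by `4N²`.
  · refine sqBound_empty (fun p hp => ?_) _
    obtain ⟨a1, a2, a3⟩ := h p hp
    have b1 := annMod.le_xiSq a1
    have c1 := a1.1.2
    have c2 := a2.1.2
    have c3 := a3.1
    have d1 := xiSq_nonneg (p.1 + p.2)
    have d2 := xiSq_nonneg p.2
    have d3 := le_abs_self ((p.1 + p.2) 2)
    unfold modulation at c1 c2
    simp only [PiLp.add_apply] at c3 d3
    rw [abs_le] at c1 c2
    nlinarith [c1.1, c2.1]
  · push Not at hc
    refine (sqBound_comparable (r := H / 1024) (Λ := 2048) (N₁ := H) (N₂ := H') (N₃ := N)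
      (by positivity) (by norm_num) (by linarith) (by linarith) hM₃ (by linarith) (by linarith)
      (by linarith) (by linarith) (by linarith) hE
      fun p hp => ⟨(h p hp).1, (h p hp).2.1, hlow hN1 p hp⟩).mono_const ?_
    rw [show (2 : ℝ) ^ 27 * 2048 ^ 4 * (M₁ * M₂ * M₃ / (H / 1024) ^ 2) =
      2 ^ 91 * (M₁ * M₂ * M₃ / (H * H)) by field_simp; norm_num]
    gcongr

lemma sqBound_trivial_fst {N M : ℝ} (hN : 0 ≤ N) {E : Set (SpaceTime × SpaceTime)}
    (hE : MeasurableSet E) (h : ∀ p ∈ E, p.1 ∈ ballMod N M) : SqBound E (64 * N ^ 2 * M) := by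
  refine triBound_of_snd_slice hE fun y => ?_
  have hsub : {x | (x, y) ∈ E} ⊆ ballMod N M := fun x hx => h (x, y) hx
  exact (measure_mono hsub).trans (volume_le_trivial 0 hN 1 (Or.inl rfl) (isClosed_ballMod N M).measurableSet
      fun ζ hζ => ⟨ballMod.xiSq_le hζ, by simpa using hζ.2⟩)

lemma sqBound_trivial_sum {N M : ℝ} (hN : 0 ≤ N) {E : Set (SpaceTime × SpaceTime)}
    (hE : MeasurableSet E) (h : ∀ p ∈ E, p.1 + p.2 ∈ ballMod N M) :
    SqBound E (64 * N ^ 2 * M) := by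
  refine triBound_of_snd_slice hE fun y => ?_
  refine (le_trans (measure_mono fun x hx => ?_) (measure_preimage_add_right volume y
    (ballMod N M)).le).trans (volume_le_trivial 0 hN 1 (Or.inl rfl)
      (isClosed_ballMod N M).measurableSet
      fun ζ hζ => ⟨ballMod.xiSq_le hζ, by simpa using hζ.2⟩)
  exact h _ hx

lemma trivial_numerics {M₁ M₂ M₃ : ℝ} (hM₁ : 1 ≤ M₁) (hM₂ : 1 ≤ M₂) (hM₃ : 1 ≤ M₃) {h : ℕ}
    (hh : h ≤ 1) :
    64 * ((2 : ℝ) ^ 0) ^ 2 * M₁ ≤ 2 ^ 91 * (M₁ * min M₂ M₃ * 2 ^ 0 / 2 ^ h) ∧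
    64 * ((2 : ℝ) ^ 0) ^ 2 * M₁ ≤ 2 ^ 91 * (M₁ * M₂ * M₃ / (2 ^ 0 * 2 ^ h)) := by
  have h2 : (2 : ℝ) ^ h ≤ 2 := by
    calc (2 : ℝ) ^ h ≤ 2 ^ 1 := pow_le_pow_right₀ (by norm_num) hh
      _ = 2 := by norm_num
  have h3 : 1 ≤ min M₂ M₃ := le_min hM₂ hM₃
  have h4 : M₁ * 1 / 2 ≤ M₁ * min M₂ M₃ / 2 ^ h := by gcongr
  have h5 : M₁ * 1 * 1 / 2 ≤ M₁ * M₂ * M₃ / 2 ^ h := by gcongr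
  simp only [pow_zero, one_mul, mul_one]
  constructor <;> linarith

/-- The trilinear estimates when the low frequency is a summand. -/
lemma sqBound_pairs_low_fst {l h h' n₁ n₂ n₃ : ℕ} (hlh : l ≤ h) (hlh' : l ≤ h') (hh : h ≤ h' + 1)
    (hh' : h' ≤ h + 1) :
    SqBound (pairs (piece l n₁) (piece h n₂) (piece h' n₃))
      (2 ^ 91 * (2 ^ n₁ * min (2 ^ n₂) (2 ^ n₃) * 2 ^ l / 2 ^ h)) ∧
    ((l + 6 ≤ h → n₁ + 3 ≤ 2 * l) →
      SqBound (pairs (piece l n₁) (piece h n₂) (piece h' n₃))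
        (2 ^ 91 * (2 ^ n₁ * 2 ^ n₂ * 2 ^ n₃ / (2 ^ l * 2 ^ h)))) := by
  have hE := measurableSet_pairs (isClosed_piece l n₁).measurableSet
    (isClosed_piece h n₂).measurableSet (isClosed_piece h' n₃).measurableSet
  have hpow : ∀ n : ℕ, (1 : ℝ) ≤ 2 ^ n := fun n => one_le_pow₀ (by norm_num)
  have hpos : ∀ n : ℕ, (0 : ℝ) < 2 ^ n := fun n => by positivity
  have hmono : ∀ {a b : ℕ}, a ≤ b → (2 : ℝ) ^ a ≤ 2 ^ b := fun hab =>
    pow_le_pow_right₀ (by norm_num) hab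
  have hsucc : ∀ {a b : ℕ}, a ≤ b + 1 → (2 : ℝ) ^ a ≤ 2 * 2 ^ b := fun hab => by
    rw [← pow_succ']; exact hmono hab
  by_cases h0 : 1 ≤ h ∧ 1 ≤ h'
  · have hmem : ∀ p ∈ pairs (piece l n₁) (piece h n₂) (piece h' n₃), p.1 ∈ ballMod (2 ^ l) (2 ^ n₁) ∧
        p.2 ∈ annMod (2 ^ h) (2 ^ n₂) ∧ p.1 + p.2 ∈ annMod (2 ^ h') (2 ^ n₃) := fun p hp =>
      ⟨hp.1.1, mem_annMod_of_mem_piece h0.1 hp.2.1, mem_annMod_of_mem_piece h0.2 hp.2.2⟩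
    constructor
    · have := sqBound_low_fst (Λ := 1) (hpos l) (hpos h) (hpos h') (hpos n₁) (hpos n₂) (hpos n₃)
        le_rfl (by linarith [hmono hlh]) hE hmem
      have hκ : 0 ≤ (2 : ℝ) ^ n₁ * 2 ^ n₂ * 2 ^ l / 2 ^ h := by positivity
      have hκ' : 0 ≤ (2 : ℝ) ^ n₁ * 2 ^ n₃ * 2 ^ l / 2 ^ h := by positivity
      rcases le_total ((2 : ℝ) ^ n₂) (2 ^ n₃) with hm | hm
      · rw [min_eq_left hm]
        refine this.2.mono_const ?_
        have : (2 : ℝ) ^ n₁ * 2 ^ n₂ * 2 ^ l / 2 ^ h' ≤ 2 * (2 ^ n₁ * 2 ^ n₂ * 2 ^ l / 2 ^ h) := by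
          rw [← mul_div_assoc, div_le_div_iff₀ (hpos _) (hpos _)]
          calc _ ≤ (2 : ℝ) ^ n₁ * 2 ^ n₂ * 2 ^ l * (2 * 2 ^ h') := by gcongr; exact hsucc hh
            _ = _ := by ring
        linarith
      · rw [min_eq_right hm]
        exact this.1.mono_const (by linarith)
    · intro hcond
      refine (sqBound_low_fst_all (hpos l) (hpos n₁) (hpow n₂) (hpow n₃) (hmono hlh) (hmono hlh')
        (hsucc hh) ?_ hE hmem ?_).mono_const ?_
      · intro hN
        have h1 : l + 6 ≤ h := by
          by_contra hcon
          have : (2 : ℝ) ^ h ≤ 2 ^ (l + 5) := hmono (by omega)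
          rw [pow_add] at this
          nlinarith [hpos l]
        have h2 := hmono (hcond h1)
        rw [pow_add, mul_comm 2 l, pow_mul] at h2
        linarith
      · intro hN p hp
        refine mem_annMod_of_mem_piece ?_ hp.1
        by_contra hcon
        have : l = 0 := by omega
        simp [this] at hN
      · have : 0 ≤ (2 : ℝ) ^ n₁ * 2 ^ n₂ * 2 ^ n₃ / (2 ^ l * 2 ^ h) := by positivity
        linarith
  -- A high piece of index `0` has no lower bound on its size. Then `l = 0` and `h ≤ 1`, and the
  -- volume of the low piece alone is enough.
  · have hl0 : l = 0 := by omega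
    subst hl0
    have htriv := sqBound_trivial_fst (hpos 0).le hE fun p hp => hp.1.1
    have hnum := trivial_numerics (hpow n₁) (hpow n₂) (hpow n₃) (h := h) (by omega)
    exact ⟨htriv.mono_const hnum.1, fun _ => htriv.mono_const hnum.2⟩

/-- The trilinear estimates when the low frequency is the sum. -/
lemma sqBound_pairs_low_sum {l h h' n₁ n₂ n₃ : ℕ} (hlh : l ≤ h) (hlh' : l ≤ h') (hh : h ≤ h' + 1)
    (hh' : h' ≤ h + 1) :
    SqBound (pairs (piece h n₂) (piece h' n₃) (piece l n₁))
      (2 ^ 91 * (2 ^ n₁ * min (2 ^ n₂) (2 ^ n₃) * 2 ^ l / 2 ^ h)) ∧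
    SqBound (pairs (piece h n₂) (piece h' n₃) (piece l n₁))
        (2 ^ 91 * (2 ^ n₁ * 2 ^ n₂ * 2 ^ n₃ / (2 ^ l * 2 ^ h))) := by
  have hE := measurableSet_pairs
    (isClosed_piece h n₂).measurableSet (isClosed_piece h' n₃).measurableSet
    (isClosed_piece l n₁).measurableSet
  have hpow : ∀ n : ℕ, (1 : ℝ) ≤ 2 ^ n := fun n => one_le_pow₀ (by norm_num)
  have hpos : ∀ n : ℕ, (0 : ℝ) < 2 ^ n := fun n => by positivity
  have hmono : ∀ {a b : ℕ}, a ≤ b → (2 : ℝ) ^ a ≤ 2 ^ b := fun hab =>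
    pow_le_pow_right₀ (by norm_num) hab
  have hsucc : ∀ {a b : ℕ}, a ≤ b + 1 → (2 : ℝ) ^ a ≤ 2 * 2 ^ b := fun hab => by
    rw [← pow_succ']; exact hmono hab
  by_cases h0 : 1 ≤ h ∧ 1 ≤ h'
  · have hmem : ∀ p ∈ pairs (piece h n₂) (piece h' n₃) (piece l n₁),
        p.1 ∈ annMod (2 ^ h) (2 ^ n₂) ∧ p.2 ∈ annMod (2 ^ h') (2 ^ n₃) ∧
        p.1 + p.2 ∈ ballMod (2 ^ l) (2 ^ n₁) := fun p hp =>
      ⟨mem_annMod_of_mem_piece h0.1 hp.1, mem_annMod_of_mem_piece h0.2 hp.2.1, hp.2.2.1⟩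
    constructor
    · have := sqBound_low_sum (Λ := 1) (hpos l) (hpos h) (hpos h') (hpos n₂) (hpos n₃) (hpos n₁)
        le_rfl (by linarith [hmono hlh]) (by linarith [hmono hlh']) hE hmem
      have hκ : 0 ≤ (2 : ℝ) ^ n₁ * 2 ^ n₂ * 2 ^ l / 2 ^ h := by positivity
      have hκ' : 0 ≤ (2 : ℝ) ^ n₁ * 2 ^ n₃ * 2 ^ l / 2 ^ h := by positivity
      rcases le_total ((2 : ℝ) ^ n₂) (2 ^ n₃) with hm | hm
      · rw [min_eq_left hm]
        refine this.1.mono_const ?_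
        have : (2 : ℝ) ^ n₁ * 2 ^ n₂ * 2 ^ l / 2 ^ h' ≤ 2 * (2 ^ n₁ * 2 ^ n₂ * 2 ^ l / 2 ^ h) := by
          rw [← mul_div_assoc, div_le_div_iff₀ (hpos _) (hpos _)]
          calc _ ≤ (2 : ℝ) ^ n₁ * 2 ^ n₂ * 2 ^ l * (2 * 2 ^ h') := by gcongr; exact hsucc hh
            _ = _ := by ring
        linarith
      · rw [min_eq_right hm]
        exact this.2.mono_const (by linarith)
    · refine (sqBound_low_sum_all (hpos l) (hpow n₂) (hpow n₃) (hpos n₁) (hmono hlh) (hmono hlh')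
        (hsucc hh) (hsucc hh') hE hmem ?_).mono_const (le_of_eq (by ring))
      intro hN p hp
      refine mem_annMod_of_mem_piece ?_ hp.2.2
      by_contra hcon
      have : l = 0 := by omega
      simp [this] at hN
  · have hl0 : l = 0 := by omega
    subst hl0
    have htriv := sqBound_trivial_sum (hpos 0).le hE fun p hp => hp.2.2.1
    have hnum := trivial_numerics (hpow n₁) (hpow n₂) (hpow n₃) (h := h) (by omega)
    exact ⟨htriv.mono_const hnum.1, htriv.mono_const hnum.2⟩


/-! ### From trilinear forms to convolutions -/

section Duality

variable {G : Type*} [AddCommGroup G] [MeasurableSpace G] {μ : Measure G} [MeasurableAdd₂ G]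
  [MeasurableNeg G] [SFinite μ] [μ.IsAddLeftInvariant]

omit [MeasurableAdd₂ G] [SFinite μ] [μ.IsAddLeftInvariant] in
lemma l2_comp_neg [μ.IsNegInvariant] (f : G → ℝ≥0∞) : l2 μ (fun x => f (-x)) = l2 μ f := by
  exact congrArg (· ^ (1 / 2 : ℝ)) (lintegral_neg_eq_self (fun x => f x ^ (2 : ℝ)))

/-- The convolution of nonnegative functions. -/
noncomputable def lconv (μ : Measure G) (f g : G → ℝ≥0∞) (x : G) : ℝ≥0∞ :=
  ∫⁻ y, f (x - y) * g y ∂μ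

omit [μ.IsAddLeftInvariant] in
lemma measurable_lconv {f g : G → ℝ≥0∞} (hf : Measurable f) (hg : Measurable g) :
    Measurable (lconv μ f g) := by
  have : Measurable fun p : G × G => f (p.1 - p.2) * g p.2 := by
    simp only [sub_eq_add_neg]; fun_prop
  exact this.lintegral_prod_right'

omit [SFinite μ] in
lemma lconv_le [μ.IsNegInvariant] {f g : G → ℝ≥0∞} (hf : Measurable f) (hg : Measurable g)
    (x : G) : lconv μ f g x ≤ l2 μ f * l2 μ g := by
  have hm : Measurable fun y => f (x - y) := by simp only [sub_eq_add_neg]; fun_prop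
  refine (lintegral_mul_le_l2 (μ := μ) hm hg).trans (le_of_eq ?_)
  congr 1
  exact congrArg (· ^ (1 / 2 : ℝ)) (lintegral_sub_left_eq_self (fun y => f y ^ (2 : ℝ)) x)

/-- The dual formulation of a trilinear bound. -/
lemma l2_indicator_lconv_le [μ.IsNegInvariant] {E : Set (G × G)} {K : ℝ≥0∞}
    (h : TriBound μ E K) {f g : G → ℝ≥0∞} (hf : Measurable f) (hg : Measurable g)
    (hf2 : l2 μ f ≠ ⊤) (hg2 : l2 μ g ≠ ⊤) {C : Set G} (hC : MeasurableSet C) (hCμ : μ C ≠ ⊤)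
    (hE : ∀ x y, f x ≠ 0 → g y ≠ 0 → x + y ∈ C → (x, y) ∈ E) :
    l2 μ (C.indicator (lconv μ f g)) ≤ K * (l2 μ f * l2 μ g) := by
  set k := C.indicator (lconv μ f g) with hk
  have hkm : Measurable k := (measurable_lconv hf hg).indicator hC
  -- A priori finiteness is needed to divide by `l2 μ k` at the end; it comes from the pointwise
  -- bound on the convolution and the finite measure of `C`.
  have hfin : l2 μ k ≠ ⊤ := by
    have : ∫⁻ x, k x ^ (2 : ℝ) ∂μ ≤ (l2 μ f * l2 μ g) ^ (2 : ℝ) * μ C := by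
      calc ∫⁻ x, k x ^ (2 : ℝ) ∂μ ≤ ∫⁻ x, C.indicator (fun _ => (l2 μ f * l2 μ g) ^ (2 : ℝ)) x ∂μ := by
            refine lintegral_mono fun x => ?_
            by_cases hx : x ∈ C
            · simp only [hk, Set.indicator_of_mem hx]
              exact ENNReal.rpow_le_rpow (lconv_le hf hg x) (by norm_num)
            · simp [hk, hx]
        _ = _ := lintegral_indicator_const hC _
    refine ENNReal.rpow_ne_top_of_nonneg (by norm_num) (ne_top_of_le_ne_top ?_ this)
    exact ENNReal.mul_ne_top (ENNReal.rpow_ne_top_of_nonneg (by norm_num)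
      (ENNReal.mul_ne_top hf2 hg2)) hCμ
  have hsub : Measurable fun p : G × G => p.1 - p.2 := by simp only [sub_eq_add_neg]; fun_prop
  -- The truncated convolution is its own test function.
  have hsq : l2 μ k ^ (2 : ℝ) = triForm μ E f g k := by
    have hm1 : Measurable fun p : G × G => k p.1 * (f (p.1 - p.2) * g p.2) := by fun_prop
    have hm2 : Measurable fun p : G × G => k (p.2 + p.1) * (f p.2 * g p.1) := by fun_prop
    rw [l2_sq]
    calc ∫⁻ x, k x ^ (2 : ℝ) ∂μ = ∫⁻ x, ∫⁻ y, k x * (f (x - y) * g y) ∂μ ∂μ := by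
          refine lintegral_congr fun x => ?_
          have hm : Measurable fun y => f (x - y) * g y := by
            have : Measurable fun y => x - y := hsub.comp measurable_prodMk_left
            fun_prop
          rw [lintegral_const_mul _ hm, ENNReal.rpow_two, sq]
          by_cases hx : x ∈ C
          · simp [hk, hx, lconv]
          · simp [hk, hx]
      _ = ∫⁻ y, ∫⁻ x, k x * (f (x - y) * g y) ∂μ ∂μ := lintegral_lintegral_swap hm1.aemeasurable
      _ = ∫⁻ y, ∫⁻ x, k (x + y) * (f x * g y) ∂μ ∂μ := by
          refine lintegral_congr fun y => ?_
          rw [← lintegral_add_right_eq_self _ y]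
          simp
      _ = ∫⁻ x, ∫⁻ y, k (x + y) * (f x * g y) ∂μ ∂μ := lintegral_lintegral_swap hm2.aemeasurable
      _ = triForm μ E f g k := by
          unfold triForm
          refine lintegral_congr fun x => lintegral_congr fun y => ?_
          by_cases hxy : (x, y) ∈ E
          · simp only [Set.indicator_of_mem hxy, Pi.one_apply, one_mul]; ring
          · simp only [Set.indicator_of_notMem hxy, zero_mul]
            by_cases hx : f x = 0
            · simp [hx]
            by_cases hy : g y = 0
            · simp [hy]
            have : x + y ∉ C := fun hc => hxy (hE x y hx hy hc)
            simp [hk, this]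
  have hle := h f g k hf hg hkm
  rw [← hsq, ENNReal.rpow_two, sq] at hle
  rcases eq_or_ne (l2 μ k) 0 with h0 | h0
  · rw [h0]; exact zero_le
  · rw [← mul_assoc] at hle
    exact (ENNReal.mul_le_mul_iff_left h0 hfin).1 hle

end Duality

/-- The relation `-x + y = w` is the same as `x + w = y`: reflecting one factor interchanges the
other factor and the sum. -/
lemma TriBound.reflect {A B C : Set SpaceTime} {K : ℝ≥0∞}
    (h : TriBound volume (pairs A C B) K) : TriBound volume (pairs (Neg.neg ⁻¹' A) B C) K := by
  intro f₁ f₂ f₃ h₁ h₂ h₃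
  have := h (fun x => f₁ (-x)) f₃ f₂ (h₁.comp measurable_neg) h₃ h₂
  rw [l2_comp_neg] at this
  calc triForm volume (pairs (Neg.neg ⁻¹' A) B C) f₁ f₂ f₃
      = triForm volume (pairs A C B) (fun x => f₁ (-x)) f₃ f₂ := by
        unfold triForm
        rw [← lintegral_neg_eq_self]
        refine lintegral_congr fun x => ?_
        rw [← lintegral_add_left_eq_self _ x]
        refine lintegral_congr fun y => ?_
        have e1 : -x + (x + y) = y := by abel
        rw [e1]
        have e2 : (pairs (Neg.neg ⁻¹' A) B C).indicator (1 : SpaceTime × SpaceTime → ℝ≥0∞)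
            (-x, x + y) = (pairs A C B).indicator 1 (x, y) := by
          have : (-x, x + y) ∈ pairs (Neg.neg ⁻¹' A) B C ↔ (x, y) ∈ pairs A C B := by
            simp only [pairs, Set.mem_ofPred_eq, Set.mem_preimage, neg_neg, e1]
            tauto
          by_cases hx : (x, y) ∈ pairs A C B
          · rw [Set.indicator_of_mem hx, Set.indicator_of_mem (this.2 hx)]; rfl
          · rw [Set.indicator_of_notMem hx, Set.indicator_of_notMem (fun h => hx (this.1 h))]
        rw [e2]
        ring
    _ ≤ _ := this
    _ = _ := by ring

lemma TriBound.pairs_swap {A B C : Set SpaceTime} {K : ℝ≥0∞} (hA : MeasurableSet A)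
    (hB : MeasurableSet B) (hC : MeasurableSet C)
    (h : TriBound volume (pairs A B C) K) : TriBound volume (pairs B A C) K := by
  refine (TriBound.swap (measurableSet_pairs hA hB hC) h).mono (fun p hp => ?_) le_rfl
  exact ⟨hp.2.1, hp.1, by have := hp.2.2; rwa [add_comm] at this⟩


/-! ### Fourier transforms of integrable functions -/

section Fourier

open scoped FourierTransform Convolution
open Real (pi)

/-- The function `z ↦ ∫ e^{i z·ζ} g(ζ) dζ`. -/
noncomputable def synth (g : SpaceTime → ℂ) (z : SpaceTime) : ℂ := 𝓕 g (-((2 * pi)⁻¹ • z))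

lemma synth_const_mul (c : ℂ) (g : SpaceTime → ℂ) :
    synth (fun ζ => c * g ζ) = fun z => c * synth g z := by
  funext z
  simp only [synth, Real.fourier_eq, Circle.smul_def, smul_eq_mul]
  rw [← integral_const_mul]
  congr 1
  funext v
  ring

lemma synth_add {g h : SpaceTime → ℂ} (hg : Integrable g) (hh : Integrable h) :
    synth (g + h) = synth g + synth h := by
  funext z
  simp only [synth, Pi.add_apply, Real.fourier_eq, smul_add]
  exact integral_add ((Real.fourierIntegral_convergent_iff _).2 hg)
    ((Real.fourierIntegral_convergent_iff _).2 hh)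

lemma synth_zero : synth 0 = 0 := by
  funext z
  simp [synth, Real.fourier_eq]

lemma synth_sum {ι : Type*} (s : Finset ι) {g : ι → SpaceTime → ℂ}
    (hg : ∀ i ∈ s, Integrable (g i)) : synth (∑ i ∈ s, g i) = ∑ i ∈ s, synth (g i) := by
  classical
  induction s using Finset.induction_on with
  | empty => simp [synth_zero]
  | insert a s ha ih =>
    rw [Finset.sum_insert ha, Finset.sum_insert ha,
      synth_add (hg a (Finset.mem_insert_self a s))
        (integrable_finsetSum' s fun i hi => hg i (Finset.mem_insert_of_mem hi)),
      ih fun i hi => hg i (Finset.mem_insert_of_mem hi)]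

lemma continuous_synth {g : SpaceTime → ℂ} (hg : Integrable g) : Continuous (synth g) := by
  have : Continuous (𝓕 g) := VectorFourier.fourierIntegral_continuous Real.continuous_fourierChar
    (by exact continuous_inner) hg
  exact this.comp (by fun_prop)

lemma synth_mul {g h : SpaceTime → ℂ} (hg : Integrable g) (hh : Integrable h) :
    synth (g ⋆[ContinuousLinearMap.mul ℂ ℂ] h) = fun z => synth g z * synth h z :=
  funext fun _ => Real.fourier_mul_convolution_eq hg hh _

lemma conjFun_synth (g : SpaceTime → ℂ) :
    conjFun (synth g) = synth (fun ζ => conj (g (-ζ))) := by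
  funext z
  simp only [conjFun, synth, Real.fourier_eq', smul_eq_mul]
  rw [← integral_conj, ← integral_neg_eq_self]
  congr 1
  funext v
  rw [map_mul, ← Complex.exp_conj, map_mul, Complex.conj_ofReal, Complex.conj_I, inner_neg_left]
  push_cast
  congr 2
  ring

lemma spatialDeriv_synth {g : SpaceTime → ℂ} (hg : Integrable g)
    (hg' : Integrable fun ζ => ‖ζ‖ * ‖g ζ‖) (a : Fin 2) :
    spatialDeriv a (synth g) = synth (fun ζ => Complex.I * (ζ a.castSucc : ℂ) * g ζ) := by
  funext z
  set e : SpaceTime := EuclideanSpace.single a.castSucc (1 : ℝ)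
  have h1 := Real.hasFDerivAt_fourier hg hg' (-((2 * pi)⁻¹ • z))
  have h2 : HasFDerivAt (fun z : SpaceTime => -((2 * pi)⁻¹ • z))
      (-((2 * pi)⁻¹ • ContinuousLinearMap.id ℝ SpaceTime)) z :=
    (-((2 * pi)⁻¹ • ContinuousLinearMap.id ℝ SpaceTime)).hasFDerivAt
  have h3 : HasFDerivAt (synth g) _ z := h1.comp z h2
  have hint : Integrable (VectorFourier.fourierSMulRight (innerSL ℝ) g) := by
    refine (hg'.const_mul (2 * pi)).mono' (hg.1.fourierSMulRight (L := innerSL ℝ)) ?_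
    filter_upwards with v
    rw [VectorFourier.norm_fourierSMulRight]
    rw [innerSL_apply_norm]
    exact le_of_eq (by ring)
  simp only [spatialDeriv, h3.fderiv, ContinuousLinearMap.comp_apply]
  rw [Real.fourier_continuousLinearMap_apply hint]
  simp only [synth, Real.fourier_eq, Circle.smul_def, smul_eq_mul]
  congr 1
  funext v
  have hv : ⟪v, e⟫_ℝ = v a.castSucc := by simp [e, EuclideanSpace.inner_single_right]
  simp only [VectorFourier.fourierSMulRight_apply, neg_apply, smul_apply,
    ContinuousLinearMap.id_apply, inner_neg_right, real_inner_smul_right, Complex.real_smul, smul_eq_mul]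
  have hv' : (innerSL ℝ v) (-((2 * pi)⁻¹ • e)) = -((2 * pi)⁻¹ * v a.castSucc) := by
    rw [innerSL_apply_apply, inner_neg_right, real_inner_smul_right, hv]
  rw [hv']
  have : (pi : ℂ) ≠ 0 := by exact_mod_cast Real.pi_ne_zero
  push_cast
  field_simp

lemma fourierSchwartz_eq (ψ : 𝓢(SpaceTime, ℂ)) (ζ : SpaceTime) :
    fourierSchwartz ψ ζ = 𝓕 (ψ : SpaceTime → ℂ) ((2 * pi)⁻¹ • ζ) := by
  simp only [fourierSchwartz, Real.fourier_eq', smul_eq_mul]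
  congr 1
  funext z
  rw [real_inner_smul_right]
  have : (pi : ℂ) ≠ 0 := by exact_mod_cast Real.pi_ne_zero
  congr 2
  push_cast
  field_simp

lemma integrable_fourierSchwartz (ψ : 𝓢(SpaceTime, ℂ)) : Integrable (fourierSchwartz ψ) := by
  have : fourierSchwartz ψ = fun ζ => (𝓕 ψ) ((2 * pi)⁻¹ • ζ) := by
    funext ζ; rw [fourierSchwartz_eq]; rfl
  rw [this]
  exact (𝓕 ψ).integrable.comp_smul (by positivity)

/-- The multiplication formula moves the transform from `g` to the test function, and Schwartz
inversion undoes it there. The factor `(2π)³` is the Jacobian of `z ↦ z / (2π)`. -/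
lemma isFourierTransform_synth {g : SpaceTime → ℂ} (hg : Integrable g) :
    IsFourierTransform (synth g) (fun ζ => (2 * pi : ℂ) ^ 3 * g ζ) := by
  intro ψ
  have hb : ∀ z, ‖synth g z‖ ≤ ∫ ζ, ‖g ζ‖ := fun z =>
    VectorFourier.norm_fourierIntegral_le_integral_norm _ _ _ _ _
  have hψb : ∃ C, ∀ ζ, ‖ψ ζ‖ ≤ C := ⟨_, fun ζ => ψ.toBoundedContinuousFunction.norm_coe_le_norm ζ⟩
  obtain ⟨C, hC⟩ := hψb
  refine ⟨(integrable_fourierSchwartz ψ).bdd_mul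
    (continuous_synth hg).aestronglyMeasurable (Filter.Eventually.of_forall hb), ?_, ?_⟩
  · refine Integrable.mul_bdd (c := C) (hg.const_mul _) ψ.continuous.aestronglyMeasurable
      (Filter.Eventually.of_forall hC)
  have h1 : ∫ y, 𝓕 g y * (𝓕⁻ ψ) y = ∫ x, g x * ψ x := by
    have := VectorFourier.integral_fourierIntegral_smul_eq_flip (μ := (volume : Measure SpaceTime))
      (ν := (volume : Measure SpaceTime)) (L := innerₗ SpaceTime) (g := (𝓕⁻ ψ : 𝓢(SpaceTime, ℂ)))
      Real.continuous_fourierChar continuous_inner hg (𝓕⁻ ψ).integrable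
    rw [flip_innerₗ] at this
    refine this.trans ?_
    have h2 : 𝓕 (𝓕⁻ ψ) = ψ := FourierTransform.fourier_fourierInv_eq ψ
    have h3 : VectorFourier.fourierIntegral Real.fourierChar volume (innerₗ SpaceTime)
        ⇑(𝓕⁻ ψ : 𝓢(SpaceTime, ℂ)) = ψ := by
      conv_rhs => rw [← h2]
      rfl
    rw [h3]
    rfl
  have h2 : ∀ z, synth g z * fourierSchwartz ψ z =
      (fun y => 𝓕 g (-y) * 𝓕 (ψ : SpaceTime → ℂ) y) ((2 * pi)⁻¹ • z) := by
    intro z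
    rw [fourierSchwartz_eq]; rfl
  rw [integral_congr_ae (Filter.Eventually.of_forall h2),
    Measure.integral_comp_inv_smul volume (fun y => 𝓕 g (-y) * 𝓕 (ψ : SpaceTime → ℂ) y) (2 * pi),
    ← integral_neg_eq_self]
  simp only [neg_neg]
  have h3 : ∀ y, 𝓕 (ψ : SpaceTime → ℂ) (-y) = (𝓕⁻ ψ) y := fun y => by
    rw [SchwartzMap.fourierInv_coe, Real.fourierInv_eq_fourier_neg]
  simp_rw [h3]
  rw [h1, finrank_euclideanSpace_fin, abs_of_pos (by positivity), Complex.real_smul,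
    ← integral_const_mul]
  push_cast
  simp only [mul_assoc]

/-- Smooth compactly supported functions are Fourier transforms of Schwartz functions. -/
lemma exists_fourierSchwartz_eq {φ : SpaceTime → ℂ} (hφ : ContDiff ℝ ∞ φ)
    (hφc : HasCompactSupport φ) : ∃ ψ : 𝓢(SpaceTime, ℂ), ∀ ζ, fourierSchwartz ψ ζ = φ ζ := by
  have hpi : (2 * pi : ℝ) ≠ 0 := by positivity
  let θ : 𝓢(SpaceTime, ℂ) := HasCompactSupport.toSchwartzMap (f := fun y => φ ((2 * pi) • y))
    (hφc.comp_smul hpi) (hφ.comp (by fun_prop))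
  refine ⟨𝓕⁻ θ, fun ζ => ?_⟩
  rw [fourierSchwartz_eq, ← SchwartzMap.fourier_coe, FourierTransform.fourier_fourierInv_eq]
  change φ ((2 * pi) • ((2 * pi)⁻¹ • ζ)) = φ ζ
  rw [smul_smul, mul_inv_cancel₀ hpi, one_smul]

/-- Both sides have the same transform, hence the same integrals against all smooth compactly
supported functions, since these are transforms of Schwartz functions. Continuity upgrades the
resulting almost everywhere equality. -/
lemma IsFourierTransform.eq_synth {u g : SpaceTime → ℂ} (hu : Continuous u) (hg : Integrable g)
    (h : IsFourierTransform u g) : u = synth (fun ζ => ((2 * pi : ℂ) ^ 3)⁻¹ * g ζ) := by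
  have hpi : (2 * pi : ℂ) ^ 3 ≠ 0 := by
    simp
  have hg' := hg.const_mul ((2 * pi : ℂ) ^ 3)⁻¹
  have hc := continuous_synth hg'
  have hs := isFourierTransform_synth hg'
  refine (Continuous.ae_eq_iff_eq volume hu hc).1 ?_
  refine ae_eq_of_integral_contDiff_smul_eq hu.locallyIntegrable hc.locallyIntegrable ?_
  intro φ hφ hφc
  obtain ⟨ψ, hψ⟩ := exists_fourierSchwartz_eq (φ := fun z => (φ z : ℂ))
    (Complex.ofRealCLM.contDiff.comp hφ) (hφc.comp_left (g := ((↑) : ℝ → ℂ)) Complex.ofReal_zero)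
  have e1 := (h ψ).2.2
  have e2 := (hs ψ).2.2
  simp only [hψ] at e1 e2
  simp only [Complex.real_smul]
  simp_rw [mul_comm (φ _ : ℂ)]
  rw [e1, e2]
  congr 1
  funext ζ
  rw [mul_inv_cancel_left₀ hpi]

lemma IsFourierTransform.locallyIntegrable {u g : SpaceTime → ℂ} (h : IsFourierTransform u g) :
    LocallyIntegrable g := by
  intro x
  let φ : ContDiffBump x := ⟨1, 2, one_pos, one_lt_two⟩
  let ψ : 𝓢(SpaceTime, ℂ) := HasCompactSupport.toSchwartzMap (f := fun z => (φ z : ℂ))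
    (φ.hasCompactSupport.comp_left (g := ((↑) : ℝ → ℂ)) Complex.ofReal_zero)
    (Complex.ofRealCLM.contDiff.comp φ.contDiff)
  refine ⟨Metric.closedBall x 1, Metric.closedBall_mem_nhds x one_pos, ?_⟩
  refine (h ψ).2.1.integrableOn.congr_fun (fun ζ hζ => ?_) measurableSet_closedBall
  change g ζ * ((φ ζ : ℝ) : ℂ) = g ζ
  rw [φ.one_of_mem_closedBall hζ, Complex.ofReal_one, mul_one]

lemma IsFourierTransform.congr_ae {u g g' : SpaceTime → ℂ} (h : IsFourierTransform u g)
    (hg : g =ᵐ[volume] g') : IsFourierTransform u g' := by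
  intro ψ
  have hψ : (fun ζ => g ζ * ψ ζ) =ᵐ[volume] fun ζ => g' ζ * ψ ζ := by
    filter_upwards [hg] with ζ hζ
    rw [hζ]
  obtain ⟨h1, h2, h3⟩ := h ψ
  exact ⟨h1, h2.congr hψ, h3.trans (integral_congr_ae hψ)⟩

lemma IsFourierTransform.ae_eq {u g g' : SpaceTime → ℂ} (h : IsFourierTransform u g)
    (h' : IsFourierTransform u g') : g =ᵐ[volume] g' := by
  refine ae_eq_of_integral_contDiff_smul_eq h.locallyIntegrable h'.locallyIntegrable ?_
  intro φ hφ hφc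
  let ψ : 𝓢(SpaceTime, ℂ) := HasCompactSupport.toSchwartzMap (f := fun z => (φ z : ℂ))
    (hφc.comp_left (g := ((↑) : ℝ → ℂ)) Complex.ofReal_zero)
    (Complex.ofRealCLM.contDiff.comp hφ)
  have e := (h ψ).2.2.symm.trans (h' ψ).2.2
  simp only [Complex.real_smul]
  simp_rw [mul_comm (φ _ : ℂ)]
  exact e

/-- Transforms are unique almost everywhere, so the infimum is over a single value. -/
lemma normX_eq {u g : SpaceTime → ℂ} (h : IsFourierTransform u g) (s b : ℝ) :
    normX s b u = weightedL2 s b g := by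
  refine le_antisymm (iInf₂_le g h) (le_iInf₂ fun g' h' => le_of_eq ?_)
  refine eLpNorm_congr_ae ?_
  filter_upwards [h.ae_eq h'] with ζ hζ
  rw [hζ]

end Fourier


/-! ### Localized functions as integrals over dyadic pieces -/

/-- For `i ≥ 1` the two terms are both `0` above `2^{i+1}` and both `1` below `2^{i-1}`; for `i = 0`
only the upper bound remains. -/
lemma dyadicCutoff_ne_zero {φ₀ : ℝ → ℝ} (hφ : IsCutoff φ₀) {i : ℕ} {x : ℝ} (hx : 0 ≤ x)
    (h : dyadicCutoff φ₀ i x ≠ 0) : x ≤ 2 * 2 ^ i ∧ (1 ≤ i → 2 ^ i / 2 ≤ x) := by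
  have hpos : (0 : ℝ) < 2 ^ i := by positivity
  have e1 : (2 : ℝ) ^ (-(i : ℤ)) * x = x / 2 ^ i := by
    rw [zpow_neg, zpow_natCast]; field_simp
  have e2 : (2 : ℝ) ^ (-(i : ℤ) + 1) * x = x / (2 ^ i / 2) := by
    rw [zpow_add₀ two_ne_zero, zpow_neg, zpow_natCast]; field_simp
  constructor
  · by_contra! hlt
    refine h ?_
    unfold dyadicCutoff
    have h1 : 2 ≤ x / 2 ^ i := (le_div_iff₀ hpos).2 hlt.le
    split_ifs with hi
    · subst hi
      exact hφ.eq_zero _ (by simpa using h1)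
    · have h2 : 2 ≤ x / (2 ^ i / 2) := (le_div_iff₀ (by positivity)).2 (by linarith)
      rw [e1, e2, hφ.eq_zero _ h1, hφ.eq_zero _ h2, sub_zero]
  · intro hi
    by_contra! hlt
    refine h ?_
    unfold dyadicCutoff
    have h1 : x / 2 ^ i ≤ 1 := (div_le_one hpos).2 (by linarith)
    have h2 : x / (2 ^ i / 2) ≤ 1 := (div_le_one (by positivity)).2 hlt.le
    rw [if_neg (by omega), e1, e2, hφ.eq_one _ (by positivity) h1,
      hφ.eq_one _ (by positivity) h2, sub_self]

/-- All the inequalities are non-strict, so the set on the right is closed and contains the closed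
support. -/
lemma region_subset {φ₀ : ℝ → ℝ} (hφ : IsCutoff φ₀) (i : ℕ) (ℓ : ℤ) :
    region φ₀ i ℓ ⊆ {ζ | ζ ∈ piece i ((i : ℤ) + ℓ).toNat ∧
      (1 ≤ ((i : ℤ) + ℓ).toNat → 2 ^ ((i : ℤ) + ℓ).toNat / 2 ≤ |modulation ζ|)} := by
  set n := ((i : ℤ) + ℓ).toNat with hn
  have hcl : IsClosed {ζ : SpaceTime | 1 ≤ n → (2 : ℝ) ^ n / 2 ≤ |modulation ζ|} := by
    by_cases h : 1 ≤ n
    · simp only [h, true_imp_iff]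
      exact isClosed_le (by fun_prop) (by fun_prop)
    · simp [h]
  refine closure_minimal (fun ζ hζ => ?_) (isClosed_setOf_and (isClosed_piece i n) hcl)
  rw [Function.mem_support, pieceCutoff] at hζ
  obtain ⟨h1, h2⟩ := mul_ne_zero_iff.1 hζ
  have h1 := dyadicCutoff_ne_zero hφ (Real.sqrt_nonneg _) h1
  have h2 := dyadicCutoff_ne_zero hφ (abs_nonneg _) h2
  have h0 : 0 ≤ |ζ 2| + xiSq ζ := add_nonneg (abs_nonneg _) (xiSq_nonneg ζ)
  refine ⟨⟨⟨?_, h2.1⟩, fun hi => ?_⟩, h2.2⟩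
  · have := (Real.sqrt_le_left (by positivity)).1 h1.1
    linarith
  · have := (Real.le_sqrt' (by positivity)).1 (h1.2 hi)
    linarith

lemma weight_zero_left (b : ℝ) (ζ : SpaceTime) : weight 0 b ζ = bracket (modulation ζ) ^ b := by
  rw [weight, Real.rpow_zero, one_mul]

lemma le_bracket {n : ℕ} {x : ℝ} (h : 1 ≤ n → 2 ^ n / 2 ≤ |x|) : 2 ^ n / 2 ≤ bracket x := by
  rcases Nat.eq_zero_or_pos n with rfl | hn
  · refine Real.le_sqrt_of_sq_le ?_
    nlinarith [sq_nonneg x]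
  · refine (h hn).trans (Real.le_sqrt_of_sq_le ?_)
    rw [sq_abs]; linarith

lemma l2_const_mul {G : Type*} [MeasurableSpace G] {μ : Measure G} {a : ℝ≥0∞} (ha : a ≠ ⊤)
    (f : G → ℝ≥0∞) : l2 μ (fun x => a * f x) = a * l2 μ f := by
  unfold l2
  simp_rw [ENNReal.mul_rpow_of_nonneg _ _ zero_le_two]
  rw [lintegral_const_mul' _ _ (ENNReal.rpow_ne_top_of_nonneg zero_le_two ha),
    ENNReal.mul_rpow_of_nonneg _ _ (by norm_num), ← ENNReal.rpow_mul]
  norm_num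

lemma l2_mono_ae {G : Type*} [MeasurableSpace G] {μ : Measure G} {f g : G → ℝ≥0∞}
    (h : ∀ᵐ x ∂μ, f x ≤ g x) : l2 μ f ≤ l2 μ g := by
  refine ENNReal.rpow_le_rpow (lintegral_mono_ae ?_) (by norm_num)
  filter_upwards [h] with x hx
  exact ENNReal.rpow_le_rpow hx (by norm_num)

lemma weightedL2_eq_l2 (s b : ℝ) (g : SpaceTime → ℂ) :
    weightedL2 s b g = l2 volume (fun ζ => ‖(weight s b ζ : ℂ) * g ζ‖ₑ) := by
  rw [weightedL2, eLpNorm_eq_lintegral_rpow_enorm_toReal two_ne_zero ENNReal.ofNat_ne_top, l2]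
  simp

/-- On the region with modulation index `n` the weights `⟨τ - ξ²⟩^{±1/2}` are comparable to powers
of this constant. -/
noncomputable def modConst (n : ℕ) : ℝ := √(2 / 2 ^ n)

lemma one_le_modConst_mul {n : ℕ} {ζ : SpaceTime}
    (h : 1 ≤ n → 2 ^ n / 2 ≤ |modulation ζ|) : 1 ≤ modConst n * weight 0 (1 / 2) ζ := by
  have h1 := le_bracket h
  rw [weight_zero_left, ← Real.sqrt_eq_rpow, modConst, ← Real.sqrt_mul (by positivity),
    Real.one_le_sqrt]
  calc (1 : ℝ) = 2 / 2 ^ n * (2 ^ n / 2) := by field_simp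
    _ ≤ _ := by gcongr

lemma weight_le_modConst {n : ℕ} {ζ : SpaceTime}
    (h : 1 ≤ n → 2 ^ n / 2 ≤ |modulation ζ|) : weight 0 (-(1 / 2)) ζ ≤ modConst n := by
  have h1 := le_bracket h
  have h0 : (0 : ℝ) < 2 ^ n / 2 := by positivity
  rw [weight_zero_left, Real.rpow_neg (h0.le.trans h1), ← Real.sqrt_eq_rpow, modConst,
    ← Real.sqrt_inv]
  refine Real.sqrt_le_sqrt ?_
  rw [show (2 : ℝ) / 2 ^ n = (2 ^ n / 2)⁻¹ by rw [inv_div]]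
  exact inv_anti₀ h0 h1

lemma weight_nonneg (s b : ℝ) (ζ : SpaceTime) : 0 ≤ weight s b ζ :=
  mul_nonneg (Real.rpow_nonneg (Real.sqrt_nonneg _) _) (Real.rpow_nonneg (Real.sqrt_nonneg _) _)

lemma enorm_weight_mul (s b : ℝ) (ζ : SpaceTime) (c : ℂ) :
    ‖(weight s b ζ : ℂ) * c‖ₑ = ENNReal.ofReal (weight s b ζ) * ‖c‖ₑ := by
  rw [enorm_mul, ← ofReal_norm, Complex.norm_real, Real.norm_of_nonneg (weight_nonneg s b ζ)]

/-- `u = ∫ e^{i z·ζ} g(ζ) dζ` with `g` supported in `P` and with `L²` norm at most `N`. -/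
def SynthIn (P : Set SpaceTime) (N : ℝ≥0∞) (u : SpaceTime → ℂ) : Prop :=
  ∃ g : SpaceTime → ℂ, Measurable g ∧ (∀ ζ, g ζ ≠ 0 → ζ ∈ P) ∧
    l2 volume (fun ζ => ‖g ζ‖ₑ) ≤ N ∧ u = synth g

lemma SynthIn.conjFun {P : Set SpaceTime} {N : ℝ≥0∞} {u : SpaceTime → ℂ} (h : SynthIn P N u) :
    SynthIn (Neg.neg ⁻¹' P) N (conjFun u) := by
  obtain ⟨g, hg, hP, hN, rfl⟩ := h
  refine ⟨fun ζ => conj (g (-ζ)), ?_, fun ζ hζ => hP _ (by simpa using hζ), ?_, conjFun_synth g⟩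
  · exact Complex.continuous_conj.measurable.comp (hg.comp measurable_neg)
  · have := l2_comp_neg (μ := (volume : Measure SpaceTime)) (fun ζ => ‖g ζ‖ₑ)
    simpa only [RCLike.enorm_conj, this] using hN

/-- Cauchy-Schwarz against the indicator of the ball. -/
lemma integrable_of_l2 {g : SpaceTime → ℂ} (hg : Measurable g)
    (h2 : l2 volume (fun ζ => ‖g ζ‖ₑ) ≠ ⊤) {R : ℝ} (hR : ∀ ζ, g ζ ≠ 0 → ‖ζ‖ ≤ R) :
    Integrable g := by
  refine ⟨hg.aestronglyMeasurable, ?_⟩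
  have hind : Measurable ((Metric.closedBall (0 : SpaceTime) R).indicator (1 : SpaceTime → ℝ≥0∞)) :=
    measurable_one.indicator measurableSet_closedBall
  have hB : l2 volume ((Metric.closedBall (0 : SpaceTime) R).indicator (1 : SpaceTime → ℝ≥0∞)) ≠ ⊤ := by
    refine ENNReal.rpow_ne_top_of_nonneg (by norm_num) ?_
    have : ∀ x, ((Metric.closedBall (0 : SpaceTime) R).indicator (1 : SpaceTime → ℝ≥0∞) x) ^ (2 : ℝ)
        = (Metric.closedBall (0 : SpaceTime) R).indicator 1 x := by
      intro x
      by_cases hx : x ∈ Metric.closedBall (0 : SpaceTime) R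
      · simp [Set.indicator_of_mem hx]
      · simp [Set.indicator_of_notMem hx]
    simp_rw [this]
    rw [lintegral_indicator_one measurableSet_closedBall]
    exact measure_closedBall_lt_top.ne
  calc ∫⁻ ζ, ‖g ζ‖ₑ = ∫⁻ ζ, (Metric.closedBall (0 : SpaceTime) R).indicator 1 ζ * ‖g ζ‖ₑ := by
        refine lintegral_congr fun ζ => ?_
        by_cases h0 : g ζ = 0
        · simp [h0]
        · rw [Set.indicator_of_mem (by simpa using hR ζ h0)]; simp
    _ ≤ _ := lintegral_mul_le_l2 hind hg.enorm
    _ < ⊤ := ENNReal.mul_lt_top hB.lt_top h2.lt_top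

lemma norm_le_of_mem_piece {i n : ℕ} {ζ : SpaceTime} (h : ζ ∈ piece i n) :
    ‖ζ‖ ≤ 6 * (2 ^ i) ^ 2 := by
  have h1 : |ζ 2| + xiSq ζ ≤ 4 * (2 ^ i) ^ 2 := h.1.1
  have h2 := xiSq_nonneg ζ
  have h3 := abs_nonneg (ζ 2)
  have hp : (1 : ℝ) ≤ 2 ^ i := one_le_pow₀ (by norm_num)
  rw [EuclideanSpace.norm_eq, Fin.sum_univ_three]
  simp only [Real.norm_eq_abs, sq_abs]
  refine Real.sqrt_le_iff.2 ⟨by positivity, ?_⟩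
  have h4 : (ζ 2) ^ 2 ≤ (4 * (2 ^ i) ^ 2) ^ 2 := by
    rw [← sq_abs]; gcongr; linarith
  have h5 : (ζ 0) ^ 2 + (ζ 1) ^ 2 ≤ 4 * (2 ^ i) ^ 2 := by unfold xiSq at h1 h2; linarith
  nlinarith [one_le_pow₀ (n := 2) hp]

/-- The transform is replaced by a measurable representative that vanishes off the region
everywhere. The lower bound on the weight there gives its `L²` norm, bounded support makes it
integrable, and `eq_synth` recovers `u`. -/
lemma MemXPiece.synthIn {φ₀ : ℝ → ℝ} (hφ : IsCutoff φ₀) {i : ℕ} {ℓ : ℤ} {u : SpaceTime → ℂ}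
    (hu : MemXPiece φ₀ 0 (1 / 2) i ℓ u) :
    normX 0 (1 / 2) u ≠ ⊤ ∧ SynthIn (piece i ((i : ℤ) + ℓ).toNat)
      (ENNReal.ofReal (modConst ((i : ℤ) + ℓ).toNat) * normX 0 (1 / 2) u) u := by
  set n := ((i : ℤ) + ℓ).toNat
  obtain ⟨hu1, g, hg, hfin, hsupp⟩ := hu
  rw [normX_eq hg]
  refine ⟨hfin.ne, ?_⟩
  have hreg := region_subset hφ i ℓ
  have hgm := hg.locallyIntegrable.aestronglyMeasurable
  have hRm : MeasurableSet (region φ₀ i ℓ) := (isClosed_tsupport _).measurableSet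
  set f : SpaceTime → ℂ := (region φ₀ i ℓ).indicator (hgm.mk g) with hf
  have hfm : Measurable f := hgm.stronglyMeasurable_mk.measurable.indicator hRm
  have hfR : ∀ ζ, f ζ ≠ 0 → ζ ∈ region φ₀ i ℓ := fun ζ hζ => by
    by_contra h; exact hζ (Set.indicator_of_notMem h _)
  have hgf : g =ᵐ[volume] f := by
    filter_upwards [hgm.ae_eq_mk, hsupp] with ζ h1 h2
    by_cases hζ : ζ ∈ region φ₀ i ℓ
    · rw [hf, Set.indicator_of_mem hζ, h1]
    · rw [hf, Set.indicator_of_notMem hζ, h2 hζ]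
  have hl2 : l2 volume (fun ζ => ‖f ζ‖ₑ) ≤ ENNReal.ofReal (modConst n) * weightedL2 0 (1 / 2) g := by
    rw [weightedL2_eq_l2, ← l2_const_mul ENNReal.ofReal_ne_top]
    refine l2_mono_ae ?_
    filter_upwards [hgf] with ζ hζ
    rw [hζ]
    by_cases h0 : f ζ = 0
    · simp [h0]
    · rw [enorm_weight_mul, ← mul_assoc, ← ENNReal.ofReal_mul (show 0 ≤ modConst n from Real.sqrt_nonneg _)]
      refine le_mul_of_one_le_left' ?_
      rw [ENNReal.one_le_ofReal]
      exact one_le_modConst_mul (hreg (hfR ζ h0)).2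
  have hfi : Integrable f := integrable_of_l2 hfm
    (ne_top_of_le_ne_top (ENNReal.mul_ne_top ENNReal.ofReal_ne_top hfin.ne) hl2)
    fun ζ hζ => norm_le_of_mem_piece (hreg (hfR ζ hζ)).1
  refine ⟨fun ζ => ((2 * Real.pi : ℂ) ^ 3)⁻¹ * f ζ, measurable_const.mul hfm, fun ζ hζ => (hreg (hfR ζ (right_ne_zero_of_mul hζ))).1,
    le_trans (l2_mono_ae (Filter.Eventually.of_forall fun ζ => ?_)) hl2,
    (hg.congr_ae hgf).eq_synth hu1.continuous hfi⟩
  rw [enorm_mul]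
  -- The inversion factor `(2π)^{-3}` is below `1` and is simply discarded.
  refine mul_le_of_le_one_left' ?_
  rw [← ofReal_norm, ENNReal.ofReal_le_one, norm_inv, norm_pow, norm_mul, Complex.norm_real,
    Real.norm_of_nonneg Real.pi_pos.le]
  refine inv_le_one_of_one_le₀ (one_le_pow₀ ?_)
  have := Real.pi_gt_three
  simp only [Complex.norm_ofNat]
  linarith


/-! ### The bilinear form on the Fourier side -/

section Bilinear

open scoped Convolution

/-- The order is reversed because `⋆` puts the difference `x - y` in its second factor and `lconv`
in its first. -/
lemma enorm_convolution_le (g h : SpaceTime → ℂ) (x : SpaceTime) :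
    ‖(h ⋆[ContinuousLinearMap.mul ℂ ℂ] g) x‖ₑ ≤
      lconv volume (fun ζ => ‖g ζ‖ₑ) (fun ζ => ‖h ζ‖ₑ) x := by
  refine (enorm_integral_le_lintegral_enorm _).trans (le_of_eq (lintegral_congr fun y => ?_))
  simp [mul_comm]

lemma lconv_mul_le {a b : ℝ≥0∞} (ha : a ≠ ⊤) (hb : b ≠ ⊤) {f g f' g' : SpaceTime → ℝ≥0∞}
    (hf : ∀ x, f' x ≤ a * f x) (hg : ∀ x, g' x ≤ b * g x) (x : SpaceTime) :
    lconv volume f' g' x ≤ a * b * lconv volume f g x := by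
  unfold lconv
  rw [← lintegral_const_mul' _ _ (ENNReal.mul_ne_top ha hb)]
  refine lintegral_mono fun y => ?_
  calc f' (x - y) * g' y ≤ (a * f (x - y)) * (b * g y) := mul_le_mul' (hf _) (hg _)
    _ = _ := by ring

/-- The Fourier multiplier of `∂_a`. -/
noncomputable def derivMult (a : Fin 2) (g : SpaceTime → ℂ) (ζ : SpaceTime) : ℂ :=
  Complex.I * (ζ a.castSucc : ℂ) * g ζ

lemma measurable_derivMult (a : Fin 2) {g : SpaceTime → ℂ} (hg : Measurable g) :
    Measurable (derivMult a g) := by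
  unfold derivMult
  fun_prop

lemma enorm_derivMult_le {g : SpaceTime → ℂ} {r : ℝ}
    (hr : ∀ ζ, g ζ ≠ 0 → ∀ a : Fin 2, |ζ a.castSucc| ≤ r) (a : Fin 2) (ζ : SpaceTime) :
    ‖derivMult a g ζ‖ₑ ≤ ENNReal.ofReal r * ‖g ζ‖ₑ := by
  by_cases h : g ζ = 0
  · simp [derivMult, h]
  · rw [derivMult, enorm_mul, enorm_mul]
    refine mul_le_mul_left ?_ _
    rw [← ofReal_norm, ← ofReal_norm, Complex.norm_I, Complex.norm_real, ENNReal.ofReal_one, one_mul]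
    exact ENNReal.ofReal_le_ofReal (hr ζ h a)

/-- The Fourier side of `B(u, v)` up to a constant. -/
noncomputable def bilinearSymbol (c : Fin 2 → Fin 2 → ℂ) (g h : SpaceTime → ℂ) : SpaceTime → ℂ :=
  ∑ a : Fin 2, ∑ b : Fin 2,
    fun ζ => c a b * (derivMult b h ⋆[ContinuousLinearMap.mul ℂ ℂ] derivMult a g) ζ

/-- A measurable square integrable function with bounded support. -/
structure IsBand (g : SpaceTime → ℂ) (R r : ℝ) : Prop where
  measurable : Measurable g
  l2_ne_top : l2 volume (fun ζ => ‖g ζ‖ₑ) ≠ ⊤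
  norm_le : ∀ ζ, g ζ ≠ 0 → ‖ζ‖ ≤ R
  coord_le : ∀ ζ, g ζ ≠ 0 → ∀ a : Fin 2, |ζ a.castSucc| ≤ r

variable {g h : SpaceTime → ℂ} {R r R' r' : ℝ}

lemma IsBand.integrable (hg : IsBand g R r) : Integrable g :=
  integrable_of_l2 hg.measurable hg.l2_ne_top hg.norm_le

lemma IsBand.integrable_norm_mul (hg : IsBand g R r) : Integrable fun ζ => ‖ζ‖ * ‖g ζ‖ := by
  refine (hg.integrable.norm.const_mul R).mono' ?_ (Filter.Eventually.of_forall fun ζ => ?_)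
  · exact (measurable_norm.mul hg.measurable.norm).aestronglyMeasurable
  · rw [Real.norm_of_nonneg (by positivity)]
    by_cases h : g ζ = 0
    · simp [h]
    · exact mul_le_mul_of_nonneg_right (hg.norm_le ζ h) (norm_nonneg _)

lemma IsBand.integrable_derivMult (hg : IsBand g R r) (a : Fin 2) : Integrable (derivMult a g) := by
  refine (hg.integrable.norm.const_mul r).mono'
    (measurable_derivMult a hg.measurable).aestronglyMeasurable
    (Filter.Eventually.of_forall fun ζ => ?_)
  by_cases h : g ζ = 0
  · simp [derivMult, h]
  · rw [derivMult, norm_mul, norm_mul, Complex.norm_I, one_mul, Complex.norm_real]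
    exact mul_le_mul_of_nonneg_right (hg.coord_le ζ h a) (norm_nonneg _)

lemma integrable_bilinearSymbol_aux (c : Fin 2 → Fin 2 → ℂ) (hg : IsBand g R r)
    (hh : IsBand h R' r') (a b : Fin 2) : Integrable
      fun ζ => c a b * (derivMult b h ⋆[ContinuousLinearMap.mul ℂ ℂ] derivMult a g) ζ :=
  ((hh.integrable_derivMult b).integrable_convolution _ (hg.integrable_derivMult a)).const_mul _

lemma integrable_bilinearSymbol (c : Fin 2 → Fin 2 → ℂ) (hg : IsBand g R r)
    (hh : IsBand h R' r') : Integrable (bilinearSymbol c g h) :=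
  integrable_finsetSum' _ fun a _ => integrable_finsetSum' _ fun b _ =>
    integrable_bilinearSymbol_aux c hg hh a b

lemma bilinearB_synth (c : Fin 2 → Fin 2 → ℂ) (hg : IsBand g R r) (hh : IsBand h R' r') :
    bilinearB c (synth g) (synth h) = synth (bilinearSymbol c g h) := by
  have hi := integrable_bilinearSymbol_aux c hg hh
  rw [bilinearSymbol, synth_sum _ fun a _ => integrable_finsetSum' _ fun b _ => hi a b]
  funext z
  rw [Finset.sum_apply, bilinearB]
  refine Finset.sum_congr rfl fun a _ => ?_
  rw [synth_sum _ fun b _ => hi a b, Finset.sum_apply]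
  refine Finset.sum_congr rfl fun b _ => ?_
  rw [synth_const_mul, synth_mul (hh.integrable_derivMult b) (hg.integrable_derivMult a),
    spatialDeriv_synth hg.integrable hg.integrable_norm_mul,
    spatialDeriv_synth hh.integrable hh.integrable_norm_mul]
  change c a b * synth (derivMult a g) z * synth (derivMult b h) z = _
  ring

/-- The total size of the coefficients. -/
noncomputable def coeffSum (c : Fin 2 → Fin 2 → ℂ) : ℝ := ∑ a : Fin 2, ∑ b : Fin 2, ‖c a b‖

lemma enorm_bilinearSymbol_le (c : Fin 2 → Fin 2 → ℂ) (hg : IsBand g R r) (hh : IsBand h R' r')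
    (x : SpaceTime) : ‖bilinearSymbol c g h x‖ₑ ≤
      ENNReal.ofReal (coeffSum c) * (ENNReal.ofReal r * ENNReal.ofReal r') *
        lconv volume (fun ζ => ‖g ζ‖ₑ) (fun ζ => ‖h ζ‖ₑ) x := by
  have hterm : ∀ a b : Fin 2,
      ‖(derivMult b h ⋆[ContinuousLinearMap.mul ℂ ℂ] derivMult a g) x‖ₑ ≤
        ENNReal.ofReal r * ENNReal.ofReal r' *
          lconv volume (fun ζ => ‖g ζ‖ₑ) (fun ζ => ‖h ζ‖ₑ) x := fun a b =>
    (enorm_convolution_le _ _ x).trans (lconv_mul_le ENNReal.ofReal_ne_top ENNReal.ofReal_ne_top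
      (enorm_derivMult_le hg.coord_le a) (enorm_derivMult_le hh.coord_le b) x)
  have hsum : ENNReal.ofReal (coeffSum c) = ∑ a : Fin 2, ∑ b : Fin 2, ‖c a b‖ₑ := by
    rw [coeffSum, ENNReal.ofReal_sum_of_nonneg fun a _ => by positivity]
    refine Finset.sum_congr rfl fun a _ => ?_
    rw [ENNReal.ofReal_sum_of_nonneg fun b _ => norm_nonneg _]
    simp only [ofReal_norm]
  rw [bilinearSymbol, Finset.sum_apply, hsum, mul_assoc, Finset.sum_mul]
  refine (enorm_sum_le _ _).trans (Finset.sum_le_sum fun a _ => ?_)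
  rw [Finset.sum_apply, Finset.sum_mul]
  refine (enorm_sum_le _ _).trans (Finset.sum_le_sum fun b _ => ?_)
  rw [enorm_mul]
  exact mul_le_mul' le_rfl (hterm a b)

/-- Trilinear bounds on the Fourier side give bilinear bounds. -/
lemma normXPiece_bilinearB_le {φ₀ : ℝ → ℝ} (hφ : IsCutoff φ₀) (c : Fin 2 → Fin 2 → ℂ)
    {P Q : Set SpaceTime} {k : ℕ} {ℓ : ℤ} {K : ℝ≥0∞}
    (hT : TriBound volume (pairs P Q (piece k ((k : ℤ) + ℓ).toNat)) K)
    (hP : ∀ ζ ∈ P, ‖ζ‖ ≤ R ∧ ∀ a : Fin 2, |ζ a.castSucc| ≤ r)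
    (hQ : ∀ ζ ∈ Q, ‖ζ‖ ≤ R' ∧ ∀ a : Fin 2, |ζ a.castSucc| ≤ r')
    {N N' : ℝ≥0∞} (hN : N ≠ ⊤) (hN' : N' ≠ ⊤) {u v : SpaceTime → ℂ}
    (hu : SynthIn P N u) (hv : SynthIn Q N' v) :
    normXPiece φ₀ 0 (-(1 / 2)) k ℓ (bilinearB c u v) ≤
      ENNReal.ofReal ((2 * Real.pi) ^ 3 * coeffSum c) *
        ((ENNReal.ofReal r * ENNReal.ofReal r') *
          (ENNReal.ofReal (modConst ((k : ℤ) + ℓ).toNat) * (K * (N * N')))) := by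
  set n := ((k : ℤ) + ℓ).toNat
  obtain ⟨g, hgm, hgP, hgN, rfl⟩ := hu
  obtain ⟨h, hhm, hhQ, hhN, rfl⟩ := hv
  have hg : IsBand g R r := ⟨hgm, ne_top_of_le_ne_top hN hgN, fun ζ hζ => (hP ζ (hgP ζ hζ)).1,
    fun ζ hζ => (hP ζ (hgP ζ hζ)).2⟩
  have hh : IsBand h R' r' := ⟨hhm, ne_top_of_le_ne_top hN' hhN, fun ζ hζ => (hQ ζ (hhQ ζ hζ)).1,
    fun ζ hζ => (hQ ζ (hhQ ζ hζ)).2⟩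
  have hreg := region_subset hφ k ℓ
  have hC : MeasurableSet (piece k n) := (isClosed_piece k n).measurableSet
  have hCfin : (volume : Measure SpaceTime) (piece k n) ≠ ⊤ := by
    refine ne_top_of_le_ne_top measure_closedBall_lt_top.ne
      (measure_mono (t := Metric.closedBall 0 (6 * (2 ^ k) ^ 2)) fun ζ hζ => ?_)
    simpa using norm_le_of_mem_piece hζ
  have hdual := l2_indicator_lconv_le hT hgm.enorm hhm.enorm hg.l2_ne_top hh.l2_ne_top hC hCfin
    fun x y hx hy hxy => ⟨hgP x (by simpa using hx), hhQ y (by simpa using hy), hxy⟩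
  rw [bilinearB_synth c hg hh]
  -- An upper bound for the infimum needs only one transform of the product, namely the explicit
  -- one.
  refine (iInf₂_le _ (isFourierTransform_synth (integrable_bilinearSymbol c hg hh))).trans ?_
  set D : ℝ≥0∞ := ENNReal.ofReal ((2 * Real.pi) ^ 3 * coeffSum c) *
    ((ENNReal.ofReal r * ENNReal.ofReal r') * ENNReal.ofReal (modConst n)) with hD
  have hDtop : D ≠ ⊤ := by
    simp only [hD]
    finiteness
  calc weightedL2 0 (-(1 / 2)) ((region φ₀ k ℓ).indicator
        fun ζ => (2 * Real.pi : ℂ) ^ 3 * bilinearSymbol c g h ζ)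
      ≤ l2 volume (fun ζ => D * (piece k n).indicator
          (lconv volume (fun ζ => ‖g ζ‖ₑ) (fun ζ => ‖h ζ‖ₑ)) ζ) := by
        rw [weightedL2_eq_l2]
        refine l2_mono_ae (Filter.Eventually.of_forall fun ζ => ?_)
        by_cases hζ : ζ ∈ region φ₀ k ℓ
        · rw [Set.indicator_of_mem hζ, Set.indicator_of_mem (hreg hζ).1, enorm_weight_mul, enorm_mul]
          have e1 : ‖(2 * Real.pi : ℂ) ^ 3‖ₑ = ENNReal.ofReal ((2 * Real.pi) ^ 3) := by
            rw [← ofReal_norm, norm_pow, norm_mul, Complex.norm_real,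
              Real.norm_of_nonneg Real.pi_pos.le, Complex.norm_ofNat]
          have e2 := weight_le_modConst (hreg hζ).2
          rw [e1]
          calc _ ≤ ENNReal.ofReal (modConst n) * (ENNReal.ofReal ((2 * Real.pi) ^ 3) * _) :=
                mul_le_mul' (ENNReal.ofReal_le_ofReal e2)
                  (mul_le_mul' le_rfl (enorm_bilinearSymbol_le c hg hh ζ))
            _ = _ := by
                rw [hD, ENNReal.ofReal_mul (by positivity)]
                ring
        · simp [Set.indicator_of_notMem hζ]
    _ ≤ D * (K * (N * N')) := by
        rw [l2_const_mul hDtop]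
        exact mul_le_mul' le_rfl (hdual.trans (mul_le_mul' le_rfl (mul_le_mul' hgN hhN)))
    _ = _ := by rw [hD]; ring

end Bilinear


/-! ### The bilinear estimates -/

lemma bounds_of_mem_piece {i n : ℕ} : ∀ ζ ∈ piece i n,
    ‖ζ‖ ≤ 6 * (2 ^ i) ^ 2 ∧ ∀ a : Fin 2, |ζ a.castSucc| ≤ 2 * 2 ^ i := by
  intro ζ hζ
  have h := abs_coord_le (R := 2 * 2 ^ i) (by positivity)
    ((ballMod.xiSq_le hζ.1).trans (le_of_eq (by ring)))
  refine ⟨norm_le_of_mem_piece hζ, fun a => ?_⟩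
  fin_cases a
  exacts [h.1, h.2]

lemma bounds_of_neg_mem_piece {i n : ℕ} : ∀ ζ ∈ Neg.neg ⁻¹' piece i n,
    ‖ζ‖ ≤ 6 * (2 ^ i) ^ 2 ∧ ∀ a : Fin 2, |ζ a.castSucc| ≤ 2 * 2 ^ i := by
  intro ζ hζ
  have := bounds_of_mem_piece _ hζ
  simpa using this

lemma coeffSum_nonneg (c : Fin 2 → Fin 2 → ℂ) : 0 ≤ coeffSum c := by
  unfold coeffSum; positivity

/-- The constant in the bilinear estimates. -/
noncomputable def estimateConst (c : Fin 2 → Fin 2 → ℂ) : ℝ :=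
  2 ^ 52 * ((2 * Real.pi) ^ 3 * (coeffSum c + 1))

lemma estimateConst_pos (c : Fin 2 → Fin 2 → ℂ) : 0 < estimateConst c := by
  have := coeffSum_nonneg c
  have := Real.pi_pos
  unfold estimateConst; positivity

lemma modConst_sq (n : ℕ) : modConst n ^ 2 = 2 / 2 ^ n := Real.sq_sqrt (by positivity)

/-- The numerical condition is the squared constant: `2^4 (2^i 2^j)^2` comes from the two
derivatives, and `2^3 / (2^{n₁} 2^{n₂} 2^{n₃})` from the three modulation weights. The right side is
the square of `2^52 T`, with `2^52` built into `estimateConst`. -/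
lemma bilinearBound_of_sqBound {φ₀ : ℝ → ℝ} (hφ : IsCutoff φ₀) (c : Fin 2 → Fin 2 → ℂ)
    {i j k n₁ n₂ n₃ : ℕ} {ℓ₁ ℓ₂ ℓ₃ : ℤ} (hn₁ : ((i : ℤ) + ℓ₁).toNat = n₁)
    (hn₂ : ((j : ℤ) + ℓ₂).toNat = n₂) (hn₃ : ((k : ℤ) + ℓ₃).toNat = n₃) {κ T : ℝ} (hκ : 0 ≤ κ)
    (h₁ : SqBound (pairs (piece i n₁) (piece j n₂) (piece k n₃)) κ)
    (h₂ : SqBound (pairs (Neg.neg ⁻¹' piece i n₁) (piece j n₂) (piece k n₃)) κ)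
    (h₃ : SqBound (pairs (piece i n₁) (Neg.neg ⁻¹' piece j n₂) (piece k n₃)) κ)
    (hT0 : 0 ≤ T)
    (hT : 2 ^ 7 * ((2 ^ i * 2 ^ j) ^ 2 * κ / (2 ^ n₁ * 2 ^ n₂ * 2 ^ n₃)) ≤ 2 ^ 104 * T ^ 2) :
    BilinearBound φ₀ c i j k ℓ₁ ℓ₂ ℓ₃ (estimateConst c * T) := by
  subst hn₁ hn₂ hn₃
  intro u v hu hv F hF
  obtain ⟨hu0, hu⟩ := hu.synthIn hφ
  obtain ⟨hv0, hv⟩ := hv.synthIn hφ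
  have hutop := ENNReal.mul_ne_top (ENNReal.ofReal_ne_top
    (r := modConst ((i : ℤ) + ℓ₁).toNat)) hu0
  have hvtop := ENNReal.mul_ne_top (ENNReal.ofReal_ne_top
    (r := modConst ((j : ℤ) + ℓ₂).toNat)) hv0
  set n₁ := ((i : ℤ) + ℓ₁).toNat
  set n₂ := ((j : ℤ) + ℓ₂).toNat
  set n₃ := ((k : ℤ) + ℓ₃).toNat
  have hS := coeffSum_nonneg c
  have hm : ∀ n, 0 ≤ modConst n := fun n => Real.sqrt_nonneg _
  have hprod : 2 * 2 ^ i * (2 * 2 ^ j) * modConst n₃ * √κ * modConst n₁ * modConst n₂ ≤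
      2 ^ 52 * T := by
    refine (abs_le_of_sq_le_sq' ?_ (mul_nonneg (by positivity) hT0)).2
    calc (2 * 2 ^ i * (2 * 2 ^ j) * modConst n₃ * √κ * modConst n₁ * modConst n₂) ^ 2
        = 2 ^ 4 * (2 ^ i * 2 ^ j) ^ 2 * (modConst n₃ ^ 2 * √κ ^ 2 * modConst n₁ ^ 2
            * modConst n₂ ^ 2) := by ring
      _ = 2 ^ 7 * ((2 ^ i * 2 ^ j) ^ 2 * κ / (2 ^ n₁ * 2 ^ n₂ * 2 ^ n₃)) := by
          rw [modConst_sq, modConst_sq, modConst_sq, Real.sq_sqrt hκ]; field_simp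
      _ ≤ _ := hT.trans (le_of_eq (by rw [mul_pow, ← pow_mul]))
  have hfinal : ENNReal.ofReal ((2 * Real.pi) ^ 3 * coeffSum c) *
        ((ENNReal.ofReal (2 * 2 ^ i) * ENNReal.ofReal (2 * 2 ^ j)) *
          (ENNReal.ofReal (modConst n₃) * (ENNReal.ofReal κ ^ (1 / 2 : ℝ) *
            (ENNReal.ofReal (modConst n₁) * normX 0 (1 / 2) u *
              (ENNReal.ofReal (modConst n₂) * normX 0 (1 / 2) v))))) ≤
      ENNReal.ofReal (estimateConst c * T) * normX 0 (1 / 2) u * normX 0 (1 / 2) v := by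
    have hs : ENNReal.ofReal κ ^ (1 / 2 : ℝ) = ENNReal.ofReal √κ := by
      rw [ENNReal.ofReal_rpow_of_nonneg hκ (by norm_num), Real.sqrt_eq_rpow]
    have hle : (2 * Real.pi) ^ 3 * coeffSum c *
        (2 * 2 ^ i * (2 * 2 ^ j) * modConst n₃ * √κ * modConst n₁ * modConst n₂) ≤
        estimateConst c * T := by
      have hpi := Real.pi_pos
      calc _ ≤ (2 * Real.pi) ^ 3 * (coeffSum c + 1) * (2 ^ 52 * T) := by
            refine mul_le_mul ?_ hprod ?_ (by positivity)
            · gcongr; linarith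
            · have := hm n₁; have := hm n₂; have := hm n₃
              positivity
        _ = _ := by unfold estimateConst; ring
    refine le_trans (le_of_eq ?_) (mul_le_mul_left (mul_le_mul_left
      (ENNReal.ofReal_le_ofReal hle) _) _)
    have := hm n₁; have := hm n₂; have := hm n₃
    have hpi := Real.pi_pos
    rw [hs, ENNReal.ofReal_mul (p := (2 * Real.pi) ^ 3 * coeffSum c) (by positivity),
      ENNReal.ofReal_mul (q := modConst n₂) (by positivity),
      ENNReal.ofReal_mul (q := modConst n₁) (by positivity),
      ENNReal.ofReal_mul (q := √κ) (by positivity),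
      ENNReal.ofReal_mul (q := modConst n₃) (by positivity),
      ENNReal.ofReal_mul (q := 2 * 2 ^ j) (by positivity)]
    ring
  rcases hF with rfl | rfl | rfl
  · exact (normXPiece_bilinearB_le hφ c h₁ bounds_of_mem_piece bounds_of_mem_piece
      hutop hvtop hu hv).trans hfinal
  · exact (normXPiece_bilinearB_le hφ c h₂ bounds_of_neg_mem_piece bounds_of_mem_piece
      hutop hvtop hu.conjFun hv).trans hfinal
  · exact (normXPiece_bilinearB_le hφ c h₃ bounds_of_mem_piece bounds_of_neg_mem_piece
      hutop hvtop hu hv.conjFun).trans hfinal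

/-! ### Reduction of the conjugated products to unconjugated trilinear forms. -/

section Conjugates

variable {l h h' n₁ n₂ n₃ : ℕ}

lemma measurableSet_piece (i n : ℕ) : MeasurableSet (piece i n) := (isClosed_piece i n).measurableSet

lemma measurableSet_neg_piece (i n : ℕ) : MeasurableSet (Neg.neg ⁻¹' piece i n) :=
  (measurableSet_piece i n).preimage measurable_neg

/-- A low frequency factor times a high frequency factor, either of them conjugated. -/
lemma sqBound_low_high_output {κ : ℝ}
    (hfst : SqBound (pairs (piece l n₁) (piece h n₂) (piece h' n₃)) κ)
    (hfst' : SqBound (pairs (piece l n₁) (piece h' n₃) (piece h n₂)) κ)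
    (hsum : SqBound (pairs (piece h n₂) (piece h' n₃) (piece l n₁)) κ) :
    SqBound (pairs (piece l n₁) (piece h n₂) (piece h' n₃)) κ ∧
    SqBound (pairs (Neg.neg ⁻¹' piece l n₁) (piece h n₂) (piece h' n₃)) κ ∧
    SqBound (pairs (piece l n₁) (Neg.neg ⁻¹' piece h n₂) (piece h' n₃)) κ :=
  -- Conjugating the low factor only interchanges the high factor and the output. Conjugating the
  -- high factor makes the low frequency the sum.
  ⟨hfst, TriBound.reflect hfst', TriBound.pairs_swap (measurableSet_neg_piece _ _)
    (measurableSet_piece _ _) (measurableSet_piece _ _) (TriBound.reflect hsum)⟩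

/-- Two high frequency factors, either of them conjugated, with low frequency output. -/
lemma sqBound_high_high_output {κ : ℝ}
    (hfst : SqBound (pairs (piece l n₃) (piece h n₁) (piece h' n₂)) κ)
    (hfst' : SqBound (pairs (piece l n₃) (piece h' n₂) (piece h n₁)) κ)
    (hsum : SqBound (pairs (piece h n₁) (piece h' n₂) (piece l n₃)) κ) :
    SqBound (pairs (piece h n₁) (piece h' n₂) (piece l n₃)) κ ∧
    SqBound (pairs (Neg.neg ⁻¹' piece h n₁) (piece h' n₂) (piece l n₃)) κ ∧
    SqBound (pairs (piece h n₁) (Neg.neg ⁻¹' piece h' n₂) (piece l n₃)) κ :=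
  -- Conjugating either high factor makes the low output a summand.
  ⟨hsum, TriBound.reflect (TriBound.pairs_swap (measurableSet_piece _ _)
    (measurableSet_piece _ _) (measurableSet_piece _ _) hfst),
    TriBound.pairs_swap (measurableSet_neg_piece _ _) (measurableSet_piece _ _)
      (measurableSet_piece _ _) (TriBound.reflect (TriBound.pairs_swap (measurableSet_piece _ _)
        (measurableSet_piece _ _) (measurableSet_piece _ _) hfst'))⟩

end Conjugates


/-! ### Exponents -/

lemma two_rpow_half_sq (x : ℝ) : ((2 : ℝ) ^ (x / 2)) ^ 2 = 2 ^ x := by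
  rw [← Real.rpow_natCast, ← Real.rpow_mul two_pos.le]
  congr 1
  push_cast
  ring

lemma rpow_neg_half_sq {m : ℝ} (hm : 0 < m) : (m ^ (-(1 / 2) : ℝ)) ^ 2 = m⁻¹ := by
  rw [← Real.rpow_natCast, ← Real.rpow_mul hm.le, ← Real.rpow_neg_one]
  norm_num

lemma two_pow_toNat {i : ℕ} {ℓ : ℤ} (h : ℓ ∈ exponents i) :
    (2 : ℝ) ^ ((i : ℤ) + ℓ).toNat = 2 ^ i * (2 : ℝ) ^ ℓ := by
  have h0 : 0 ≤ (i : ℤ) + ℓ := by have := h.1; omega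
  rw [← zpow_natCast, Int.toNat_of_nonneg h0, zpow_add₀ two_ne_zero, zpow_natCast]

/-- The product of minimum and maximum is `d₂ d₃`, so dividing the smaller modulation by both leaves
the reciprocal of the larger. -/
lemma high_output_max_le {I J M d₂ d₃ : ℝ} (hI : 0 < I) (hJ : 0 < J) (hM : 0 < M) (h₂ : 0 < d₂)
    (h₃ : 0 < d₃) :
    2 ^ 7 * ((I * J) ^ 2 * (2 ^ 92 * (M * min (J * d₂) (J * d₃) * I / J)) /
      (M * (J * d₂) * (J * d₃))) ≤ 2 ^ 104 * (I ^ 3 * (max d₂ d₃)⁻¹) := by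
  have hmin : min (J * d₂) (J * d₃) = J * (d₂ * d₃) * (max d₂ d₃)⁻¹ := by
    have hpos : 0 < max d₂ d₃ := lt_max_of_lt_left h₂
    rw [← mul_min_of_nonneg _ _ hJ.le, ← min_mul_max d₂ d₃]
    field_simp
  rw [hmin]
  have hpos : 0 < (max d₂ d₃)⁻¹ := inv_pos.2 (lt_max_of_lt_left h₂)
  calc _ = 2 ^ 99 * (I ^ 3 * (max d₂ d₃)⁻¹) := by field_simp
    _ ≤ _ := by gcongr <;> norm_num

/-- The two high frequencies may differ by a factor `2`, so the order of the `d`'s need not be that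
of the modulations. The minimum is estimated by the modulation with the smaller `d`. -/
lemma low_output_max_le {I J K M d₁ d₂ : ℝ} (hI : 0 < I) (hJ : 0 < J) (hK : 0 < K) (hM : 0 < M)
    (h₁ : 0 < d₁) (h₂ : 0 < d₂) (hIJ : I ≤ 2 * J) :
    2 ^ 7 * ((I * J) ^ 2 * (2 ^ 92 * (M * min (I * d₁) (J * d₂) * K / J)) /
      (I * d₁ * (J * d₂) * M)) ≤ 2 ^ 104 * (K * J ^ 2 * (max d₁ d₂)⁻¹) := by
  rcases le_total d₁ d₂ with h | h
  · rw [max_eq_right h]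
    calc _ ≤ 2 ^ 7 * ((I * J) ^ 2 * (2 ^ 92 * (M * (I * d₁) * K / J)) /
          (I * d₁ * (J * d₂) * M)) := by gcongr; exact min_le_left _ _
      _ = 2 ^ 99 * (K * I ^ 2 * d₂⁻¹) := by field_simp
      _ ≤ 2 ^ 99 * (K * (2 * J) ^ 2 * d₂⁻¹) := by gcongr
      _ = 2 ^ 101 * (K * J ^ 2 * d₂⁻¹) := by ring
      _ ≤ _ := by gcongr <;> norm_num
  · rw [max_eq_left h]
    calc _ ≤ 2 ^ 7 * ((I * J) ^ 2 * (2 ^ 92 * (M * (J * d₂) * K / J)) /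
          (I * d₁ * (J * d₂) * M)) := by gcongr; exact min_le_right _ _
      _ = 2 ^ 99 * (K * (I * J) * d₁⁻¹) := by field_simp
      _ ≤ 2 ^ 99 * (K * (2 * J * J) * d₁⁻¹) := by gcongr
      _ = 2 ^ 100 * (K * J ^ 2 * d₁⁻¹) := by ring
      _ ≤ _ := by gcongr <;> norm_num

lemma two_pow_mul_div_le {i j : ℕ} (h : j ≤ i + 1) {a : ℝ} (ha : 0 ≤ a) :
    2 ^ 91 * (a / 2 ^ i) ≤ 2 ^ 92 * (a / 2 ^ j) := by
  have : (2 : ℝ) ^ j ≤ 2 * 2 ^ i := by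
    rw [← pow_succ']; exact pow_le_pow_right₀ (by norm_num) h
  calc 2 ^ 91 * (a / 2 ^ i) = 2 ^ 92 * (a / (2 * 2 ^ i)) := by field_simp
    _ ≤ _ := by gcongr

/-- High frequency output, bound in terms of the modulations. -/
lemma bilinearBound_high_output_max {φ₀ : ℝ → ℝ} (hφ : IsCutoff φ₀) (c : Fin 2 → Fin 2 → ℂ)
    {i j : ℕ} (hij : i ≤ j) {ℓ₁ ℓ₂ ℓ₃ : ℤ} (h₂ : ℓ₂ ∈ exponents j) (h₃ : ℓ₃ ∈ exponents j) :
    BilinearBound φ₀ c i j j ℓ₁ ℓ₂ ℓ₃ (estimateConst c * ((2 : ℝ) ^ (3 * (i : ℝ) / 2)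
      * (max ((2 : ℝ) ^ ℓ₂) ((2 : ℝ) ^ ℓ₃)) ^ (-(1 / 2) : ℝ))) := by
  set n₁ := ((i : ℤ) + ℓ₁).toNat with hn₁
  set n₂ := ((j : ℤ) + ℓ₂).toNat with hn₂
  set n₃ := ((j : ℤ) + ℓ₃).toNat with hn₃
  have e₂ : (2 : ℝ) ^ n₂ = 2 ^ j * (2 : ℝ) ^ ℓ₂ := two_pow_toNat h₂
  have e₃ : (2 : ℝ) ^ n₃ = 2 ^ j * (2 : ℝ) ^ ℓ₃ := two_pow_toNat h₃
  have hκ : (2 : ℝ) ^ 91 * (2 ^ n₁ * min (2 ^ n₂) (2 ^ n₃) * 2 ^ i / 2 ^ j) ≤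
      2 ^ 92 * (2 ^ n₁ * min (2 ^ n₂) (2 ^ n₃) * 2 ^ i / 2 ^ j) :=
    two_pow_mul_div_le (Nat.le_succ j) (by positivity)
  obtain ⟨s₁, s₂, s₃⟩ := sqBound_low_high_output
    ((sqBound_pairs_low_fst (n₁ := n₁) (n₂ := n₂) (n₃ := n₃) hij hij (by omega) (by omega)).1.mono_const hκ)
    ((sqBound_pairs_low_fst (n₁ := n₁) (n₂ := n₃) (n₃ := n₂) hij hij (by omega) (by omega)).1.mono_const
      (by rw [min_comm]; exact hκ))
    ((sqBound_pairs_low_sum (n₁ := n₁) (n₂ := n₂) (n₃ := n₃) hij hij (by omega) (by omega)).1.mono_const hκ)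
  refine bilinearBound_of_sqBound hφ c hn₁.symm hn₂.symm hn₃.symm (by positivity) s₁ s₂ s₃
    (by positivity) ?_
  rw [e₂, e₃, mul_pow ((2 : ℝ) ^ (3 * (i : ℝ) / 2)), two_rpow_half_sq, rpow_neg_half_sq (by positivity)]
  have : (2 : ℝ) ^ (3 * (i : ℝ)) = (2 ^ i) ^ 3 := by
    rw [mul_comm, Real.rpow_mul two_pos.le, Real.rpow_natCast]
    norm_cast
  rw [this]
  exact high_output_max_le (by positivity) (by positivity) (by positivity) (by positivity)
    (by positivity)

/-- High frequency output, bound in terms of the frequencies only. -/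
lemma bilinearBound_high_output {φ₀ : ℝ → ℝ} (hφ : IsCutoff φ₀) (c : Fin 2 → Fin 2 → ℂ)
    {i j : ℕ} (hij : i ≤ j) {ℓ₁ ℓ₂ ℓ₃ : ℤ}
    (h₁ : ℓ₁ ∈ exponents i) (hℓ : i + 5 ≤ j → ℓ₁ ≤ (i : ℤ) - 3) :
    BilinearBound φ₀ c i j j ℓ₁ ℓ₂ ℓ₃ (estimateConst c * (2 : ℝ) ^ (((i : ℝ) + (j : ℝ)) / 2)) := by
  set n₁ := ((i : ℤ) + ℓ₁).toNat with hn₁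
  set n₂ := ((j : ℤ) + ℓ₂).toNat with hn₂
  set n₃ := ((j : ℤ) + ℓ₃).toNat with hn₃
  -- In terms of `N = 2^i`, the restriction on `d₁` is exactly `M₁ ≤ N²/8`.
  have hcond : i + 6 ≤ j → n₁ + 3 ≤ 2 * i := fun h => by
    have := hℓ (by omega)
    have := h₁.1
    omega
  obtain ⟨s₁, s₂, s₃⟩ := sqBound_low_high_output
    ((sqBound_pairs_low_fst (n₁ := n₁) (n₂ := n₂) (n₃ := n₃) hij hij (by omega) (by omega)).2 hcond)
    (((sqBound_pairs_low_fst (n₁ := n₁) (n₂ := n₃) (n₃ := n₂) hij hij (by omega) (by omega)).2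
      hcond).mono_const (le_of_eq (by ring)))
    (sqBound_pairs_low_sum (n₁ := n₁) (n₂ := n₂) (n₃ := n₃) hij hij (by omega) (by omega)).2
  refine bilinearBound_of_sqBound hφ c hn₁.symm hn₂.symm hn₃.symm (by positivity) s₁ s₂ s₃
    (by positivity) ?_
  rw [two_rpow_half_sq, Real.rpow_add two_pos, Real.rpow_natCast, Real.rpow_natCast]
  calc _ = (2 : ℝ) ^ 98 * (2 ^ i * 2 ^ j) := by field_simp
    _ ≤ _ := by gcongr <;> norm_num

/-- Low frequency output, bound in terms of the modulations. -/
lemma bilinearBound_low_output_max {φ₀ : ℝ → ℝ} (hφ : IsCutoff φ₀) (c : Fin 2 → Fin 2 → ℂ)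
    {i j k : ℕ} (hij : i ≤ j + 1) (hji : j ≤ i + 1) (hk : k + 1 ≤ j) {ℓ₁ ℓ₂ ℓ₃ : ℤ}
    (h₁ : ℓ₁ ∈ exponents i) (h₂ : ℓ₂ ∈ exponents j) :
    BilinearBound φ₀ c i j k ℓ₁ ℓ₂ ℓ₃ (estimateConst c * ((2 : ℝ) ^ ((k : ℝ) / 2 + (j : ℝ))
      * (max ((2 : ℝ) ^ ℓ₁) ((2 : ℝ) ^ ℓ₂)) ^ (-(1 / 2) : ℝ))) := by
  set n₁ := ((i : ℤ) + ℓ₁).toNat with hn₁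
  set n₂ := ((j : ℤ) + ℓ₂).toNat with hn₂
  set n₃ := ((k : ℤ) + ℓ₃).toNat with hn₃
  have hki : k ≤ i := by omega
  have hkj : k ≤ j := by omega
  have e₁ : (2 : ℝ) ^ n₁ = 2 ^ i * (2 : ℝ) ^ ℓ₁ := two_pow_toNat h₁
  have e₂ : (2 : ℝ) ^ n₂ = 2 ^ j * (2 : ℝ) ^ ℓ₂ := two_pow_toNat h₂
  have hκ : ∀ h : ℕ, j ≤ h + 1 → (2 : ℝ) ^ 91 * (2 ^ n₃ * min (2 ^ n₁) (2 ^ n₂) * 2 ^ k / 2 ^ h) ≤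
      2 ^ 92 * (2 ^ n₃ * min (2 ^ n₁) (2 ^ n₂) * 2 ^ k / 2 ^ j) := fun h hh =>
    two_pow_mul_div_le hh (by positivity)
  obtain ⟨s₁, s₂, s₃⟩ := sqBound_high_high_output
    ((sqBound_pairs_low_fst (n₁ := n₃) (n₂ := n₁) (n₃ := n₂) hki hkj hij hji).1.mono_const (hκ i hji))
    ((sqBound_pairs_low_fst (n₁ := n₃) (n₂ := n₂) (n₃ := n₁) hkj hki hji hij).1.mono_const
      (by rw [min_comm]; exact hκ j (Nat.le_succ j)))
    ((sqBound_pairs_low_sum (n₁ := n₃) (n₂ := n₁) (n₃ := n₂) hki hkj hij hji).1.mono_const (hκ i hji))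
  refine bilinearBound_of_sqBound hφ c hn₁.symm hn₂.symm hn₃.symm (by positivity) s₁ s₂ s₃
    (by positivity) ?_
  have : (2 : ℝ) ^ (k + 2 * j : ℝ) = 2 ^ k * (2 ^ j) ^ 2 := by
    rw [Real.rpow_add two_pos, mul_comm (2 : ℝ) j, Real.rpow_mul two_pos.le, Real.rpow_natCast,
      Real.rpow_natCast, Real.rpow_two]
  rw [e₁, e₂, mul_pow ((2 : ℝ) ^ ((k : ℝ) / 2 + (j : ℝ))), show (k : ℝ) / 2 + j = (k + 2 * j) / 2 by ring,
    two_rpow_half_sq, rpow_neg_half_sq (by positivity), this]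
  refine low_output_max_le (by positivity) (by positivity) (by positivity) (by positivity)
    (by positivity) (by positivity) ?_
  rw [← pow_succ']; exact pow_le_pow_right₀ (by norm_num) hij

/-- Low frequency output, bound in terms of the frequencies only. -/
lemma bilinearBound_low_output {φ₀ : ℝ → ℝ} (hφ : IsCutoff φ₀) (c : Fin 2 → Fin 2 → ℂ)
    {i j k : ℕ} (hij : i ≤ j + 1) (hji : j ≤ i + 1) (hk : k + 1 ≤ j) {ℓ₁ ℓ₂ ℓ₃ : ℤ}
    (h₃ : ℓ₃ ∈ exponents k) (hℓ : k + 5 ≤ j → ℓ₃ ≤ (k : ℤ) - 3) :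
    BilinearBound φ₀ c i j k ℓ₁ ℓ₂ ℓ₃
      (estimateConst c * (2 : ℝ) ^ ((3 * (j : ℝ) - (k : ℝ)) / 2)) := by
  set n₁ := ((i : ℤ) + ℓ₁).toNat with hn₁
  set n₂ := ((j : ℤ) + ℓ₂).toNat with hn₂
  set n₃ := ((k : ℤ) + ℓ₃).toNat with hn₃
  have hki : k ≤ i := by omega
  have hkj : k ≤ j := by omega
  have hcond : k + 5 ≤ j → n₃ + 3 ≤ 2 * k := fun h => by
    have := hℓ h
    have := h₃.1
    omega
  have hκ : ∀ h : ℕ, j ≤ h + 1 → (2 : ℝ) ^ 91 * (2 ^ n₃ * 2 ^ n₁ * 2 ^ n₂ / (2 ^ k * 2 ^ h)) ≤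
      2 ^ 92 * (2 ^ n₃ * 2 ^ n₁ * 2 ^ n₂ / 2 ^ k / 2 ^ j) := fun h hh => by
    rw [← div_div]
    exact two_pow_mul_div_le hh (by positivity)
  obtain ⟨s₁, s₂, s₃⟩ := sqBound_high_high_output
    (((sqBound_pairs_low_fst (n₁ := n₃) (n₂ := n₁) (n₃ := n₂) hki hkj hij hji).2
      fun h => hcond (by omega)).mono_const (hκ i hji))
    (((sqBound_pairs_low_fst (n₁ := n₃) (n₂ := n₂) (n₃ := n₁) hkj hki hji hij).2
      fun h => hcond (by omega)).mono_const
      ((le_of_eq (by ring)).trans (hκ j (Nat.le_succ j))))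
    ((sqBound_pairs_low_sum (n₁ := n₃) (n₂ := n₁) (n₃ := n₂) hki hkj hij hji).2.mono_const (hκ i hji))
  refine bilinearBound_of_sqBound hφ c hn₁.symm hn₂.symm hn₃.symm (by positivity) s₁ s₂ s₃
    (by positivity) ?_
  have : (2 : ℝ) ^ (3 * (j : ℝ) - k) = (2 ^ j) ^ 3 / 2 ^ k := by
    rw [Real.rpow_sub two_pos, mul_comm (3 : ℝ) j, Real.rpow_mul two_pos.le, Real.rpow_natCast,
      Real.rpow_natCast]
    norm_cast
  have hIJ : (2 : ℝ) ^ i ≤ 2 * 2 ^ j := by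
    rw [← pow_succ']; exact pow_le_pow_right₀ (by norm_num) hij
  rw [two_rpow_half_sq, this]
  calc _ = (2 : ℝ) ^ 99 * ((2 ^ i) ^ 2 * 2 ^ j / 2 ^ k) := by field_simp
    _ ≤ (2 : ℝ) ^ 99 * ((2 * 2 ^ j) ^ 2 * 2 ^ j / 2 ^ k) := by gcongr
    _ = (2 : ℝ) ^ 101 * ((2 ^ j) ^ 3 / 2 ^ k) := by ring
    _ ≤ _ := by gcongr <;> norm_num

end SchrodingerBilinear

theorem mainTheorem7 (φ₀ : ℝ → ℝ) (hφ₀ : SchrodingerBilinear.IsCutoff φ₀)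
    (c : Fin 2 → Fin 2 → ℂ) :
    ∃ C : ℝ, 0 < C ∧
      -- outputs at the high frequency
      (∀ i j : ℕ, 1 ≤ i → i ≤ j →
        ∀ ℓ₁ ∈ SchrodingerBilinear.exponents i, ∀ ℓ₂ ∈ SchrodingerBilinear.exponents j,
        ∀ ℓ₃ ∈ SchrodingerBilinear.exponents j,
          (i + 5 ≤ j → ℓ₁ ≤ (i : ℤ) - 3) →
            SchrodingerBilinear.BilinearBound φ₀ c i j j ℓ₁ ℓ₂ ℓ₃
              (C * ((2 : ℝ) ^ (3 * (i : ℝ) / 2)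
                * (max ((2 : ℝ) ^ ℓ₂) ((2 : ℝ) ^ ℓ₃)) ^ (-(1 / 2) : ℝ))) ∧
            SchrodingerBilinear.BilinearBound φ₀ c i j j ℓ₁ ℓ₂ ℓ₃
              (C * (2 : ℝ) ^ (((i : ℝ) + (j : ℝ)) / 2))) ∧
      -- high-high interactions with output at low frequency
      (∀ i j k : ℕ, i ≤ j + 1 → j ≤ i + 1 → k + 1 ≤ j →
        ∀ ℓ₁ ∈ SchrodingerBilinear.exponents i, ∀ ℓ₂ ∈ SchrodingerBilinear.exponents j,
        ∀ ℓ₃ ∈ SchrodingerBilinear.exponents k,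
          ((k + 5 ≤ j → ℓ₃ ≤ (k : ℤ) - 2) →
            SchrodingerBilinear.BilinearBound φ₀ c i j k ℓ₁ ℓ₂ ℓ₃
              (C * ((2 : ℝ) ^ ((k : ℝ) / 2 + (j : ℝ))
                * (max ((2 : ℝ) ^ ℓ₁) ((2 : ℝ) ^ ℓ₂)) ^ (-(1 / 2) : ℝ)))) ∧
          ((k + 5 ≤ j → ℓ₃ ≤ (k : ℤ) - 3) →
            SchrodingerBilinear.BilinearBound φ₀ c i j k ℓ₁ ℓ₂ ℓ₃
              (C * (2 : ℝ) ^ ((3 * (j : ℝ) - (k : ℝ)) / 2)))) := by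
  refine ⟨SchrodingerBilinear.estimateConst c, SchrodingerBilinear.estimateConst_pos c, ?_, ?_⟩
  · intro i j _ hij ℓ₁ h₁ ℓ₂ h₂ ℓ₃ h₃ hℓ
    exact ⟨SchrodingerBilinear.bilinearBound_high_output_max hφ₀ c hij h₂ h₃,
      SchrodingerBilinear.bilinearBound_high_output hφ₀ c hij h₁ hℓ⟩
  · intro i j k hij hji hk ℓ₁ h₁ ℓ₂ h₂ ℓ₃ h₃
    exact ⟨fun _ => SchrodingerBilinear.bilinearBound_low_output_max hφ₀ c hij hji hk h₁ h₂,
      fun hℓ => SchrodingerBilinear.bilinearBound_low_output hφ₀ c hij hji hk h₃ hℓ⟩
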